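/- **Setting.** Let $\Lambda\subset J^1\mathbb R=(\mathbb R^3_{x,y,z},\ker(dz-y\,dx))$ be a Legendrian embedding of finitely many circles, lying in $\{x<0\}$, and finitely many arcs, lying in $\{x\le 0\}$ with exactly their endpoints in $\{x=0\}$. Assume that the front ($xz$-projection) of $\Lambda$ is generic (semicubical cusps and transverse double points only, also over $x=0$, so in particular no three arc ends have the same front projection), and that the fronts of the arcs and their reflections through the $z$-axis glue together smoothly: for each endpoint $(0,y,z)$ there is a smooth $F$ such that the front of $\Lambda$ near $(0,y,z)$ is the graph of $F$ over $x\le 0$ and the reflected front of $\Lambda$ near $(0,-y,z)\in\Lambda$ is the graph of $F$ over $x\ge 0$. Thus an endpoint either has $y=0$, or its front projection coincides with that of exactly one other endpoint $(0,-y,z)$ (a matched pair). The *front spin* $L\subset J^1\mathbb R^2$ is the Legendrian surface whose front is the rotation of the front of $\Lambda$ about the $z$-axis, where $J^0\mathbb R$ is embedded in $J^0\mathbb R^2$ as $\{x_2=0\}$; each matched pair gives a cone point of the front of $L$. **Cells.** Fix a cellular decomposition of the base projection of $\Lambda$ whose 0-cells include the projections of all cusps and crossings, and $0$ if $\Lambda$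 has arcs. Decompose the base projection of $L$ by the cells $e\subset\{x_2=0\}$, for each cell $e$ of $\Lambda$, and the cells $\hat e$, for each $e\ne\{0\}$, swept out by rotating $e$ through the polar angles in $(-\pi,\pi)$. Orient 1-cells radially outwards (also those of $\Lambda$) or counter-clockwise; each 2-cell has its inner vertex at angle $-\pi$ as initial and its outer vertex at angle $\pi$ as terminal vertex. **Cellular DGA.** It is the free unital associative $\mathbb Z/2$-algebra with one generator for each cell and each pair of sheets $S_p\prec S_q$ above the cell (meaning $z(S_p)>z(S_q)$; sheets are the components of the part of the Legendrian above the cell that are not contained in a cusp edge). For a $\mathbb Z/m$-valued Maslov potential $\mu$ the degree is $\mu(S_p)-\mu(S_q)-1$, $\mu(S_p)-\mu(S_q)$, $\mu(S_p)-\mu(S_q)+1$ for cells of dimension $0,1,2$. The differential is the derivation with, for the matrices $A,B,C$ of generators of a 0-, 1-, 2-cell, $$\partial A=A^2,\quad \partial B=A_+(I+B)+(I+B)A_-,\quad \partial C=A_{v_1}C+CA_{v_0}+\prod_{\gamma_+}(I+B_i)^{\pm1}+\prod_{\gamma_-}(I+B_i)^{\pm1},$$ where $A_\pm$ are the matrices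 of the terminal/initial vertices of a 1-cell, $v_0,v_1$ are the initial and terminal vertices of a 2-cell, $\gamma_\pm$ are the two boundary paths from $v_0$ to $v_1$ (later edges are written to the left, with exponent $-1$ for an edge traversed against its orientation), and matrices of boundary cells are indexed by the sheets of the given cell, with an additional entry $1$ for two sheets that meet in a cusp above a vertex (the matrix of an edge gets $0$). If there are cone points above a 0-cell joining the pairs of nearby sheets $(k_1,k_1+1),\dots,(k_r,k_r+1)$ (sheets numbered by decreasing $z$), then this 0-cell has generators $a_{i,j}$ for $i<j$, $(i,j)\ne(k_p,k_p+1)$, and the matrix $$U=U_r\cdots U_1,\qquad U_p=I+\sum_{\ell<k_p}a_{\ell,k_p+1}E_{\ell,k_p}+\sum_{k_p+1<\ell}a_{k_p,\ell}E_{k_p+1,\ell}$$ is inserted as an additional edge at a corner of an adjacent 2-cell. Here this corner is the one at the centre $0$ of the unique adjacent 2-cell, on the boundary path starting there clockwise. The cone points may be numbered in any order. A Maslov potential is locally constant away from cusps and cone points, and at those its value on the upper sheet is its value on the lower sheet plus one. **Suspension.** For a based DGA $(\mathcal A,\partial)$ and the sub-DGA $\mathcal L$ generated by a subset of the generators, the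 suspension of $\mathcal A$ relative to $\mathcal L$ has generators $a$ for all generators $a$ of $\mathcal A$, and $\hat a$ for those not in $\mathcal L$, with $|\hat a|=|a|+1$. Its differential is $\partial a$ as in $\mathcal A$ and $\partial\hat a=\Gamma(\partial a)$, where $\Gamma$ is the derivation with $\Gamma(a)=\hat a$ for generators $a\notin\mathcal L$ and $\Gamma(a)=0$ for generators $a\in\mathcal L$. The suspension of $\mathcal A$ is the one without $\mathcal L$ (every generator $a$ has an $\hat a$). **Proposition.** Let $\mu$ and $\nu$ be $\mathbb Z/m$-valued Maslov potentials on $\Lambda$ and on $L$, with $\nu=\mu$ on $\Lambda\cap\{x<0\}$ away from the cusps, and let $\mathcal A_\Lambda$, $\mathcal A_L$ be the resulting cellular DGAs for the decompositions above. 1. If $\Lambda$ has no arcs, then $(\mathcal A_L,\partial)$ is the suspension of $(\mathcal A_\Lambda,\partial)$. 2. If $\Lambda$ has arcs and the front projections of their endpoints are distinct, then $(\mathcal A_L,\partial)$ is the suspension of $(\mathcal A_\Lambda,\partial)$ relative to the sub-DGA generated by the generators above the 0-cell $\{0\}$. 3. If $\Lambda$ has arcs, with $r$ matched pairs of endpoints,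 then $(\mathcal A_L,\partial)$ is this relative suspension with $\Gamma(A)=0$ replaced by $\Gamma(A)=U-I$, where $A$ is the matrix of generators of $\mathcal A_\Lambda$ above the 0-cell $\{0\}$, and $U$ is the matrix above for the $r$ cone points. In each case "is" means: the bijection of generators that takes $a$ to the generator above the cell $e$, and $\hat a$ to the generator above $\hat e$, for the corresponding pairs of sheets, preserves degrees and commutes with the differentials. -/

import Mathlib

open Set Topology
open scoped ContDiff

noncomputable section

namespace CellularDGA

/-! ## Free algebras with a differential, derivations, suspensions -/

/-- The derivation `D` from the free algebra on `X` to an algebra `B` along the algebra map `φ`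
with `φ x = f x` and `D x = g x` on generators.  It is the second component of the algebra map
`x ↦ (f x, g x)` to the square-zero extension `B ⊕ B ε`.  Coefficients are in `ℤ/2`, so that no
signs occur in the Leibniz rule. -/
def derivAlong {X B : Type} [Ring B] [Algebra (ZMod 2) B] (f g : X → B) :
    FreeAlgebra (ZMod 2) X → B :=
  fun a => (FreeAlgebra.lift (ZMod 2)
    (fun x => (TrivSqZeroExt.inl (f x) + TrivSqZeroExt.inr (g x) : TrivSqZeroExt B B)) a).snd

theorem derivAlong_ι {X B : Type} [Ring B] [Algebra (ZMod 2) B] (f g : X → B) (x : X) :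
    derivAlong f g (FreeAlgebra.ι (ZMod 2) x) = g x := by
  simp [derivAlong]

theorem derivAlong_one {X B : Type} [Ring B] [Algebra (ZMod 2) B] (f g : X → B) :
    derivAlong f g 1 = 0 := by
  simp [derivAlong]

theorem derivAlong_add {X B : Type} [Ring B] [Algebra (ZMod 2) B] (f g : X → B)
    (a b : FreeAlgebra (ZMod 2) X) :
    derivAlong f g (a + b) = derivAlong f g a + derivAlong f g b := by
  simp [derivAlong]

theorem fst_lift {X B : Type} [Ring B] [Algebra (ZMod 2) B] (f g : X → B)
    (a : FreeAlgebra (ZMod 2) X) :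
    (FreeAlgebra.lift (ZMod 2)
      (fun x => (TrivSqZeroExt.inl (f x) + TrivSqZeroExt.inr (g x) : TrivSqZeroExt B B)) a).fst
      = FreeAlgebra.lift (ZMod 2) f a := by
  have h : (TrivSqZeroExt.fstHom (ZMod 2) B B).comp (FreeAlgebra.lift (ZMod 2)
      (fun x => (TrivSqZeroExt.inl (f x) + TrivSqZeroExt.inr (g x) : TrivSqZeroExt B B)))
      = FreeAlgebra.lift (ZMod 2) f := by
    ext x
    simp
  exact DFunLike.congr_fun h a

/-- Leibniz rule. -/
theorem derivAlong_mul {X B : Type} [Ring B] [Algebra (ZMod 2) B] (f g : X → B)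
    (a b : FreeAlgebra (ZMod 2) X) :
    derivAlong f g (a * b) = derivAlong f g a * FreeAlgebra.lift (ZMod 2) f b
      + FreeAlgebra.lift (ZMod 2) f a * derivAlong f g b := by
  unfold derivAlong
  rw [map_mul, TrivSqZeroExt.snd_mul, fst_lift, fst_lift, add_comm]
  rfl

/-- A based algebra with differential: a generating set, a `ℤ/m`-degree for every generator, and
the value of the differential on every generator.  The algebra is the free unital associative
`ℤ/2`-algebra on the generators. -/
structure Based (m : ℕ) where
  Gen : Type
  deg : Gen → ZMod m
  d : Gen → FreeAlgebra (ZMod 2) Gen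

/-- The underlying algebra. -/
abbrev Based.Alg {m : ℕ} (A : Based m) : Type := FreeAlgebra (ZMod 2) A.Gen

/-- The differential: the derivation with the given values on the generators. -/
def Based.diff {m : ℕ} (A : Based m) : A.Alg → A.Alg :=
  derivAlong (FreeAlgebra.ι (ZMod 2)) A.d

/-- The algebra map induced by a map of generating sets. -/
def mapGen {X Y : Type} (φ : X → Y) : FreeAlgebra (ZMod 2) X →ₐ[ZMod 2] FreeAlgebra (ZMod 2) Y :=
  FreeAlgebra.lift (ZMod 2) (fun x => FreeAlgebra.ι (ZMod 2) (φ x))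

/-- A bijection of generating sets is an isomorphism of based algebras with differential if it
preserves degrees and the induced algebra isomorphism commutes with the differentials. -/
def IsBasedIso {m : ℕ} {A B : Based m} (φ : A.Gen ≃ B.Gen) : Prop :=
  (∀ x, B.deg (φ x) = A.deg x) ∧ ∀ a : A.Alg, mapGen φ (A.diff a) = B.diff (mapGen φ a)

/-- The generators of a suspension relative to the subalgebra generated by `ℒ`:
`Sum.inl a` is `a`, and `Sum.inr a` is `â`, the latter only for `a ∉ ℒ`. -/
abbrev SuspGen {m : ℕ} (A : Based m) (ℒ : Set A.Gen) : Type := A.Gen ⊕ {a : A.Gen // a ∉ ℒ}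

open scoped Classical in
/-- The derivation `Γ` from `A` to the suspension: `Γ(a) = â` for a generator `a ∉ ℒ`, and
`Γ(a) = g a` for a generator `a ∈ ℒ`. -/
def suspΓ {m : ℕ} (A : Based m) (ℒ : Set A.Gen) (g : A.Gen → A.Alg) :
    A.Alg → FreeAlgebra (ZMod 2) (SuspGen A ℒ) :=
  derivAlong (fun a => FreeAlgebra.ι (ZMod 2) (Sum.inl a))
    (fun a => if h : a ∉ ℒ then FreeAlgebra.ι (ZMod 2) (Sum.inr ⟨a, h⟩) else mapGen Sum.inl (g a))

/-- The suspension of `A` relative to `ℒ`, with `Γ = g` on `ℒ`: the generators are the `a` and the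
`â` with `a ∉ ℒ`, the degrees are `|a|` and `|â| = |a| + 1`, and the differential is `∂ a` (as in
`A`) and `∂ â = Γ(∂ a)`. -/
def modifiedSuspension {m : ℕ} (A : Based m) (ℒ : Set A.Gen) (g : A.Gen → A.Alg) : Based m where
  Gen := SuspGen A ℒ
  deg := Sum.elim A.deg (fun a => A.deg a.1 + 1)
  d := Sum.elim (fun a => mapGen Sum.inl (A.d a)) (fun a => suspΓ A ℒ g (A.d a.1))

/-- The suspension relative to the sub-DGA generated by `ℒ`, where `Γ = 0` on `ℒ`. -/
def relSuspension {m : ℕ} (A : Based m) (ℒ : Set A.Gen) : Based m :=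
  modifiedSuspension A ℒ (fun _ => 0)

/-- The suspension. -/
def suspension {m : ℕ} (A : Based m) : Based m := relSuspension A ∅

/-! ## 1-jet spaces, sheets, Maslov potentials -/

/-- The 1-jet space of a Euclidean space `V`; a point is `(x, y, z)` with contact form
`dz - y dx`, where covectors are identified with vectors by the inner product.  We use `V = ℝ` and
`V = ℂ = ℝ²`. -/
abbrev J1 (V : Type) : Type := V × V × ℝ

/-- The part of `L` above a subset `K` of the base. -/
def partOver {V : Type} (L : Set (J1 V)) (K : Set V) : Set (J1 V) := {p ∈ L | p.1 ∈ K}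

/-- The points of `L` near which the base projection `L → V` is not injective.  For a Legendrian
whose front is generic (without swallowtails) up to cone points, these are the points on the cusp
edges and on the circles that are collapsed to cone points. -/
def foldLocus {V : Type} [TopologicalSpace V] (L : Set (J1 V)) : Set (J1 V) :=
  {p ∈ L | ∀ N ∈ 𝓝 p, ¬ InjOn Prod.fst (L ∩ N)}

/-- The preimage in `L` of a cone point is a circle in a fibre of the base projection. -/
def IsConeCircle {V : Type} [TopologicalSpace V] (C : Set (J1 V)) : Prop :=
  (∃ x, ∀ p ∈ C, p.1 = x) ∧ Nonempty (C ≃ₜ Circle)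

/-- Sheets of `L` above a cell `K`: the connected components of the part of `L` above `K` that are
not contained in a cusp edge.  At a 0-cell below a cone point, a collapsed circle `C` stands for the
two sheets near the 0-cell that meet in the cone point: `(C, false)` for the upper one and
`(C, true)` for the lower one. -/
def IsSheet {V : Type} [TopologicalSpace V] (L : Set (J1 V)) (K : Set V)
    (S : Set (J1 V) × Bool) : Prop :=
  (∃ p ∈ partOver L K, S.1 = connectedComponentIn (partOver L K) p) ∧
    (IsConeCircle S.1 ∨ (¬ S.1 ⊆ foldLocus L ∧ S.2 = false))

/-- The set of sheets of `L` above `K`. -/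
def Sheet {V : Type} [TopologicalSpace V] (L : Set (J1 V)) (K : Set V) : Type :=
  {S : Set (J1 V) × Bool // IsSheet L K S}

/-- The set of points of a sheet. -/
def Sheet.pts {V : Type} [TopologicalSpace V] {L : Set (J1 V)} {K : Set V} (S : Sheet L K) :
    Set (J1 V) := S.1.1

/-- Whether the sheet is the lower one of the two sheets meeting in a cone point. -/
def Sheet.lower {V : Type} [TopologicalSpace V] {L : Set (J1 V)} {K : Set V} (S : Sheet L K) :
    Bool := S.1.2

/-- The partial order of sheets, `S ≺ S'`: the sheet `S` has larger `z`-coordinate than `S'`. -/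
def Above {V : Type} [TopologicalSpace V] {L : Set (J1 V)} {K : Set V} (S S' : Sheet L K) : Prop :=
  ∀ p ∈ S.pts, ∀ q ∈ S'.pts, p.1 = q.1 → q.2.2 < p.2.2

/-- `μ` is a `ℤ/m`-valued Maslov potential for `L`: it is locally constant on the part of `L` where
the front is locally a graph, and near a cusp or a cone point its value on the upper sheet is its
value on the lower sheet plus one.  (The values of `μ` elsewhere do not matter.) -/
def IsMaslov {V : Type} [TopologicalSpace V] {m : ℕ} (L : Set (J1 V)) (μ : J1 V → ZMod m) : Prop :=
  (∀ p ∈ L, p ∉ foldLocus L → ∀ᶠ q in 𝓝[L] p, μ q = μ p) ∧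
  ∀ p ∈ foldLocus L, ∃ N : Set (J1 V), IsOpen N ∧ connectedComponentIn (partOver L {p.1}) p ⊆ N ∧
    ∀ q ∈ L ∩ N, ∀ q' ∈ L ∩ N, q.1 = q'.1 → q'.2.2 < q.2.2 → μ q = μ q' + 1

open scoped Classical in
/-- The value of a Maslov potential on a sheet; for the two sheets at a cone point it is the value
on the upper, resp. lower, sheet near the cone point. -/
def sheetVal {V : Type} [TopologicalSpace V] {m : ℕ} {L : Set (J1 V)} {K : Set V}
    (μ : J1 V → ZMod m) (S : Sheet L K) : ZMod m :=
  if IsConeCircle S.pts then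
    Classical.epsilon (fun k => ∀ N : Set (J1 V), IsOpen N → S.pts ⊆ N →
      ∃ q ∈ L ∩ N, ∃ q' ∈ L ∩ N, q.1 = q'.1 ∧ q'.2.2 < q.2.2 ∧
        (if S.lower = true then μ q' else μ q) = k)
  else Classical.epsilon (fun k => ∃ p ∈ S.pts, μ p = k)

/-! ## Polygonal decompositions -/

/-- A step of a path along the boundary of a polygon: an edge, traversed along (`true`) or against
(`false`) its orientation; or an extra edge at a corner that is marked with the matrix `U` of the
cone points above the vertex, listed by their heights.  The point `u` is a point of the boundary of
the polygon in the interior of the (extra) edge. -/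
inductive Step (Vert Edge : Type) : Type
  | edge (e : Edge) (forward : Bool) (u : ℝ × ℝ) : Step Vert Edge
  | corner (v : Vert) (u : ℝ × ℝ) (heights : List ℝ) : Step Vert Edge

/-- A decomposition of a part of the base `V` into 0-cells, open 1-cells and open 2-cells.  The
characteristic maps are defined on `[0,1]` and on the closed disc `[0,1]²`.  Every 2-cell has an
initial vertex `v0` at the boundary point `p0` of `[0,1]²` and a terminal vertex `v1` at the
boundary point `p1`; the steps of the counter-clockwise and of the clockwise path from `p0` to `p1`
along the boundary are listed in `ccw` and `cw`.  A side of the square that is collapsed to a vertex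
does not count as an edge. -/
structure Decomp (V : Type) where
  Vert : Type
  Edge : Type
  Face : Type
  pt : Vert → V
  path : Edge → ℝ → V
  src : Edge → Vert
  tgt : Edge → Vert
  chart : Face → ℝ × ℝ → V
  v0 : Face → Vert
  v1 : Face → Vert
  p0 : Face → ℝ × ℝ
  p1 : Face → ℝ × ℝ
  ccw : Face → List (Step Vert Edge)
  cw : Face → List (Step Vert Edge)

/-- The cells. -/
inductive Cell {V : Type} (E : Decomp V) : Type
  | vert (v : E.Vert) : Cell E
  | edge (e : E.Edge) : Cell E
  | face (f : E.Face) : Cell E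

/-- The open interval, the interior of the domain of the characteristic map of a 1-cell. -/
def openI : Set ℝ := Ioo 0 1

/-- The open square, the interior of the domain of the characteristic map of a 2-cell. -/
def openSq : Set (ℝ × ℝ) := Ioo 0 1 ×ˢ Ioo 0 1

/-- The subset of the base that is the (open) cell. -/
def Cell.carrier {V : Type} {E : Decomp V} : Cell E → Set V
  | .vert v => {E.pt v}
  | .edge e => E.path e '' openI
  | .face f => E.chart f '' openSq

/-! ## The cellular DGA -/

/-- The generators: one for every cell and every pair of sheets `S ≺ S'` above the cell. -/
def Gen {V : Type} [TopologicalSpace V] (L : Set (J1 V)) (E : Decomp V) : Type :=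
  Σ c : Cell E, {S : Sheet L c.carrier × Sheet L c.carrier // Above S.1 S.2}

/-- The algebra. -/
abbrev Alg {V : Type} [TopologicalSpace V] (L : Set (J1 V)) (E : Decomp V) : Type :=
  FreeAlgebra (ZMod 2) (Gen L E)

/-- The product of matrices (all index sets of interest are finite). -/
def mmul {I A : Type} [Ring A] (M N : Matrix I I A) : Matrix I I A :=
  fun i j => ∑ᶠ k, M i k * N k j

open scoped Classical in
/-- The identity matrix. -/
def mone (I A : Type) [Ring A] : Matrix I I A := 1

/-- Powers of a matrix. -/
def mpow {I A : Type} [Ring A] (M : Matrix I I A) : ℕ → Matrix I I A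
  | 0 => mone I A
  | k + 1 => mmul (mpow M k) M

/-- `(I + M)⁻¹ = I + M + M² + ⋯` for a nilpotent matrix `M` in characteristic 2. -/
def invOneAdd {I A : Type} [Ring A] (M : Matrix I I A) : Matrix I I A :=
  fun i j => ∑ᶠ k : ℕ, mpow M k i j

open scoped Classical in
/-- The matrix of the generators of a cell, indexed by the sheets above the cell; the entry is `0`
for a pair of sheets without a generator. -/
def gmat {V : Type} [TopologicalSpace V] (L : Set (J1 V)) (E : Decomp V) (c : Cell E) :
    Matrix (Sheet L c.carrier) (Sheet L c.carrier) (Alg L E) :=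
  fun S S' => if h : Above S S' then FreeAlgebra.ι (ZMod 2) (⟨c, ⟨(S, S'), h⟩⟩ : Gen L E) else 0

/-- Let `χ : T → V` be a characteristic map of a cell with interior `D` of its domain, `u` a boundary
point of the domain, `S` a subset of `L` above the cell.  The point `p` of `L` above `χ u` is a limit
of points of `S` as `u` is approached in the cell. -/
def Touches {V T : Type} [TopologicalSpace V] [TopologicalSpace T] (D : Set T) (χ : T → V) (u : T)
    (S : Set (J1 V)) (p : J1 V) : Prop :=
  (u, p) ∈ closure {w : T × J1 V | w.1 ∈ D ∧ w.2 ∈ S ∧ w.2.1 = χ w.1}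

/-- The sheet `P` above a cell in the boundary belongs to the closure of the sheet `S`, where the
boundary cell occurs at the boundary point `u` of the domain of the characteristic map.  If `P` is
one of the two sheets at a cone point, then `S` has to be the upper, resp. the lower, one of the two
sheets that meet there. -/
def Limits {V T : Type} [TopologicalSpace V] [TopologicalSpace T] {L : Set (J1 V)} {K K' : Set V}
    (D : Set T) (χ : T → V) (u : T) (S : Sheet L K) (P : Sheet L K') : Prop :=
  (∃ p ∈ P.pts, Touches D χ u S.pts p) ∧
  (IsConeCircle P.pts → ∃ S' : Sheet L K, (∃ p ∈ P.pts, Touches D χ u S'.pts p) ∧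
    if P.lower = true then Above S' S else Above S S')

/-- The sheets `S` and `S'`, with `S ≺ S'`, meet in a cusp above the boundary point `u`. -/
def MeetInCusp {V T : Type} [TopologicalSpace V] [TopologicalSpace T] {L : Set (J1 V)} {K : Set V}
    (D : Set T) (χ : T → V) (u : T) (S S' : Sheet L K) : Prop :=
  Above S S' ∧ ∃ p ∈ foldLocus L, Touches D χ u S.pts p ∧ Touches D χ u S'.pts p

open scoped Classical in
/-- A matrix indexed by `J` placed into a matrix indexed by `I`, where `r` relates every index in `J`
to its position in `I`; the remaining entries are `0`. -/
def place {I J A : Type} [Ring A] (r : I → J → Prop) (M : Matrix J J A) : Matrix I I A :=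
  fun i i' => if h : ∃ j : J × J, r i j.1 ∧ r i' j.2 then M h.choose.1 h.choose.2 else 0

open scoped Classical in
/-- The matrix associated to a vertex `v` at the boundary point `u` of a 1- or 2-cell with sheets
above `K`: the generators of `v` at their positions, and an entry `1` for every pair of sheets that
meet in a cusp above `v`. -/
def vertMat {V T : Type} [TopologicalSpace V] [TopologicalSpace T] (L : Set (J1 V)) (E : Decomp V)
    (K : Set V) (D : Set T) (χ : T → V) (u : T) (v : E.Vert) :
    Matrix (Sheet L K) (Sheet L K) (Alg L E) :=
  fun S S' => place (Limits D χ u) (gmat L E (.vert v)) S S' +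
    if MeetInCusp D χ u S S' then 1 else 0

open scoped Classical in
/-- The matrix `∑_{ℓ < k} a_{ℓ,k+1} E_{ℓ,k} + ∑_{k+1 < ℓ} a_{k,ℓ} E_{k+1,ℓ}` of a cone point joining
the sheets `k = up` and `k + 1 = low`, for the strictly upper triangular matrix `a` of generators
(whose entry `a_{k,k+1}` is `0`). -/
def coneMat {I A : Type} [Ring A] (a : Matrix I I A) (up low : I) : Matrix I I A :=
  fun i j => (if j = up then a i low else 0) + (if i = low then a up j else 0)

open scoped Classical in
/-- The matrix `U_p` of the cone point that joins the pair of sheets satisfying `P`. -/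
def coneFactor {I A : Type} [Ring A] (a : Matrix I I A) (P : I × I → Prop) : Matrix I I A :=
  if h : ∃ r, P r then mone I A + coneMat a h.choose.1 h.choose.2 else mone I A

/-- The matrix `U = U_r ⋯ U_1` of the cone points of heights `z_1, …, z_r`; the `p`-th cone point
joins the pair of sheets that satisfies `P z_p`. -/
def coneU {I A : Type} [Ring A] (a : Matrix I I A) (P : ℝ → I × I → Prop) (heights : List ℝ) :
    Matrix I I A :=
  heights.foldl (fun M z => mmul (coneFactor a (P z)) M) (mone I A)

/-- The pair of the upper and the lower sheet at the cone point of height `z`. -/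
def ConePair {V : Type} [TopologicalSpace V] {L : Set (J1 V)} {K : Set V} (z : ℝ)
    (r : Sheet L K × Sheet L K) : Prop :=
  IsConeCircle r.1.pts ∧ r.1.pts = r.2.pts ∧ r.1.lower = false ∧ r.2.lower = true ∧
    ∀ p ∈ r.1.pts, p.2.2 = z

/-- The factor of a step in the boundary of a 2-cell. -/
def stepMat {V : Type} [TopologicalSpace V] (L : Set (J1 V)) (E : Decomp V) (f : E.Face) :
    Step E.Vert E.Edge →
      Matrix (Sheet L (Cell.face f).carrier) (Sheet L (Cell.face f).carrier) (Alg L E)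
  | .edge e true u =>
      mone _ _ + place (Limits openSq (E.chart f) u) (gmat L E (.edge e))
  | .edge e false u =>
      invOneAdd (place (Limits openSq (E.chart f) u) (gmat L E (.edge e)))
  | .corner v u heights =>
      mone _ _ + place (Limits openSq (E.chart f) u)
        (coneU (gmat L E (.vert v)) ConePair heights - mone _ _)

/-- The product of the factors of a path `s_1, …, s_j`, with the factor of `s_1` rightmost. -/
def pathMat {V : Type} [TopologicalSpace V] (L : Set (J1 V)) (E : Decomp V) (f : E.Face)
    (l : List (Step E.Vert E.Edge)) :
    Matrix (Sheet L (Cell.face f).carrier) (Sheet L (Cell.face f).carrier) (Alg L E) :=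
  l.foldl (fun M s => mmul (stepMat L E f s) M) (mone _ _)

/-- The matrix `∂ X` for the matrix `X` of generators of a cell:
`∂ A = A²`, `∂ B = A₊ (I + B) + (I + B) A₋`, and
`∂ C = A_{v1} C + C A_{v0} + (I + B_j)^{±1} ⋯ (I + B_1)^{±1} + (I + B_m)^{±1} ⋯ (I + B_{j+1})^{±1}`. -/
def dmat {V : Type} [TopologicalSpace V] (L : Set (J1 V)) (E : Decomp V) :
    (c : Cell E) → Matrix (Sheet L c.carrier) (Sheet L c.carrier) (Alg L E)
  | .vert v => mmul (gmat L E (.vert v)) (gmat L E (.vert v))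
  | .edge e =>
      mmul (vertMat L E _ openI (E.path e) 1 (E.tgt e)) (mone _ _ + gmat L E (.edge e)) +
      mmul (mone _ _ + gmat L E (.edge e)) (vertMat L E _ openI (E.path e) 0 (E.src e))
  | .face f =>
      mmul (vertMat L E _ openSq (E.chart f) (E.p1 f) (E.v1 f)) (gmat L E (.face f)) +
      mmul (gmat L E (.face f)) (vertMat L E _ openSq (E.chart f) (E.p0 f) (E.v0 f)) +
      pathMat L E f (E.ccw f) + pathMat L E f (E.cw f)

/-- The shift in the degree `μ(S) - μ(S') + (dim - 1)` of a generator. -/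
def Cell.shift {V : Type} {E : Decomp V} (m : ℕ) : Cell E → ZMod m
  | .vert _ => -1
  | .edge _ => 0
  | .face _ => 1

/-- The cellular DGA of `L`, for the decomposition `E` and the Maslov potential `μ`. -/
def cellularDGA {V : Type} [TopologicalSpace V] {m : ℕ} (L : Set (J1 V)) (E : Decomp V)
    (μ : J1 V → ZMod m) : Based m where
  Gen := Gen L E
  deg := fun x => sheetVal μ x.2.1.1 - sheetVal μ x.2.1.2 + x.1.shift m
  d := fun x => dmat L E x.1 x.2.1.1 x.2.1.2

/-! ## 1-dimensional Legendrians with boundary on the axis -/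

/-- A Legendrian embedding in `J¹ℝ` of a union of circles, in `x < 0`, and arcs, in `x ≤ 0` with
exactly their endpoints in `x = 0`. -/
structure Leg where
  numCircles : ℕ
  numArcs : ℕ
  circle : Fin numCircles → ℝ → J1 ℝ
  arc : Fin numArcs → ℝ → J1 ℝ
  circle_periodic : ∀ i t, circle i (t + 1) = circle i t
  circle_smooth : ∀ i, ContDiff ℝ ∞ (circle i)
  arc_smooth : ∀ j, ContDiff ℝ ∞ (arc j)
  circle_regular : ∀ i t, deriv (circle i) t ≠ 0
  arc_regular : ∀ j, ∀ t ∈ Icc (0 : ℝ) 1, deriv (arc j) t ≠ 0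
  circle_legendrian : ∀ i t, deriv (fun s => (circle i s).2.2) t
    = (circle i t).2.1 * deriv (fun s => (circle i s).1) t
  arc_legendrian : ∀ j, ∀ t ∈ Icc (0 : ℝ) 1, deriv (fun s => (arc j s).2.2) t
    = (arc j t).2.1 * deriv (fun s => (arc j s).1) t
  embedded : Function.Injective (Sum.elim
    (fun q : Fin numCircles × Ico (0 : ℝ) 1 => circle q.1 q.2)
    (fun q : Fin numArcs × Icc (0 : ℝ) 1 => arc q.1 q.2))
  circle_neg : ∀ i t, (circle i t).1 < 0
  arc_neg : ∀ j, ∀ t ∈ Ioo (0 : ℝ) 1, (arc j t).1 < 0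
  arc_zero : ∀ j, (arc j 0).1 = 0
  arc_one : ∀ j, (arc j 1).1 = 0

/-- The underlying subset of `J¹ℝ`. -/
def Leg.carrier (Λ : Leg) : Set (J1 ℝ) :=
  (⋃ i, range (Λ.circle i)) ∪ ⋃ j, Λ.arc j '' Icc 0 1

/-- The front of `Λ` and its reflection through the `z`-axis glue together smoothly: for every
endpoint `(0, y, z)` there is a smooth function `F` such that near the endpoint the front of `Λ` is
the graph of `F` over `x ≤ 0`, and such that the reflection of the front of `Λ` near
`(0, -y, z)` is the graph of `F` over `x ≥ 0`.  (In particular `(0, -y, z)` is an endpoint as well,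
possibly the same one.) -/
def Leg.GluesToReflection (Λ : Leg) : Prop :=
  ∀ p ∈ Λ.carrier, p.1 = 0 → ∃ F : ℝ → ℝ, ContDiff ℝ ∞ F ∧
    (∀ᶠ q in 𝓝 p, q ∈ Λ.carrier ↔ q.1 ≤ 0 ∧ q.2.1 = deriv F q.1 ∧ q.2.2 = F q.1) ∧
    (∀ᶠ q in 𝓝 ((0, -p.2.1, p.2.2) : J1 ℝ),
      q ∈ Λ.carrier ↔ q.1 ≤ 0 ∧ q.2.1 = -deriv F (-q.1) ∧ q.2.2 = F (-q.1))

/-- The front of `Λ` is generic: its singularities are semicubical cusps and transverse double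
points, no triple point occurs (also not over `x = 0`), and no strand passes through a cusp.  (Double
points are transverse because `Λ` is embedded.) -/
def Leg.GenericFront (Λ : Leg) : Prop :=
  (∀ i t, deriv (fun s => (Λ.circle i s).1) t = 0 →
    deriv (deriv (fun s => (Λ.circle i s).1)) t ≠ 0) ∧
  (∀ j, ∀ t ∈ Icc (0 : ℝ) 1, deriv (fun s => (Λ.arc j s).1) t = 0 →
    deriv (deriv (fun s => (Λ.arc j s).1)) t ≠ 0) ∧
  (∀ p ∈ Λ.carrier, ∀ q ∈ Λ.carrier, ∀ r ∈ Λ.carrier, p.1 = q.1 → p.2.2 = q.2.2 →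
    q.1 = r.1 → q.2.2 = r.2.2 → p = q ∨ q = r ∨ p = r) ∧
  (∀ p ∈ foldLocus Λ.carrier, ∀ q ∈ Λ.carrier, p.1 = q.1 → p.2.2 = q.2.2 → p = q)

/-- The finite set `T` is the set of 0-cells of a compatible cellular decomposition of the base
projection of `Λ`: it contains the base projections of all cusps and crossings, and `0` if `Λ` has
arcs. -/
def Leg.Compatible (Λ : Leg) (T : Finset ℝ) : Prop :=
  (T : Set ℝ) ⊆ Prod.fst '' Λ.carrier ∧
  (∀ p ∈ foldLocus Λ.carrier, p.1 ∈ T) ∧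
  (∀ p ∈ Λ.carrier, ∀ q ∈ Λ.carrier, p ≠ q → p.1 = q.1 → p.2.2 = q.2.2 → p.1 ∈ T) ∧
  (Λ.numArcs ≠ 0 → (0 : ℝ) ∈ T)

/-- The 1-cells: the intervals between successive 0-cells that are contained in the base projection.
A 1-cell is recorded as its endpoints `(t, t')` with `t' < t`; it is oriented from `t` to `t'`, i.e.
in the direction of the growing distance from the axis. -/
def LineEdge (Λ : Set (J1 ℝ)) (T : Finset ℝ) : Type :=
  {e : T × T // e.2.1 < e.1.1 ∧ (∀ t ∈ T, ¬ (e.2.1 < t ∧ t < e.1.1)) ∧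
    Ioo e.2.1 e.1.1 ⊆ Prod.fst '' Λ}

/-- The parametrization of a 1-cell. -/
def LineEdge.path {Λ : Set (J1 ℝ)} {T : Finset ℝ} (e : LineEdge Λ T) (s : ℝ) : ℝ :=
  (1 - s) * e.1.1.1 + s * e.1.2.1

/-- The cellular decomposition of the base projection of `Λ` with set of 0-cells `T`. -/
def lineDecomp (Λ : Set (J1 ℝ)) (T : Finset ℝ) : Decomp ℝ where
  Vert := T
  Edge := LineEdge Λ T
  Face := Empty
  pt := fun t => t.1
  path := LineEdge.path
  src := fun e => e.1.1
  tgt := fun e => e.1.2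
  chart := fun f => f.elim
  v0 := fun f => f.elim
  v1 := fun f => f.elim
  p0 := fun f => f.elim
  p1 := fun f => f.elim
  ccw := fun f => f.elim
  cw := fun f => f.elim

/-! ## The front spin -/

/-- The rotation by `u` of the point `(x₁, y₁, z)` of `J¹ℝ`, included in `J¹ℝ²` above `x₂ = 0`. -/
def spinPt (u : Circle) (p : J1 ℝ) : J1 ℂ := ((p.1 : ℂ) * u, (p.2.1 : ℂ) * u, p.2.2)

/-- The front spin: the Legendrian in `J¹ℝ²` whose front is the rotation of the front of `Λ` about
the `z`-axis. -/
def frontSpin (Λ : Set (J1 ℝ)) : Set (J1 ℂ) := {q | ∃ u : Circle, ∃ p ∈ Λ, q = spinPt u p}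

/-- The 0-cells of `Λ` that are not on the axis. -/
abbrev OffAxis (T : Finset ℝ) : Type := {t : T // t.1 ≠ 0}

/-- The point of the base at distance `-x` from the origin and with polar angle `2π φ - π`, so that
`φ = 0` and `φ = 1` both give the point `(x, 0)`. -/
def polar (x φ : ℝ) : ℂ := -(x : ℂ) * Complex.exp ((2 * Real.pi * φ - Real.pi : ℝ) * Complex.I)

open scoped Classical in
/-- The spun decomposition.  Every cell `e` of `Λ` gives a cell `e` above `x₂ = 0` and, unless it is
the 0-cell on the axis, a cell `ê` that is swept out by the rotation of `e` through the polar angles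
in `(-π, π)`.  All 1-cells are oriented in the positive polar direction (radially outward or
counter-clockwise).  The 2-cell `ê` is a polar rectangle, with its inner vertex at angle `-π` as
initial and its outer vertex at angle `π` as terminal vertex.  If it contains the axis in its
closure, then the inner side is collapsed, and the corner there is marked with the matrix `U` of the
cone points on the axis, of heights `heights`. -/
def spunDecomp (Λ : Set (J1 ℝ)) (T : Finset ℝ) (heights : List ℝ) : Decomp ℂ where
  Vert := T
  Edge := LineEdge Λ T ⊕ OffAxis T
  Face := LineEdge Λ T
  pt := fun t => (t.1 : ℂ)
  path := Sum.elim (fun e s => (e.path s : ℂ)) (fun t φ => polar t.1.1 φ)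
  src := Sum.elim (fun e => e.1.1) (fun t => t.1)
  tgt := Sum.elim (fun e => e.1.2) (fun t => t.1)
  chart := fun e w => polar (e.path w.1) w.2
  v0 := fun e => e.1.1
  v1 := fun e => e.1.2
  p0 := fun _ => (0, 0)
  p1 := fun _ => (1, 1)
  ccw := fun e => [Step.edge (Sum.inl e) true (1 / 2, 0)] ++
    (if h : e.1.2.1 ≠ 0 then [Step.edge (Sum.inr ⟨e.1.2, h⟩) true (1, 1 / 2)] else [])
  cw := fun e =>
    (if h : e.1.1.1 ≠ 0 then [Step.edge (Sum.inr ⟨e.1.1, h⟩) true (0, 1 / 2)]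
      else [Step.corner e.1.1 (0, 1 / 2) heights]) ++
    [Step.edge (Sum.inl e) true (1 / 2, 1)]

/-- `heights` lists, without repetition and in any order, the heights of the pairs of endpoints of
arcs with the same front projection. -/
def Leg.ListsMatchedEnds (Λ : Leg) (heights : List ℝ) : Prop :=
  heights.Nodup ∧ ∀ z, z ∈ heights ↔
    ∃ p ∈ Λ.carrier, ∃ q ∈ Λ.carrier, p ≠ q ∧ p.1 = 0 ∧ q.1 = 0 ∧ p.2.2 = z ∧ q.2.2 = z

/-- The fronts of the arcs have pairwise distinct endpoints. -/
def Leg.DistinctEnds (Λ : Leg) : Prop :=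
  ∀ p ∈ Λ.carrier, ∀ q ∈ Λ.carrier, p.1 = 0 → q.1 = 0 → p.2.2 = q.2.2 → p = q

/-- The cellular DGA of `Λ`. -/
def Leg.dga (Λ : Leg) {m : ℕ} (T : Finset ℝ) (μ : J1 ℝ → ZMod m) : Based m :=
  cellularDGA Λ.carrier (lineDecomp Λ.carrier T) μ

/-- The cellular DGA of the front spin of `Λ`. -/
def Leg.spunDga (Λ : Leg) {m : ℕ} (T : Finset ℝ) (heights : List ℝ) (ν : J1 ℂ → ZMod m) : Based m :=
  cellularDGA (frontSpin Λ.carrier) (spunDecomp Λ.carrier T heights) ν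

/-- The generators of the cellular DGA of `Λ` above the 0-cell on the axis. -/
def Leg.axisGens (Λ : Leg) {m : ℕ} (T : Finset ℝ) (μ : J1 ℝ → ZMod m) : Set (Λ.dga T μ).Gen :=
  {x : Gen Λ.carrier (lineDecomp Λ.carrier T) | ∃ t : T, t.1 = 0 ∧ x.1 = Cell.vert t}

/-- The pair of sheets of `Λ` above the axis that are matching endpoints of height `z`.  The upper one
is the endpoint of the upper strand near the axis, that is, the one with the smaller slope. -/
def MatchedPair {Λ : Set (J1 ℝ)} {K : Set ℝ} (z : ℝ) (r : Sheet Λ K × Sheet Λ K) : Prop :=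
  ∀ p ∈ r.1.pts, ∀ q ∈ r.2.pts, p.2.2 = z ∧ q.2.2 = z ∧ p.2.1 < q.2.1

/-- The entries of the matrix `U - I`, where `U = U_r ⋯ U_1` is formed from the matrix `A` of
generators of `Λ` above the 0-cell on the axis, and the `p`-th matched pair of endpoints is the
`(k_p, k_p + 1)`-st pair of sheets.  (Only the entries for the generators above the axis will be
used.) -/
def Leg.axisΓ (Λ : Leg) {m : ℕ} (T : Finset ℝ) (μ : J1 ℝ → ZMod m) (heights : List ℝ) :
    (Λ.dga T μ).Gen → (Λ.dga T μ).Alg :=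
  fun x : Gen Λ.carrier (lineDecomp Λ.carrier T) =>
    ((coneU (gmat Λ.carrier (lineDecomp Λ.carrier T) x.1) MatchedPair heights - mone _ _ :
      Matrix _ _ (Alg Λ.carrier (lineDecomp Λ.carrier T))) x.2.1.1 x.2.1.2 :
      Alg Λ.carrier (lineDecomp Λ.carrier T))

/-- The generator `y` of the front spin lies above the cell `e`, for the cell `e` of the generator
`x` of `Λ`, and belongs to the corresponding pair of sheets. -/
def IsBase {Λ : Set (J1 ℝ)} {T : Finset ℝ} {heights : List ℝ}
    (y : Gen (frontSpin Λ) (spunDecomp Λ T heights)) (x : Gen Λ (lineDecomp Λ T)) : Prop :=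
  ((∃ t : T, y.1 = Cell.vert t ∧ x.1 = Cell.vert t) ∨
    ∃ e : LineEdge Λ T, y.1 = Cell.edge (Sum.inl e) ∧ x.1 = Cell.edge e) ∧
  spinPt 1 '' x.2.1.1.pts ⊆ y.2.1.1.pts ∧ spinPt 1 '' x.2.1.2.pts ⊆ y.2.1.2.pts

/-- The generator `y` of the front spin lies above the spun cell `ê`, for the cell `e` of the
generator `x` of `Λ`, and belongs to the corresponding pair of sheets. -/
def IsSpun {Λ : Set (J1 ℝ)} {T : Finset ℝ} {heights : List ℝ}
    (y : Gen (frontSpin Λ) (spunDecomp Λ T heights)) (x : Gen Λ (lineDecomp Λ T)) : Prop :=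
  ((∃ t : OffAxis T, y.1 = Cell.edge (Sum.inr t) ∧ x.1 = Cell.vert t.1) ∨
    ∃ e : LineEdge Λ T, y.1 = Cell.face e ∧ x.1 = Cell.edge e) ∧
  ∀ u : Circle, u ≠ 1 →
    spinPt u '' x.2.1.1.pts ⊆ y.2.1.1.pts ∧ spinPt u '' x.2.1.2.pts ⊆ y.2.1.2.pts

/-- A bijection from the generators of a suspension of the cellular DGA of `Λ` to the generators of
the cellular DGA of the front spin is the canonical one: it sends `a` to the generator above the cell
`e`, and `â` to the generator above the spun cell `ê`, for the same pair of sheets. -/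
def IsCanonical {Λ : Leg} {m : ℕ} {T : Finset ℝ} {heights : List ℝ} {μ : J1 ℝ → ZMod m}
    {ν : J1 ℂ → ZMod m} (ℒ : Set (Λ.dga T μ).Gen)
    (φ : SuspGen (Λ.dga T μ) ℒ ≃ (Λ.spunDga T heights ν).Gen) : Prop :=
  (∀ x, IsBase (φ (Sum.inl x)) x) ∧ ∀ x, IsSpun (φ (Sum.inr x)) x.1

end CellularDGA

end

noncomputable section

namespace CellularDGA

/-! ## Fronts of 1-dimensional Legendrians -/

/-! Off the axis the front spin is the product of the part of `Λ` in `x < 0` with a circle. Hence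
the sheets above a cell `e`, and those above the swept out cell `ê`, are rotations of the sheets of
`Λ` above `e`, with the same order, the same limits, the same cusps and the same Maslov potential.
This identifies the generators; the degree of `â` exceeds that of `a` by one because the dimension
of the cell does. It remains to compare differentials, one matrix per cell.

Let `A` and `B` be the matrices of a 0-cell and a 1-cell of `Λ`, and `Â`, `B̂` those of the spun
cells. Above the cells in `x₂ = 0` the formulas are those of `Λ`. A spun 0-cell is a loop, so in
characteristic 2 `∂Â = A (I + Â) + (I + Â) A = A Â + Â A = Γ(A²)`. A spun 1-cell is a rectangle
whose two radial sides are the same 1-cell, so `∂B̂ = A₊ B̂ + B̂ A₋ + (I + Â₊)(I + B) + (I + B)(I +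
Â₋)`, where two summands `I + B` cancel and `Γ(A₊ (I + B) + (I + B) A₋)` remains. The entries `1` at
cusps are killed by `Γ`, in accordance with the rule that the matrix of an edge gets `0` there. If
the inner side of the rectangle is collapsed to the axis, then `U` replaces `I + Â₋`, and the same
computation holds with `Γ(A) = U - I`. Without matched pairs `U = I`, and without arcs no cell is on
the axis; so all three parts are instances of `exists_isBasedIso`.

The delicate geometry is above the origin. An endpoint `(0, y, z)` with `y ≠ 0` sweeps out the same
circle as `(0, -y, z)`, so two sheets of `Λ` correspond to one cone circle, which is counted twice.
Its upper copy belongs to `y < 0`, because over `x < 0` the strand of smaller slope is the higher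
one. This is carried by `exists_axisSheet`, `limits_vert_iff`, `conePair_iff` and
`VertCorr.sheetVal_eq`.

The topology rests on `exists_bijOn`: away from cusps and crossings nearby fibres of `Λ` are in
order preserving bijection. So the rank in the fibre is locally constant and sheets above 1-cells
are continuous sections (`exists_section`). Limits of sheets are rotated by `touches_spin`. The
algebra (`circle_transfer`, `face_transfer`) sees the geometry only through `SheetCorr.Compatible`.
-/

/-- The topological properties of a Legendrian with generic front and boundary on the axis that
determine its sheets and their order. -/
structure TameFront (Λ : Set (J1 ℝ)) (T : Finset ℝ) : Prop where
  compact : IsCompact Λ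
  nonpos : ∀ p ∈ Λ, p.1 ≤ 0
  finite_fibre : ∀ x, (partOver Λ {x}).Finite
  exists_near : ∀ p ∈ Λ, p.1 < 0 → p ∉ foldLocus Λ → ∀ N ∈ 𝓝 p, ∀ᶠ x in 𝓝 p.1, ∃ q ∈ Λ ∩ N, q.1 = x
  glue : ∀ p ∈ Λ, p.1 = 0 → ∃ F : ℝ → ℝ, ContDiff ℝ ∞ F ∧
    (∀ᶠ q in 𝓝 p, q ∈ Λ ↔ q.1 ≤ 0 ∧ q.2.1 = deriv F q.1 ∧ q.2.2 = F q.1) ∧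
    (∀ᶠ q in 𝓝 ((0, -p.2.1, p.2.2) : J1 ℝ),
      q ∈ Λ ↔ q.1 ≤ 0 ∧ q.2.1 = -deriv F (-q.1) ∧ q.2.2 = F (-q.1))
  no_triple : ∀ p ∈ Λ, ∀ q ∈ Λ, ∀ r ∈ Λ, p.1 = q.1 → p.2.2 = q.2.2 →
    q.1 = r.1 → q.2.2 = r.2.2 → p = q ∨ q = r ∨ p = r
  vert_sub : (T : Set ℝ) ⊆ Prod.fst '' Λ
  fold_mem : ∀ p ∈ foldLocus Λ, p.1 ∈ T
  crossing_mem : ∀ p ∈ Λ, ∀ q ∈ Λ, p ≠ q → p.1 = q.1 → p.2.2 = q.2.2 → p.1 ∈ T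

theorem not_mem_foldLocus {V : Type} [TopologicalSpace V] {L : Set (J1 V)} {p : J1 V}
    (hp : p ∈ L) : p ∉ foldLocus L ↔ ∃ N ∈ 𝓝 p, InjOn Prod.fst (L ∩ N) := by
  simp [foldLocus, hp]

/-- A locally constant function on a preconnected set is constant. -/
theorem eq_of_isPreconnected {X Y : Type*} [TopologicalSpace X] {S : Set X} (hS : IsPreconnected S)
    {f : X → Y} (hf : ∀ p ∈ S, ∀ᶠ q in 𝓝[S] p, f q = f p) {p q : X} (hp : p ∈ S) (hq : q ∈ S) :
    f p = f q := by
  let _ : TopologicalSpace Y := ⊥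
  have : DiscreteTopology Y := ⟨rfl⟩
  refine hS.constant (f := f) (fun x hx => ?_) hp hq
  have : f =ᶠ[𝓝[S] x] fun _ => f x := hf x hx
  exact (tendsto_const_nhds.congr' this.symm)

/-- Near a fibre of a compact set, the set is contained in any neighbourhood of the fibre. -/
theorem eventually_fibre_subset {X : Type*} [TopologicalSpace X] {Λ : Set (ℝ × X)}
    (hΛ : IsCompact Λ) (x₀ : ℝ) {N : Set (ℝ × X)} (hN : ∀ p ∈ Λ, p.1 = x₀ → N ∈ 𝓝 p) :
    ∀ᶠ x in 𝓝 x₀, ∀ p ∈ Λ, p.1 = x → p ∈ N := by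
  have hc : IsCompact (Λ \ interior N) := hΛ.diff isOpen_interior
  have hcl : IsClosed (Prod.fst '' (Λ \ interior N)) := (hc.image continuous_fst).isClosed
  have hx : x₀ ∈ (Prod.fst '' (Λ \ interior N))ᶜ := by
    rintro ⟨p, ⟨hp, hpN⟩, rfl⟩
    exact hpN (mem_interior_iff_mem_nhds.2 (hN p hp rfl))
  filter_upwards [hcl.isOpen_compl.mem_nhds hx] with x hx p hp hpx
  by_contra h
  exact hx ⟨p, ⟨hp, fun h' => h (interior_subset h')⟩, hpx⟩

/-! ### Local triviality of the fibres away from cusps and crossings -/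

namespace TameFront

variable {Λ : Set (J1 ℝ)} {T : Finset ℝ}

theorem isClosed (h : TameFront Λ T) : IsClosed Λ := h.compact.isClosed

/-- Near a fibre without cusps and crossings, the fibres are in an order preserving bijection that
moves points only slightly. -/
theorem exists_bijOn (h : TameFront Λ T) {x₀ : ℝ} (hx₀ : x₀ < 0) (hT : x₀ ∉ T)
    {N : J1 ℝ → Set (J1 ℝ)} (hN : ∀ p ∈ partOver Λ {x₀}, N p ∈ 𝓝 p) :
    ∀ᶠ x in 𝓝 x₀, ∃ b : J1 ℝ → J1 ℝ, BijOn b (partOver Λ {x₀}) (partOver Λ {x}) ∧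
      (∀ p ∈ partOver Λ {x₀}, b p ∈ N p) ∧
      ∀ p ∈ partOver Λ {x₀}, ∀ q ∈ partOver Λ {x₀}, (b q).2.2 < (b p).2.2 ↔ q.2.2 < p.2.2 := by
  classical
  have hfin := h.finite_fibre x₀
  have hz : ∀ p ∈ partOver Λ {x₀}, ∀ q ∈ partOver Λ {x₀}, p.2.2 = q.2.2 → p = q := by
    intro p hp q hq hpq
    by_contra hne
    exact hT (hp.2 ▸ h.crossing_mem p hp.1 q hq.1 hne (hp.2.trans hq.2.symm) hpq)
  have hinj : ∀ p ∈ partOver Λ {x₀}, ∃ M ∈ 𝓝 p, InjOn Prod.fst (Λ ∩ M) := by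
    intro p hp
    exact (not_mem_foldLocus hp.1).1 (fun hf => hT (hp.2 ▸ h.fold_mem p hf))
  choose! M hM hMinj using hinj
  -- The midpoints of the heights separate the points of the fibre, so that points close to `p` and
  -- `q` are ordered as `p` and `q` are.
  have hsep : ∀ p ∈ partOver Λ {x₀}, ∀ᶠ r in 𝓝 p, ∀ q ∈ partOver Λ {x₀},
      (q.2.2 < p.2.2 → (p.2.2 + q.2.2) / 2 < r.2.2) ∧
      (p.2.2 < q.2.2 → r.2.2 < (p.2.2 + q.2.2) / 2) := by
    intro p hp
    refine (Filter.eventually_all_finite hfin).2 fun q hq => ?_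
    have hc : Continuous fun r : J1 ℝ => r.2.2 := by fun_prop
    refine Filter.Eventually.and ?_ ?_
    · by_cases hlt : q.2.2 < p.2.2
      · filter_upwards [hc.continuousAt.eventually_const_lt
          (show (p.2.2 + q.2.2) / 2 < p.2.2 by linarith)] with r hr _ using hr
      · exact Filter.Eventually.of_forall fun r hr => absurd hr hlt
    · by_cases hlt : p.2.2 < q.2.2
      · filter_upwards [hc.continuousAt.eventually_lt_const
          (show p.2.2 < (p.2.2 + q.2.2) / 2 by linarith)] with r hr _ using hr
      · exact Filter.Eventually.of_forall fun r hr => absurd hr hlt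
  let W : J1 ℝ → Set (J1 ℝ) := fun p => N p ∩ M p ∩ {r | ∀ q ∈ partOver Λ {x₀},
      (q.2.2 < p.2.2 → (p.2.2 + q.2.2) / 2 < r.2.2) ∧
      (p.2.2 < q.2.2 → r.2.2 < (p.2.2 + q.2.2) / 2)}
  have hW : ∀ p ∈ partOver Λ {x₀}, W p ∈ 𝓝 p := fun p hp =>
    Filter.inter_mem (Filter.inter_mem (hN p hp) (hM p hp)) (hsep p hp)
  have hex : ∀ᶠ x in 𝓝 x₀, ∀ p ∈ partOver Λ {x₀}, ∃ q ∈ Λ ∩ W p, q.1 = x := by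
    refine (Filter.eventually_all_finite hfin).2 fun p hp => ?_
    have hp2 : p.1 = x₀ := hp.2
    have := h.exists_near p hp.1 (hp2 ▸ hx₀) (fun hf => hT (hp2 ▸ h.fold_mem p hf)) _ (hW p hp)
    rwa [hp2] at this
  -- By compactness nearby fibres have no points outside the sets `W p`; injectivity of the base
  -- projection on each `W p` leaves one point in each.
  have hcov := eventually_fibre_subset h.compact x₀ (N := ⋃ p ∈ partOver Λ {x₀}, W p) (by
    intro p hp hpx
    exact Filter.mem_of_superset (hW p ⟨hp, hpx⟩) (subset_biUnion_of_mem (u := W) (show p ∈ partOver Λ {x₀} from ⟨hp, hpx⟩)))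
  filter_upwards [hex, hcov] with x hx hxc
  choose! b hb hbx using hx
  have hlt : ∀ p ∈ partOver Λ {x₀}, ∀ q ∈ partOver Λ {x₀}, q.2.2 < p.2.2 →
      (b q).2.2 < (b p).2.2 := by
    intro p hp q hq hpq
    have h1 := ((hb p hp).2.2 q hq).1 hpq
    have h2 := ((hb q hq).2.2 p hp).2 hpq
    linarith
  refine ⟨b, ⟨fun p hp => ⟨(hb p hp).1, hbx p hp⟩, ?_, ?_⟩, fun p hp => (hb p hp).2.1.1, ?_⟩
  · intro p hp q hq hpq
    by_contra hne
    rcases lt_trichotomy p.2.2 q.2.2 with hl | he | hl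
    · exact absurd (hlt q hq p hp hl) (by rw [hpq]; exact lt_irrefl _)
    · exact hne (hz p hp q hq he)
    · exact absurd (hlt p hp q hq hl) (by rw [hpq]; exact lt_irrefl _)
  · intro q hq
    obtain ⟨p, hp, hqp⟩ := mem_iUnion₂.1 (hxc q hq.1 hq.2)
    refine ⟨p, hp, ?_⟩
    exact hMinj p hp ⟨(hb p hp).1, (hb p hp).2.1.2⟩ ⟨hq.1, hqp.1.2⟩
      ((hbx p hp).trans (mem_singleton_iff.1 hq.2).symm)
  · intro p hp q hq
    refine ⟨fun hl => ?_, hlt p hp q hq⟩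
    rcases lt_trichotomy q.2.2 p.2.2 with h1 | h1 | h1
    · exact h1
    · rw [hz q hq p hp h1] at hl; exact absurd hl (lt_irrefl _)
    · exact absurd hl (not_lt.2 (hlt q hq p hp h1).le)

end TameFront

/-- The number of points of `Λ` above `p` in the fibre of `p`. -/
def rank (Λ : Set (J1 ℝ)) (p : J1 ℝ) : ℕ := {q ∈ partOver Λ {p.1} | p.2.2 < q.2.2}.ncard

/-- The points above `p` correspond under `b` to the points above `b p`, and `b` is injective on the
fibre. -/
theorem rank_bijOn {Λ : Set (J1 ℝ)} {x₀ x : ℝ} {b : J1 ℝ → J1 ℝ}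
    (hb : BijOn b (partOver Λ {x₀}) (partOver Λ {x}))
    (hlt : ∀ p ∈ partOver Λ {x₀}, ∀ q ∈ partOver Λ {x₀}, (b q).2.2 < (b p).2.2 ↔ q.2.2 < p.2.2)
    {p : J1 ℝ} (hp : p ∈ partOver Λ {x₀}) : rank Λ (b p) = rank Λ p := by
  have h1 : (b p).1 = x := (hb.mapsTo hp).2
  have h2 : p.1 = x₀ := hp.2
  have : {q ∈ partOver Λ {x} | (b p).2.2 < q.2.2} = b '' {q ∈ partOver Λ {x₀} | p.2.2 < q.2.2} := by
    ext q
    constructor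
    · rintro ⟨hq, hql⟩
      obtain ⟨r, hr, rfl⟩ := hb.surjOn hq
      exact ⟨r, ⟨hr, (hlt r hr p hp).1 hql⟩, rfl⟩
    · rintro ⟨r, ⟨hr, hrl⟩, rfl⟩
      exact ⟨hb.mapsTo hr, (hlt r hr p hp).2 hrl⟩
  rw [rank, rank, h1, h2, this]
  exact InjOn.ncard_image (hb.injOn.mono fun q hq => hq.1)

namespace TameFront

variable {Λ : Set (J1 ℝ)} {T : Finset ℝ}

theorem rank_lt (h : TameFront Λ T) {p q : J1 ℝ} (hp : p ∈ Λ) (hpq : p.1 = q.1)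
    (hz : q.2.2 < p.2.2) : rank Λ p < rank Λ q := by
  unfold rank
  rw [← hpq]
  refine Set.ncard_lt_ncard ⟨fun r hr => ⟨hr.1, hz.trans hr.2⟩, fun hsub => ?_⟩
    ((h.finite_fibre p.1).subset fun r hr => hr.1)
  exact lt_irrefl _ (hsub ⟨⟨hp, rfl⟩, hz⟩).2

theorem eq_of_z (h : TameFront Λ T) {p q : J1 ℝ} (hp : p ∈ Λ) (hq : q ∈ Λ) (hT : p.1 ∉ T)
    (hpq : p.1 = q.1) (hz : p.2.2 = q.2.2) : p = q := by
  by_contra hne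
  exact hT (h.crossing_mem p hp q hq hne hpq hz)

theorem eq_of_rank (h : TameFront Λ T) {p q : J1 ℝ} (hp : p ∈ Λ) (hq : q ∈ Λ) (hT : p.1 ∉ T)
    (hpq : p.1 = q.1) (hr : rank Λ p = rank Λ q) : p = q := by
  rcases lt_trichotomy q.2.2 p.2.2 with hz | hz | hz
  · exact absurd hr (h.rank_lt hp hpq hz).ne
  · exact h.eq_of_z hp hq hT hpq hz.symm
  · exact absurd hr (h.rank_lt hq hpq.symm hz).ne'

theorem lt_iff_rank (h : TameFront Λ T) {p q : J1 ℝ} (hp : p ∈ Λ) (hq : q ∈ Λ) (hT : p.1 ∉ T)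
    (hpq : p.1 = q.1) : q.2.2 < p.2.2 ↔ rank Λ p < rank Λ q := by
  refine ⟨h.rank_lt hp hpq, fun hr => ?_⟩
  rcases lt_trichotomy q.2.2 p.2.2 with hz | hz | hz
  · exact hz
  · rw [h.eq_of_z hp hq hT hpq hz.symm] at hr; exact absurd hr (lt_irrefl _)
  · exact absurd hr (h.rank_lt hq hpq.symm hz).not_gt

/-- The rank is locally constant. -/
theorem eventually_rank (h : TameFront Λ T) {p : J1 ℝ} (hp : p ∈ Λ) (hx : p.1 < 0)
    (hT : p.1 ∉ T) : ∀ᶠ q in 𝓝[Λ] p, rank Λ q = rank Λ p := by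
  obtain ⟨N, hN, hinj⟩ := (not_mem_foldLocus hp).1 (fun hf => hT (h.fold_mem p hf))
  classical
  -- Only the neighbourhood at `p` matters: `q` and `b p` lie over the same base point inside `N`,
  -- where the base projection is injective, so `q = b p`.
  have := h.exists_bijOn hx hT (N := fun q => if q = p then N else univ) (by
    intro q _
    split_ifs with hq
    · exact hq ▸ hN
    · exact Filter.univ_mem)
  have h2 := (continuous_fst.tendsto p).eventually this
  filter_upwards [mem_nhdsWithin_of_mem_nhds h2, mem_nhdsWithin_of_mem_nhds hN,
    self_mem_nhdsWithin] with q ⟨b, hb, hbN, hlt⟩ hqN hq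
  have hpp : p ∈ partOver Λ {p.1} := ⟨hp, rfl⟩
  have hbp := hbN p hpp
  rw [if_pos rfl] at hbp
  have hm := hb.mapsTo hpp
  have : q = b p := hinj ⟨hq, hqN⟩ ⟨hm.1, hbp⟩ (mem_singleton_iff.1 hm.2).symm
  rw [this]
  exact rank_bijOn hb hlt hpp

/-- The sets of ranks of the fibres are locally constant. -/
theorem eventually_exists_rank (h : TameFront Λ T) {x₀ : ℝ} (hx : x₀ < 0) (hT : x₀ ∉ T) (k : ℕ) :
    ∀ᶠ x in 𝓝 x₀, ((∃ p ∈ partOver Λ {x}, rank Λ p = k) ↔ ∃ p ∈ partOver Λ {x₀}, rank Λ p = k) := by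
  filter_upwards [h.exists_bijOn hx hT (N := fun _ => univ) (fun _ _ => Filter.univ_mem)]
    with x ⟨b, hb, _, hlt⟩
  constructor
  · rintro ⟨p, hp, hk⟩
    obtain ⟨q, hq, rfl⟩ := hb.surjOn hp
    exact ⟨q, hq, rank_bijOn hb hlt hq ▸ hk⟩
  · rintro ⟨p, hp, hk⟩
    exact ⟨b p, hb.mapsTo hp, (rank_bijOn hb hlt hp).trans hk⟩

/-- Through every point above an interval without 0-cells there is a continuous section of constant
rank. -/
theorem exists_section (h : TameFront Λ T) {I : Set ℝ} (hI : IsPreconnected I) (hneg : ∀ x ∈ I, x < 0)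
    (hT : ∀ x ∈ I, x ∉ T) {p : J1 ℝ} (hp : p ∈ partOver Λ I) :
    ∃ Q : ℝ → J1 ℝ, ContinuousOn Q I ∧ (∀ x ∈ I, Q x ∈ Λ ∧ (Q x).1 = x ∧ rank Λ (Q x) = rank Λ p) ∧
      connectedComponentIn (partOver Λ I) p = Q '' I := by
  have hex : ∀ x ∈ I, ∃ q ∈ partOver Λ {x}, rank Λ q = rank Λ p := by
    intro x hx
    -- Having a point of prescribed rank in the fibre is a locally constant property of the base
    -- point, and it holds at `p.1`.
    have := eq_of_isPreconnected hI (f := fun x => ∃ q ∈ partOver Λ {x}, rank Λ q = rank Λ p)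
      (fun y hy => Filter.Eventually.mono (mem_nhdsWithin_of_mem_nhds
        (h.eventually_exists_rank (hneg y hy) (hT y hy) (rank Λ p)))
          fun z hz => propext hz) hp.2 hx
    rw [← this]
    exact ⟨p, ⟨hp.1, rfl⟩, rfl⟩
  choose! Q hQ hQr using hex
  have hQΛ : ∀ x ∈ I, Q x ∈ Λ := fun x hx => (hQ x hx).1
  have hQ1 : ∀ x ∈ I, (Q x).1 = x := fun x hx => (hQ x hx).2
  have hcont : ContinuousOn Q I := by
    intro x hx
    rw [ContinuousWithinAt, Filter.tendsto_def]
    intro N hN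
    classical
    have hev := h.exists_bijOn (hneg x hx) (hT x hx) (N := fun q => if q = Q x then N else univ) (by
      intro q _
      split_ifs with hq
      · exact hq ▸ hN
      · exact Filter.univ_mem)
    filter_upwards [mem_nhdsWithin_of_mem_nhds hev, self_mem_nhdsWithin] with y ⟨b, hb, hbN, hlt⟩ hy
    have hm := hb.mapsTo (hQ x hx)
    have hbQ := hbN (Q x) (hQ x hx)
    rw [if_pos rfl] at hbQ
    -- The rank determines the point in its fibre, so `Q y` has to be the image of `Q x` under the
    -- order preserving bijection, which was kept in `N`.
    have : Q y = b (Q x) := h.eq_of_rank (hQΛ y hy) hm.1 (by rw [hQ1 y hy]; exact hT y hy)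
      ((hQ1 y hy).trans (mem_singleton_iff.1 hm.2).symm)
      ((hQr y hy).trans ((hQr x hx).symm.trans (rank_bijOn hb hlt (hQ x hx)).symm))
    exact mem_preimage.2 (this ▸ hbQ)
  refine ⟨Q, hcont, fun x hx => ⟨hQΛ x hx, hQ1 x hx, hQr x hx⟩, subset_antisymm ?_ ?_⟩
  · intro q hq
    have hqI := connectedComponentIn_subset _ _ hq
    -- The rank is constant along the component, which therefore cannot leave the section.
    have hr : rank Λ q = rank Λ p := by
      refine eq_of_isPreconnected isPreconnected_connectedComponentIn (f := rank Λ) (fun r hr => ?_)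
        hq (mem_connectedComponentIn hp)
      have hrI := connectedComponentIn_subset _ _ hr
      exact Filter.Eventually.filter_mono (nhdsWithin_mono _ fun s hs =>
        (connectedComponentIn_subset _ _ hs).1)
        (h.eventually_rank hrI.1 (hneg _ hrI.2) (hT _ hrI.2))
    refine ⟨q.1, hqI.2, ?_⟩
    refine h.eq_of_rank (hQΛ _ hqI.2) hqI.1 ?_ (hQ1 _ hqI.2) ((hQr _ hqI.2).trans hr.symm)
    rw [hQ1 _ hqI.2]
    exact hT _ hqI.2
  · refine (hI.image Q hcont).subset_connectedComponentIn ⟨p.1, hp.2, ?_⟩ ?_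
    · refine h.eq_of_rank (hQΛ _ hp.2) hp.1 ?_ (hQ1 _ hp.2) (hQr _ hp.2)
      rw [hQ1 _ hp.2]
      exact hT _ hp.2
    · rintro _ ⟨x, hx, rfl⟩
      exact ⟨hQΛ x hx, by rw [hQ1 x hx]; exact hx⟩

end TameFront

/-! ### Sheets above 1-cells and their limit points -/

theorem LineEdge.continuous_path {Λ : Set (J1 ℝ)} {T : Finset ℝ} (e : LineEdge Λ T) :
    Continuous e.path := by
  unfold LineEdge.path
  fun_prop

/-- The open interval of a 1-cell. -/
def LineEdge.ivl {Λ : Set (J1 ℝ)} {T : Finset ℝ} (e : LineEdge Λ T) : Set ℝ := e.path '' openI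

/-- Edges run away from the axis, which bounds the half line `x ≤ 0` on the right. -/
theorem LineEdge.strictAnti_path {Λ : Set (J1 ℝ)} {T : Finset ℝ} (e : LineEdge Λ T) :
    StrictAnti e.path := by
  intro s s' hs
  have := e.2.1
  unfold LineEdge.path
  nlinarith

theorem LineEdge.path_zero {Λ : Set (J1 ℝ)} {T : Finset ℝ} (e : LineEdge Λ T) :
    e.path 0 = e.1.1.1 := by
  simp [LineEdge.path]

theorem LineEdge.path_one {Λ : Set (J1 ℝ)} {T : Finset ℝ} (e : LineEdge Λ T) :
    e.path 1 = e.1.2.1 := by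
  simp [LineEdge.path]

theorem LineEdge.path_mem {Λ : Set (J1 ℝ)} {T : Finset ℝ} (e : LineEdge Λ T) {s : ℝ}
    (hs : s ∈ openI) : e.path s ∈ e.ivl := ⟨s, hs, rfl⟩

theorem LineEdge.isPreconnected_ivl {Λ : Set (J1 ℝ)} {T : Finset ℝ} (e : LineEdge Λ T) :
    IsPreconnected e.ivl :=
  isPreconnected_Ioo.image _ e.continuous_path.continuousOn

theorem LineEdge.ivl_subset {Λ : Set (J1 ℝ)} {T : Finset ℝ} (e : LineEdge Λ T) {x : ℝ}
    (hx : x ∈ e.ivl) : e.1.2.1 < x ∧ x < e.1.1.1 := by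
  obtain ⟨s, hs, rfl⟩ := hx
  exact ⟨e.path_one ▸ e.strictAnti_path hs.2, e.path_zero ▸ e.strictAnti_path hs.1⟩

theorem LineEdge.notMem {Λ : Set (J1 ℝ)} {T : Finset ℝ} (e : LineEdge Λ T) {x : ℝ}
    (hx : x ∈ e.ivl) : x ∉ T := fun h => e.2.2.1 x h (e.ivl_subset hx)

/-- The points of the closed unit interval are limits of points of the open one, along connected
subsets. -/
theorem exists_isPreconnected_openI {s₀ : ℝ} (hs₀ : s₀ ∈ Icc (0 : ℝ) 1) {P : ℝ → Prop}
    (hP : ∀ᶠ s in 𝓝 s₀, P s) : ∃ J ∈ 𝓝 s₀, IsPreconnected (openI ∩ J) ∧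
      (openI ∩ J).Nonempty ∧ ∀ s ∈ J, P s := by
  obtain ⟨δ, hδ, h⟩ := Metric.eventually_nhds_iff_ball.1 hP
  refine ⟨Metric.ball s₀ δ, Metric.ball_mem_nhds _ hδ, ?_, ?_, h⟩
  · rw [Real.ball_eq_Ioo]
    exact (ordConnected_Ioo.inter ordConnected_Ioo).isPreconnected
  · have : s₀ ∈ closure openI := by
      rw [openI, closure_Ioo (by norm_num)]
      exact hs₀
    exact inter_comm _ _ ▸ mem_closure_iff_nhds.1 this _ (Metric.ball_mem_nhds _ hδ)

theorem touches_iff_frequently {V S : Type} [TopologicalSpace V] [TopologicalSpace S] {D : Set S}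
    {χ : S → V} {u : S} {A : Set (J1 V)} {p : J1 V} :
    Touches D χ u A p ↔ ∀ J ∈ 𝓝 u, ∀ N ∈ 𝓝 p, ∃ s ∈ D ∩ J, ∃ q ∈ A ∩ N, q.1 = χ s := by
  unfold Touches
  rw [mem_closure_iff_nhds]
  constructor
  · intro h J hJ N hN
    obtain ⟨⟨s, q⟩, ⟨hs, hq⟩, h1, h2, h3⟩ := h (J ×ˢ N) (prod_mem_nhds hJ hN)
    exact ⟨s, ⟨h1, hs⟩, q, ⟨h2, hq⟩, h3⟩
  · intro h M hM
    obtain ⟨J, hJ, N, hN, hJN⟩ := mem_nhds_prod_iff.1 hM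
    obtain ⟨s, ⟨h1, hs⟩, q, ⟨h2, hq⟩, h3⟩ := h J hJ N hN
    exact ⟨(s, q), hJN ⟨hs, hq⟩, h1, h2, h3⟩

namespace TameFront

variable {Λ : Set (J1 ℝ)} {T : Finset ℝ}

theorem nonpos_of_mem (h : TameFront Λ T) {t : ℝ} (ht : t ∈ T) : t ≤ 0 := by
  obtain ⟨p, hp, rfl⟩ := h.vert_sub ht
  exact h.nonpos p hp

theorem ivl_neg (h : TameFront Λ T) (e : LineEdge Λ T) {x : ℝ} (hx : x ∈ e.ivl) : x < 0 :=
  (e.ivl_subset hx).2.trans_le (h.nonpos_of_mem e.1.1.2)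

theorem notMem_fold (h : TameFront Λ T) (e : LineEdge Λ T) {p : J1 ℝ} (hp : p.1 ∈ e.ivl) :
    p ∉ foldLocus Λ := fun hf => e.notMem hp (h.fold_mem p hf)

/-- A sheet above a 1-cell is the image of a continuous section. -/
theorem edge_section (h : TameFront Λ T) {e : LineEdge Λ T} (S : Sheet Λ e.ivl) :
    ∃ Q : ℝ → J1 ℝ, ContinuousOn Q e.ivl ∧ (∀ x ∈ e.ivl, Q x ∈ Λ ∧ (Q x).1 = x) ∧
      S.pts = Q '' e.ivl ∧ ∃ k, ∀ x ∈ e.ivl, rank Λ (Q x) = k := by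
  obtain ⟨p, hp, hS⟩ := S.2.1
  obtain ⟨Q, hQ, hQ1, hQ2⟩ := h.exists_section e.isPreconnected_ivl (fun x hx => h.ivl_neg e hx)
    (fun x hx => e.notMem hx) hp
  exact ⟨Q, hQ, fun x hx => ⟨(hQ1 x hx).1, (hQ1 x hx).2.1⟩, hS.trans hQ2,
    rank Λ p, fun x hx => (hQ1 x hx).2.2⟩

theorem pts_subset {V : Type} [TopologicalSpace V] {L : Set (J1 V)} {K : Set V} (S : Sheet L K) :
    S.pts ⊆ partOver L K := by
  obtain ⟨p, hp, hS⟩ := S.2.1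
  exact hS.trans_subset (connectedComponentIn_subset _ _)

theorem pts_nonempty {V : Type} [TopologicalSpace V] {L : Set (J1 V)} {K : Set V}
    (S : Sheet L K) : S.pts.Nonempty := by
  obtain ⟨p, hp, hS⟩ := S.2.1
  exact ⟨p, (show S.pts = _ from hS) ▸ mem_connectedComponentIn hp⟩

theorem pts_eq_of_mem {V : Type} [TopologicalSpace V] {L : Set (J1 V)} {K : Set V}
    (S : Sheet L K) {p : J1 V} (hp : p ∈ S.pts) :
    S.pts = connectedComponentIn (partOver L K) p := by
  obtain ⟨q, hq, hS⟩ := S.2.1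
  have hS' : S.pts = connectedComponentIn (partOver L K) q := hS
  rw [hS'] at hp ⊢
  exact connectedComponentIn_eq hp

theorem isPreconnected_pts {V : Type} [TopologicalSpace V] {L : Set (J1 V)} {K : Set V}
    (S : Sheet L K) : IsPreconnected S.pts := by
  obtain ⟨q, hq, hS⟩ := S.2.1
  exact (show S.pts = _ from hS) ▸ isPreconnected_connectedComponentIn

/-- The preimage of a cone point is infinite. -/
theorem infinite_of_isConeCircle {V : Type} [TopologicalSpace V] {C : Set (J1 V)}
    (hC : IsConeCircle C) : C.Infinite := by
  obtain ⟨-, ⟨φ⟩⟩ := hC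
  intro hfin
  have : Finite C := hfin
  have hfinite : Finite Circle := Finite.of_equiv C φ.toEquiv
  -- A connected T₁ space with two distinct points is infinite.
  have : Nontrivial Circle := ⟨1, -1, fun h => by
    have := congrArg (fun u : Circle => (u : ℂ).re) h
    norm_num at this⟩
  exact (PreconnectedSpace.infinite (X := Circle)).not_finite hfinite

/-- Fibres of `Λ` are finite, whereas a circle is infinite. So the clause about cone points in the
notion of a sheet is void for `Λ`. -/
theorem not_isConeCircle (h : TameFront Λ T) {C : Set (J1 ℝ)} (hC : C ⊆ Λ) : ¬ IsConeCircle C := by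
  intro hcone
  obtain ⟨x, hx⟩ := hcone.1
  exact infinite_of_isConeCircle hcone ((h.finite_fibre x).subset fun p hp => ⟨hC hp, hx p hp⟩)

theorem sheet_lower (h : TameFront Λ T) {K : Set ℝ} (S : Sheet Λ K) :
    ¬ S.pts ⊆ foldLocus Λ ∧ S.lower = false :=
  S.2.2.resolve_left (h.not_isConeCircle fun _ hp => (pts_subset S hp).1)

/-- Sheets are components, and the flag of a sheet of `Λ` is always `false`. -/
theorem sheet_ext (h : TameFront Λ T) {K : Set ℝ} {S S' : Sheet Λ K} {p : J1 ℝ} (hp : p ∈ S.pts)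
    (hp' : p ∈ S'.pts) : S = S' :=
  Subtype.ext (Prod.ext ((pts_eq_of_mem S hp).trans (pts_eq_of_mem S' hp').symm)
    ((h.sheet_lower S).2.trans (h.sheet_lower S').2.symm))

theorem edge_pt_unique (h : TameFront Λ T) {e : LineEdge Λ T} {S : Sheet Λ e.ivl} {p q : J1 ℝ}
    (hp : p ∈ S.pts) (hq : q ∈ S.pts) (hpq : p.1 = q.1) : p = q := by
  obtain ⟨Q, -, hQ1, hS, -⟩ := h.edge_section S
  rw [hS] at hp hq
  obtain ⟨x, hx, rfl⟩ := hp
  obtain ⟨y, hy, rfl⟩ := hq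
  rw [(hQ1 x hx).2, (hQ1 y hy).2] at hpq
  rw [hpq]

theorem edge_exists_pt (h : TameFront Λ T) {e : LineEdge Λ T} (S : Sheet Λ e.ivl) {x : ℝ}
    (hx : x ∈ e.ivl) : ∃ p ∈ S.pts, p.1 = x := by
  obtain ⟨Q, -, hQ1, hS, -⟩ := h.edge_section S
  exact ⟨Q x, hS ▸ ⟨x, hx, rfl⟩, (hQ1 x hx).2⟩

/-- The order of two sheets above a 1-cell can be determined at a point. -/
theorem above_of_lt (h : TameFront Λ T) {e : LineEdge Λ T} {S S' : Sheet Λ e.ivl} {p q : J1 ℝ}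
    (hp : p ∈ S.pts) (hq : q ∈ S'.pts) (hpq : p.1 = q.1) (hz : q.2.2 < p.2.2) : Above S S' := by
  obtain ⟨Q, -, hQ1, hS, k, hk⟩ := h.edge_section S
  obtain ⟨Q', -, hQ1', hS', k', hk'⟩ := h.edge_section S'
  have hpart := pts_subset S hp
  have hpart' := pts_subset S' hq
  have hr := h.rank_lt hpart.1 hpq hz
  rw [hS] at hp
  rw [hS'] at hq
  obtain ⟨x, hx, rfl⟩ := hp
  obtain ⟨y, hy, rfl⟩ := hq
  rw [hk x hx, hk' y hy] at hr
  intro a ha b hb hab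
  rw [hS] at ha
  rw [hS'] at hb
  obtain ⟨x', hx', rfl⟩ := ha
  obtain ⟨y', hy', rfl⟩ := hb
  -- Both ranks are constant along the sheets, so the comparison at one point decides all others.
  refine (h.lt_iff_rank (hQ1 x' hx').1 (hQ1' y' hy').1 ?_ hab).2 (by rwa [hk x' hx', hk' y' hy'])
  rw [(hQ1 x' hx').2]
  exact e.notMem hx'

theorem not_above_self {V : Type} [TopologicalSpace V] {L : Set (J1 V)} {K : Set V}
    (S : Sheet L K) : ¬ Above S S := by
  intro hS
  obtain ⟨p, hp⟩ := pts_nonempty S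
  exact lt_irrefl _ (hS p hp p hp rfl)

theorem edge_above_asymm (h : TameFront Λ T) {e : LineEdge Λ T} {S S' : Sheet Λ e.ivl}
    (hS : Above S S') : ¬ Above S' S := by
  intro hS'
  obtain ⟨p, hp⟩ := pts_nonempty S
  obtain ⟨q, hq, hpq⟩ := h.edge_exists_pt S' (pts_subset S hp).2
  exact lt_asymm (hS p hp q hq hpq.symm) (hS' q hq p hp hpq)

/-- The sheet above a 1-cell through a given point. -/
theorem edge_exists_sheet (h : TameFront Λ T) {e : LineEdge Λ T} {p : J1 ℝ}
    (hp : p ∈ partOver Λ e.ivl) :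
    ∃ S : Sheet Λ e.ivl, S.pts = connectedComponentIn (partOver Λ e.ivl) p :=
  ⟨⟨(connectedComponentIn (partOver Λ e.ivl) p, false), ⟨p, hp, rfl⟩,
    Or.inr ⟨fun hf => h.notMem_fold e hp.2 (hf (mem_connectedComponentIn hp)), rfl⟩⟩, rfl⟩

/-- A sheet is determined by its point above the midpoint of the edge, where the fibre is finite. -/
theorem finite_edge_sheet (h : TameFront Λ T) (e : LineEdge Λ T) : Finite (Sheet Λ e.ivl) := by
  have hx : e.path (1 / 2) ∈ e.ivl := e.path_mem ⟨by norm_num, by norm_num⟩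
  choose f hf hf1 using fun S : Sheet Λ e.ivl => h.edge_exists_pt S hx
  have := (h.finite_fibre (e.path (1 / 2))).to_subtype
  refine Finite.of_injective
    (fun S => (⟨f S, (pts_subset S (hf S)).1, hf1 S⟩ : partOver Λ {e.path (1 / 2)})) ?_
  intro S S' hSS
  have : f S = f S' := congrArg Subtype.val hSS
  exact h.sheet_ext (hf S) (this ▸ hf S')

/-- The point of the closure of a sheet above a boundary point is a limit in the strong sense. -/
theorem eventually_of_touches (h : TameFront Λ T) {e : LineEdge Λ T} {S : Sheet Λ e.ivl} {s₀ : ℝ}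
    (hs₀ : s₀ ∈ Icc (0 : ℝ) 1) {p : J1 ℝ} (hp : Touches openI e.path s₀ S.pts p)
    {N : Set (J1 ℝ)} (hN : N ∈ 𝓝 p) :
    ∃ J ∈ 𝓝 s₀, (openI ∩ J).Nonempty ∧ ∀ s ∈ openI ∩ J, ∀ q ∈ S.pts, q.1 = e.path s → q ∈ N := by
  obtain ⟨Q, hQ, hQ1, hS, -⟩ := h.edge_section S
  have hfin := h.finite_fibre (e.path s₀)
  -- The fibre over the boundary point is finite, so some closed ball around `p` in `N` contains no
  -- other point of it.
  have hiso : {q | q ∈ partOver Λ {e.path s₀} → q = p} ∈ 𝓝 p := by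
    have : (partOver Λ {e.path s₀} \ {p})ᶜ ∈ 𝓝 p :=
      (hfin.subset sdiff_subset).isClosed.isOpen_compl.mem_nhds (by simp)
    refine Filter.mem_of_superset this fun q hq hqF => ?_
    by_contra hne
    exact hq ⟨hqF, hne⟩
  obtain ⟨r, hr, hball⟩ := Metric.nhds_basis_closedBall.mem_iff.1 (Filter.inter_mem hN hiso)
  -- By compactness, nearby fibres avoid the sphere of radius `r` around `p`.
  have hev := eventually_fibre_subset h.compact (e.path s₀)
    (N := Metric.ball p r ∪ (Metric.closedBall p r)ᶜ) (by
      intro q hq hqx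
      by_cases hqp : q = p
      · exact Filter.mem_of_superset (hqp ▸ Metric.ball_mem_nhds _ hr) subset_union_left
      · refine Filter.mem_of_superset (Metric.isClosed_closedBall.isOpen_compl.mem_nhds ?_)
          subset_union_right
        exact fun hb => hqp ((hball hb).2 ⟨hq, hqx⟩))
  obtain ⟨J, hJ, hJc, hJn, hJP⟩ := exists_isPreconnected_openI hs₀
    ((e.continuous_path.tendsto s₀).eventually hev)
  refine ⟨J, hJ, hJn, ?_⟩
  have hQc : IsPreconnected (Q ∘ e.path '' (openI ∩ J)) :=
    hJc.image _ (hQ.comp e.continuous_path.continuousOn fun s hs => e.path_mem hs.1)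
  have hsub : Q ∘ e.path '' (openI ∩ J) ⊆ Metric.ball p r ∪ (Metric.closedBall p r)ᶜ := by
    rintro _ ⟨s, hs, rfl⟩
    have := hQ1 _ (e.path_mem hs.1)
    exact hJP s hs.2 _ this.1 this.2
  obtain ⟨s, hs, q, ⟨hqS, hqb⟩, hqs⟩ := touches_iff_frequently.1 hp J hJ _ (Metric.ball_mem_nhds p hr)
  have hqQ : q = Q (e.path s) := by
    refine h.edge_pt_unique hqS (hS ▸ ⟨_, e.path_mem hs.1, rfl⟩) ?_
    rw [hqs, (hQ1 _ (e.path_mem hs.1)).2]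
  -- The piece of the sheet over `openI ∩ J` is connected, avoids the sphere and meets the ball, so
  -- it stays in the ball.
  have hleft := hQc.subset_left_of_subset_union Metric.isOpen_ball
    Metric.isClosed_closedBall.isOpen_compl
    (disjoint_left.2 fun x hx hx' => hx' (Metric.ball_subset_closedBall hx)) hsub
    ⟨q, ⟨s, hs, hqQ.symm⟩, hqb⟩
  intro s hs q hq hqs
  have hqQ : q = Q (e.path s) := by
    refine h.edge_pt_unique hq (hS ▸ ⟨_, e.path_mem hs.1, rfl⟩) ?_
    rw [hqs, (hQ1 _ (e.path_mem hs.1)).2]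
  exact (hball (Metric.ball_subset_closedBall (hleft ⟨s, hs, hqQ.symm⟩))).1

/-- Close to the boundary point the whole sheet stays near the first limit, which leaves no room for
a second one. -/
theorem touches_unique (h : TameFront Λ T) {e : LineEdge Λ T} {S : Sheet Λ e.ivl} {s₀ : ℝ}
    (hs₀ : s₀ ∈ Icc (0 : ℝ) 1) {p q : J1 ℝ} (hp : Touches openI e.path s₀ S.pts p)
    (hq : Touches openI e.path s₀ S.pts q) : p = q := by
  by_contra hne
  obtain ⟨M, N, hM, hN, hpM, hqN, hd⟩ := t2_separation hne
  obtain ⟨J, hJ, -, hJM⟩ := h.eventually_of_touches hs₀ hp (hM.mem_nhds hpM)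
  obtain ⟨s, hs, r, ⟨hr, hrN⟩, hrs⟩ := touches_iff_frequently.1 hq J hJ N (hN.mem_nhds hqN)
  exact disjoint_left.1 hd (hJM s hs r hr hrs) hrN

theorem touches_mem (h : TameFront Λ T) {e : LineEdge Λ T} {S : Sheet Λ e.ivl} {s₀ : ℝ}
    {p : J1 ℝ} (hp : Touches openI e.path s₀ S.pts p) : p ∈ Λ ∧ p.1 = e.path s₀ := by
  have hcl : IsClosed {w : ℝ × J1 ℝ | w.2 ∈ Λ ∧ w.2.1 = e.path w.1} :=
    (h.isClosed.preimage continuous_snd).inter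
      (isClosed_eq (by fun_prop) (e.continuous_path.comp continuous_fst))
  exact closure_minimal (s := {w : ℝ × J1 ℝ | w.1 ∈ openI ∧ w.2 ∈ S.pts ∧ w.2.1 = e.path w.1})
    (t := {w : ℝ × J1 ℝ | w.2 ∈ Λ ∧ w.2.1 = e.path w.1})
    (fun w hw => ⟨(pts_subset S hw.2.1).1, hw.2.2⟩) hcl hp

/-- Above an interior point, the limit points of a sheet belong to the sheet. -/
theorem touches_interior (h : TameFront Λ T) {e : LineEdge Λ T} {S : Sheet Λ e.ivl} {s₀ : ℝ}
    (hs₀ : s₀ ∈ openI) {p : J1 ℝ} :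
    Touches openI e.path s₀ S.pts p ↔ p ∈ S.pts ∧ p.1 = e.path s₀ := by
  constructor
  · intro hp
    obtain ⟨q, hq, hqs⟩ := h.edge_exists_pt S (e.path_mem hs₀)
    have := h.touches_unique (Ioo_subset_Icc_self hs₀) hp
      (subset_closure ⟨hs₀, hq, hqs⟩ : Touches openI e.path s₀ S.pts q)
    exact this ▸ ⟨hq, hqs⟩
  · rintro ⟨hp, hps⟩
    exact subset_closure ⟨hs₀, hp, hps⟩

end TameFront

/-! ### The ends of the arcs, and sheets above 0-cells -/

namespace TameFront

variable {Λ : Set (J1 ℝ)} {T : Finset ℝ}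

theorem glue_left (h : TameFront Λ T) {p : J1 ℝ} (hp : p ∈ Λ) (hx : p.1 = 0) :
    ∃ F : ℝ → ℝ, ContDiff ℝ ∞ F ∧ p.2.1 = deriv F 0 ∧ p.2.2 = F 0 ∧
      ∀ᶠ q in 𝓝 p, q ∈ Λ ↔ q.1 ≤ 0 ∧ q.2.1 = deriv F q.1 ∧ q.2.2 = F q.1 := by
  obtain ⟨F, hF, h1, -⟩ := h.glue p hp hx
  have := h1.self_of_nhds.1 hp
  rw [hx] at this
  exact ⟨F, hF, this.2.1, this.2.2, h1⟩

/-- Near an endpoint `Λ` is part of the 1-jet of the gluing function, whose points are determined by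
`x`. -/
theorem axis_injOn (h : TameFront Λ T) {p : J1 ℝ} (hp : p ∈ Λ) (hx : p.1 = 0) :
    ∃ N ∈ 𝓝 p, InjOn Prod.fst (Λ ∩ N) := by
  obtain ⟨F, -, -, -, hF⟩ := h.glue_left hp hx
  refine ⟨_, hF, ?_⟩
  rintro q ⟨hq, hqF⟩ r ⟨hr, hrF⟩ hqr
  obtain ⟨-, h1, h2⟩ := hqF.1 hq
  obtain ⟨-, h3, h4⟩ := hrF.1 hr
  refine Prod.ext hqr (Prod.ext ?_ ?_)
  · rw [h1, h3, hqr]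
  · rw [h2, h4, hqr]

theorem axis_notMem_fold (h : TameFront Λ T) {p : J1 ℝ} (hx : p.1 = 0) : p ∉ foldLocus Λ :=
  fun hp => (not_mem_foldLocus hp.1).2 (h.axis_injOn hp.1 hx) hp

theorem axis_partner (h : TameFront Λ T) {p : J1 ℝ} (hp : p ∈ Λ) (hx : p.1 = 0) :
    ((0, -p.2.1, p.2.2) : J1 ℝ) ∈ Λ := by
  obtain ⟨F, -, h1, h2⟩ := h.glue p hp hx
  have h3 := h1.self_of_nhds.1 hp
  rw [hx] at h3
  refine h2.self_of_nhds.2 ⟨le_rfl, ?_, ?_⟩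
  · simpa using h3.2.1
  · simpa using h3.2.2

/-- At most one sheet ends at a given point above the axis. -/
theorem axis_eq (h : TameFront Λ T) {e : LineEdge Λ T} (he : e.1.1.1 = 0) {S S' : Sheet Λ e.ivl}
    {p : J1 ℝ} (hS : Touches openI e.path 0 S.pts p) (hS' : Touches openI e.path 0 S'.pts p) :
    S = S' := by
  obtain ⟨hp, hpx⟩ := h.touches_mem hS
  rw [e.path_zero, he] at hpx
  obtain ⟨N, hN, hinj⟩ := h.axis_injOn hp hpx
  have h01 : (0 : ℝ) ∈ Icc (0 : ℝ) 1 := ⟨le_rfl, zero_le_one⟩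
  obtain ⟨J, hJ, -, hJN⟩ := h.eventually_of_touches h01 hS hN
  obtain ⟨J', hJ', -, hJN'⟩ := h.eventually_of_touches h01 hS' hN
  obtain ⟨J'', hJ'', -, ⟨s, hs, hsJ⟩, hJJ⟩ := exists_isPreconnected_openI h01
    (Filter.inter_mem hJ hJ')
  have hsJ' := hJJ s hsJ
  obtain ⟨q, hq, hqs⟩ := h.edge_exists_pt S (e.path_mem hs)
  obtain ⟨r, hr, hrs⟩ := h.edge_exists_pt S' (e.path_mem hs)
  have : q = r := hinj ⟨(pts_subset S hq).1, hJN s ⟨hs, hsJ'.1⟩ q hq hqs⟩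
    ⟨(pts_subset S' hr).1, hJN' s ⟨hs, hsJ'.2⟩ r hr hrs⟩ (hqs.trans hrs.symm)
  exact h.sheet_ext hq (this ▸ hr)

/-- A sheet ends at every point above the axis. -/
theorem axis_exists_sheet (h : TameFront Λ T) {e : LineEdge Λ T} (he : e.1.1.1 = 0) {p : J1 ℝ}
    (hp : p ∈ Λ) (hx : p.1 = 0) : ∃ S : Sheet Λ e.ivl, Touches openI e.path 0 S.pts p := by
  obtain ⟨F, hF, h1, h2, hev⟩ := h.glue_left hp hx
  have h01 : (0 : ℝ) ∈ Icc (0 : ℝ) 1 := ⟨le_rfl, zero_le_one⟩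
  -- The 1-jet of the gluing function parametrizes `Λ` near `p`; over a short interval it is
  -- connected and hence lies in one sheet.
  let g : ℝ → J1 ℝ := fun x => (x, deriv F x, F x)
  have hg : Continuous g := by
    have := hF.continuous_deriv (by simp)
    have := hF.continuous
    fun_prop
  have hgp : g (e.path 0) = p := by
    rw [e.path_zero, he]
    exact Prod.ext hx.symm (Prod.ext h1.symm h2.symm)
  have hgc : Continuous (g ∘ e.path) := hg.comp e.continuous_path
  have hgt : Filter.Tendsto (g ∘ e.path) (𝓝 0) (𝓝 p) := by
    have := hgc.tendsto 0
    rwa [Function.comp_apply, hgp] at this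
  obtain ⟨J, hJ, hJc, ⟨s₁, hs₁⟩, hJP⟩ := exists_isPreconnected_openI h01 (hgt.eventually hev)
  have hmem : ∀ s ∈ openI ∩ J, g (e.path s) ∈ partOver Λ e.ivl := fun s hs =>
    ⟨(hJP s hs.2).2 ⟨(h.ivl_neg e (e.path_mem hs.1)).le, rfl, rfl⟩, e.path_mem hs.1⟩
  obtain ⟨S, hS⟩ := h.edge_exists_sheet (hmem s₁ hs₁)
  have hsub : g ∘ e.path '' (openI ∩ J) ⊆ S.pts := by
    rw [hS]
    refine (hJc.image _ hgc.continuousOn).subset_connectedComponentIn ⟨s₁, hs₁, rfl⟩ ?_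
    rintro _ ⟨s, hs, rfl⟩
    exact hmem s hs
  refine ⟨S, touches_iff_frequently.2 fun J' hJ' N hN => ?_⟩
  obtain ⟨J'', -, -, ⟨s, hs, hsJ⟩, hJJ⟩ := exists_isPreconnected_openI h01
    (Filter.inter_mem hJ (Filter.inter_mem hJ' (hgt hN)))
  have hsJ' := hJJ s hsJ
  exact ⟨s, ⟨hs, hsJ'.2.1⟩, g (e.path s), ⟨hsub ⟨s, ⟨hs, hsJ'.1⟩, rfl⟩, hsJ'.2.2⟩, rfl⟩

/-- `F - G` vanishes at `0` with negative derivative, so its difference quotient is negative nearby,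
and the denominator `x` is negative too. -/
theorem eventually_lt_of_deriv {F G : ℝ → ℝ} (hF : DifferentiableAt ℝ F 0)
    (hG : DifferentiableAt ℝ G 0) (h0 : F 0 = G 0) (hd : deriv F 0 < deriv G 0) :
    ∀ᶠ x in 𝓝 0, x < 0 → G x < F x := by
  have h1 : HasDerivAt (fun x => F x - G x) (deriv F 0 - deriv G 0) 0 :=
    hF.hasDerivAt.sub hG.hasDerivAt
  rw [hasDerivAt_iff_tendsto_slope] at h1
  have h2 := h1.eventually (gt_mem_nhds (by linarith : deriv F 0 - deriv G 0 < 0))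
  filter_upwards [eventually_nhdsWithin_iff.1 h2] with x hx hx0
  have := hx hx0.ne
  rw [slope_def_field, h0, sub_self, sub_zero, sub_zero, div_neg_iff] at this
  rcases this with h | h
  · linarith [h.1]
  · linarith [h.2]

/-- Of two sheets that end at points of the same height above the axis, the one with the smaller
slope is the upper one. -/
theorem axis_above (h : TameFront Λ T) {e : LineEdge Λ T} (he : e.1.1.1 = 0) {S S' : Sheet Λ e.ivl}
    {p p' : J1 ℝ} (hS : Touches openI e.path 0 S.pts p) (hS' : Touches openI e.path 0 S'.pts p')
    (hz : p.2.2 = p'.2.2) (hy : p.2.1 < p'.2.1) : Above S S' := by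
  obtain ⟨hp, hpx⟩ := h.touches_mem hS
  obtain ⟨hp', hpx'⟩ := h.touches_mem hS'
  rw [e.path_zero, he] at hpx hpx'
  obtain ⟨F, hF, h1, h2, hev⟩ := h.glue_left hp hpx
  obtain ⟨G, hG, h1', h2', hev'⟩ := h.glue_left hp' hpx'
  have hlt := eventually_lt_of_deriv (hF.differentiable (by simp)).differentiableAt
    (hG.differentiable (by simp)).differentiableAt (by rw [← h2, ← h2', hz])
    (by rw [← h1, ← h1']; exact hy)
  have h01 : (0 : ℝ) ∈ Icc (0 : ℝ) 1 := ⟨le_rfl, zero_le_one⟩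
  have hpath : Filter.Tendsto e.path (𝓝 0) (𝓝 0) := by
    have := e.continuous_path.tendsto 0
    rwa [e.path_zero, he] at this
  obtain ⟨J, hJ, -, hJN⟩ := h.eventually_of_touches h01 hS hev
  obtain ⟨J', hJ', -, hJN'⟩ := h.eventually_of_touches h01 hS' hev'
  obtain ⟨J'', -, -, ⟨s, hs, hsJ⟩, hJJ⟩ := exists_isPreconnected_openI h01
    (Filter.inter_mem hJ (Filter.inter_mem hJ' (hpath.eventually hlt)))
  have hsJ' := hJJ s hsJ
  obtain ⟨q, hq, hqs⟩ := h.edge_exists_pt S (e.path_mem hs)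
  obtain ⟨r, hr, hrs⟩ := h.edge_exists_pt S' (e.path_mem hs)
  refine h.above_of_lt hq hr (hqs.trans hrs.symm) ?_
  have h3 := ((hJN s ⟨hs, hsJ'.1⟩ q hq hqs).1 (pts_subset S hq).1).2.2
  have h4 := ((hJN' s ⟨hs, hsJ'.2.1⟩ r hr hrs).1 (pts_subset S' hr).1).2.2
  rw [h3, h4, hqs, hrs]
  exact hsJ'.2.2 (h.ivl_neg e (e.path_mem hs))

/-- A sheet above a 0-cell is a point. -/
theorem vert_sheet (h : TameFront Λ T) {t : ℝ} (S : Sheet Λ {t}) :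
    ∃ p ∈ Λ, p.1 = t ∧ p ∉ foldLocus Λ ∧ S.pts = {p} := by
  obtain ⟨p, hp⟩ := pts_nonempty S
  have hsub : S.pts.Subsingleton := by
    -- A connected subset of a finite fibre has at most one point.
    have := ((h.finite_fibre t).countable.isTotallyDisconnected) _ (pts_subset S)
      (isPreconnected_pts S)
    exact this
  have hS := hsub.eq_singleton_of_mem hp
  refine ⟨p, (pts_subset S hp).1, (pts_subset S hp).2, fun hf => ?_, hS⟩
  exact (h.sheet_lower S).1 (hS ▸ singleton_subset_iff.2 hf)

theorem vert_exists_sheet (h : TameFront Λ T) {t : ℝ} {p : J1 ℝ} (hp : p ∈ Λ) (hx : p.1 = t)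
    (hf : p ∉ foldLocus Λ) : ∃ S : Sheet Λ {t}, S.pts = {p} := by
  have hpt : p ∈ partOver Λ {t} := ⟨hp, hx⟩
  refine ⟨⟨(connectedComponentIn (partOver Λ {t}) p, false), ⟨p, hpt, rfl⟩,
    Or.inr ⟨fun h' => hf (h' (mem_connectedComponentIn hpt)), rfl⟩⟩, ?_⟩
  exact Set.Subsingleton.eq_singleton_of_mem
    (((h.finite_fibre t).countable.isTotallyDisconnected) _ (connectedComponentIn_subset _ _)
      isPreconnected_connectedComponentIn) (mem_connectedComponentIn hpt)

theorem finite_vert_sheet (h : TameFront Λ T) (t : ℝ) : Finite (Sheet Λ {t}) := by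
  choose f hf hf1 _ hf2 using fun S : Sheet Λ {t} => h.vert_sheet S
  have := (h.finite_fibre t).to_subtype
  refine Finite.of_injective (fun S => (⟨f S, hf S, hf1 S⟩ : partOver Λ {t})) ?_
  intro S S' hSS
  have : f S = f S' := congrArg Subtype.val hSS
  exact h.sheet_ext (p := f S) (by rw [hf2 S]; rfl) (by rw [hf2 S', this]; rfl)

theorem vert_above_iff {t : ℝ} {S S' : Sheet Λ {t}} {p q : J1 ℝ} (hx : p.1 = q.1)
    (hS : S.pts = {p}) (hS' : S'.pts = {q}) : Above S S' ↔ q.2.2 < p.2.2 := by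
  simp [Above, hS, hS', hx]

end TameFront

/-! ### From parametrized curves to tame fronts -/

/-- Zeros of a function without degenerate critical points are isolated. -/
theorem eventually_ne_of_nondegenerate {f : ℝ → ℝ} (hf : ContDiff ℝ ∞ f) {x : ℝ}
    (hx : deriv f x = 0 → deriv (deriv f) x ≠ 0) : ∀ᶠ y in 𝓝[≠] x, f y ≠ f x := by
  have hd : Differentiable ℝ f := hf.differentiable (by simp)
  by_cases h0 : deriv f x = 0
  · have hdd : DifferentiableAt ℝ (deriv f) x :=
      ((contDiff_infty_iff_deriv.1 hf).2.differentiable (by simp)).differentiableAt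
    -- Nondegeneracy makes `deriv f` nonzero on a punctured neighbourhood; by Rolle's theorem the
    -- value at `x` does not recur there.
    have h1 := hdd.hasDerivAt.eventually_ne (c := 0) (hx h0)
    obtain ⟨ε, hε, hb⟩ := Metric.eventually_nhds_iff_ball.1 (eventually_nhdsWithin_iff.1 h1)
    rw [eventually_nhdsWithin_iff]
    filter_upwards [Metric.ball_mem_nhds x hε] with y hy hyx hfy
    rw [Real.ball_eq_Ioo] at hy hb
    rcases lt_or_gt_of_ne hyx with hlt | hlt
    · obtain ⟨c, hc, hc0⟩ := exists_deriv_eq_zero hlt hd.continuous.continuousOn hfy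
      exact hb c ⟨hy.1.trans hc.1, by linarith [hc.2]⟩ hc.2.ne hc0
    · obtain ⟨c, hc, hc0⟩ := exists_deriv_eq_zero hlt hd.continuous.continuousOn hfy.symm
      exact hb c ⟨by linarith [hc.1], hc.2.trans hy.2⟩ hc.1.ne' hc0
  · exact (hd.differentiableAt.hasDerivAt).eventually_ne h0

/-- An infinite level set in the compact interval would accumulate at one of its points, where the
level is isolated. This is the source of the finiteness of the fibres of `Λ`. -/
theorem finite_level_of_nondegenerate {f : ℝ → ℝ} (hf : ContDiff ℝ ∞ f)
    (h : ∀ s ∈ Icc (0 : ℝ) 1, deriv f s = 0 → deriv (deriv f) s ≠ 0) (c : ℝ) :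
    {s ∈ Icc (0 : ℝ) 1 | f s = c}.Finite := by
  by_contra hinf
  have hcl : IsCompact {s ∈ Icc (0 : ℝ) 1 | f s = c} :=
    isCompact_Icc.inter_right (isClosed_eq hf.continuous continuous_const)
  obtain ⟨x, hx, hacc⟩ := Set.Infinite.exists_accPt_of_subset_isCompact hinf hcl subset_rfl
  rw [accPt_iff_frequently_nhdsNE] at hacc
  exact hacc ((eventually_ne_of_nondegenerate hf (h x hx.1)).mono
    fun y hy hyc => hy (hyc.2.trans hx.2.symm))

/-- An injective curve in `Λ` through a point where the base projection is locally injective covers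
a neighbourhood in the base. -/
theorem exists_near_of_curve {Λ : Set (J1 ℝ)} {γ : ℝ → J1 ℝ} (hγ : Continuous γ) {s₀ δ : ℝ}
    (hδ : 0 < δ) (hΛ : ∀ s ∈ Ioo (s₀ - δ) (s₀ + δ), γ s ∈ Λ) (hinj : InjOn γ (Ioo (s₀ - δ) (s₀ + δ)))
    (hfold : γ s₀ ∉ foldLocus Λ) {N : Set (J1 ℝ)} (hN : N ∈ 𝓝 (γ s₀)) :
    ∀ᶠ x in 𝓝 (γ s₀).1, ∃ q ∈ Λ ∩ N, q.1 = x := by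
  obtain ⟨M, hM, hMinj⟩ := (not_mem_foldLocus (hΛ s₀ ⟨by linarith, by linarith⟩)).1 hfold
  obtain ⟨ε, hε, hb⟩ := Metric.mem_nhds_iff.1
    (Filter.inter_mem (hγ.tendsto s₀ (Filter.inter_mem hN hM))
      (Ioo_mem_nhds (by linarith : s₀ - δ < s₀) (by linarith : s₀ < s₀ + δ)))
  rw [Real.ball_eq_Ioo] at hb
  have hf : Continuous fun s => (γ s).1 := continuous_fst.comp hγ
  -- The base coordinate is injective along the curve, hence strictly monotone near `s₀`. Its values
  -- at `s₀ ± ε / 2` lie on opposite sides of the value at `s₀`, and everything between them is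
  -- attained.
  have hfi : InjOn (fun s => (γ s).1) (Ioo (s₀ - ε) (s₀ + ε)) := by
    intro s hs s' hs' hss
    exact hinj (hb hs).2 (hb hs').2
      (hMinj ⟨hΛ s (hb hs).2, (hb hs).1.2⟩ ⟨hΛ s' (hb hs').2, (hb hs').1.2⟩ hss)
  have key : ∀ x ∈ uIcc (γ (s₀ - ε / 2)).1 (γ (s₀ + ε / 2)).1, ∃ q ∈ Λ ∩ N, q.1 = x := by
    intro x hx
    obtain ⟨s, hs, hsx⟩ := intermediate_value_uIcc (f := fun s => (γ s).1) hf.continuousOn hx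
    rw [uIcc_of_le (by linarith)] at hs
    have := hb (show s ∈ Ioo (s₀ - ε) (s₀ + ε) from ⟨by linarith [hs.1], by linarith [hs.2]⟩)
    exact ⟨γ s, ⟨hΛ s this.2, this.1.1⟩, hsx⟩
  have ha : s₀ - ε / 2 ∈ Ioo (s₀ - ε) (s₀ + ε) := ⟨by linarith, by linarith⟩
  have hm : s₀ ∈ Ioo (s₀ - ε) (s₀ + ε) := ⟨by linarith, by linarith⟩
  have hc : s₀ + ε / 2 ∈ Ioo (s₀ - ε) (s₀ + ε) := ⟨by linarith, by linarith⟩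
  rcases hf.continuousOn.strictMonoOn_of_injOn_Ioo (by linarith) hfi with hmono | hmono
  · filter_upwards [Ioo_mem_nhds (hmono ha hm (by linarith)) (hmono hm hc (by linarith))] with x hx
    exact key x (Icc_subset_uIcc ⟨hx.1.le, hx.2.le⟩)
  · filter_upwards [Ioo_mem_nhds (hmono hm hc (by linarith)) (hmono ha hm (by linarith))] with x hx
    exact key x (Icc_subset_uIcc' ⟨hx.1.le, hx.2.le⟩)

namespace Leg

theorem circle_fract (Λ : Leg) (i : Fin Λ.numCircles) (s : ℝ) :
    Λ.circle i (Int.fract s) = Λ.circle i s := by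
  have : Function.Periodic (Λ.circle i) 1 := Λ.circle_periodic i
  simpa using this.sub_int_mul_eq ⌊s⌋ (x := s)

theorem circle_range (Λ : Leg) (i : Fin Λ.numCircles) :
    range (Λ.circle i) = Λ.circle i '' Icc 0 1 := by
  refine subset_antisymm ?_ (image_subset_range _ _)
  rintro _ ⟨s, rfl⟩
  exact ⟨Int.fract s, ⟨Int.fract_nonneg s, (Int.fract_lt_one s).le⟩, Λ.circle_fract i s⟩

/-- `embedded` covers the parameters in `[0, 1)` only. Parameters with the same fractional part
differ by an integer, which is `0` if they are less than a period apart. -/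
theorem circle_inj (Λ : Leg) (i : Fin Λ.numCircles) {s s' : ℝ} (hss : |s - s'| < 1)
    (h : Λ.circle i s = Λ.circle i s') : s = s' := by
  rw [← Λ.circle_fract i s, ← Λ.circle_fract i s'] at h
  have h1 := Λ.embedded (a₁ := Sum.inl (i, ⟨Int.fract s, Int.fract_nonneg s, Int.fract_lt_one s⟩))
    (a₂ := Sum.inl (i, ⟨Int.fract s', Int.fract_nonneg s', Int.fract_lt_one s'⟩)) h
  have h2 : Int.fract s = Int.fract s' :=
    congrArg Subtype.val (Prod.ext_iff.1 (Sum.inl.inj h1)).2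
  obtain ⟨z, hz⟩ := Int.fract_eq_fract.1 h2
  rw [hz] at hss
  have : z = 0 := by
    have : |z| < 1 := by exact_mod_cast hss
    exact Int.abs_lt_one_iff.1 this
  rw [this] at hz
  simpa [sub_eq_zero] using hz

theorem arc_inj (Λ : Leg) (j : Fin Λ.numArcs) : InjOn (Λ.arc j) (Icc 0 1) := by
  intro s hs s' hs' h
  have := Λ.embedded (a₁ := Sum.inr (j, ⟨s, hs⟩)) (a₂ := Sum.inr (j, ⟨s', hs'⟩)) h
  simpa using this

theorem arc_nonpos (Λ : Leg) (j : Fin Λ.numArcs) {s : ℝ} (hs : s ∈ Icc (0 : ℝ) 1) :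
    (Λ.arc j s).1 ≤ 0 := by
  rcases hs.1.eq_or_lt with h0 | h0
  · rw [← h0, Λ.arc_zero]
  rcases hs.2.eq_or_lt with h1 | h1
  · rw [h1, Λ.arc_one]
  exact (Λ.arc_neg j s ⟨h0, h1⟩).le

theorem mem_carrier (Λ : Leg) {p : J1 ℝ} : p ∈ Λ.carrier ↔
    (∃ i s, Λ.circle i s = p) ∨ ∃ j, ∃ s ∈ Icc (0 : ℝ) 1, Λ.arc j s = p := by
  simp [Leg.carrier]

/-- Fibres are finite because the base coordinate has nondegenerate critical points, and nearby base
points are covered because the curves are injective. The other properties are immediate. -/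
theorem tameFront (Λ : Leg) (hglue : Λ.GluesToReflection) (hgen : Λ.GenericFront) {T : Finset ℝ}
    (hT : Λ.Compatible T) : TameFront Λ.carrier T where
  compact := by
    refine IsCompact.union (isCompact_iUnion fun i => ?_) (isCompact_iUnion fun j => ?_)
    · rw [Λ.circle_range i]
      exact isCompact_Icc.image (Λ.circle_smooth i).continuous
    · exact isCompact_Icc.image (Λ.arc_smooth j).continuous
  nonpos := by
    intro p hp
    rcases Λ.mem_carrier.1 hp with ⟨i, s, rfl⟩ | ⟨j, s, hs, rfl⟩
    · exact (Λ.circle_neg i s).le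
    · exact Λ.arc_nonpos j hs
  finite_fibre := by
    intro x
    have h1 : ∀ i, {s ∈ Icc (0 : ℝ) 1 | (Λ.circle i s).1 = x}.Finite := fun i =>
      finite_level_of_nondegenerate (contDiff_fst.comp (Λ.circle_smooth i)) (fun s _ => hgen.1 i s) x
    have h2 : ∀ j, {s ∈ Icc (0 : ℝ) 1 | (Λ.arc j s).1 = x}.Finite := fun j =>
      finite_level_of_nondegenerate (contDiff_fst.comp (Λ.arc_smooth j)) (hgen.2.1 j) x
    refine Set.Finite.subset ((finite_iUnion fun i => (h1 i).image (Λ.circle i)).union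
      (finite_iUnion fun j => (h2 j).image (Λ.arc j))) ?_
    rintro p ⟨hp, hpx⟩
    rcases hp with hp | hp
    · obtain ⟨i, hp⟩ := mem_iUnion.1 hp
      rw [Λ.circle_range i] at hp
      obtain ⟨s, hs, rfl⟩ := hp
      exact Or.inl (mem_iUnion.2 ⟨i, s, ⟨hs, hpx⟩, rfl⟩)
    · obtain ⟨j, s, hs, rfl⟩ := mem_iUnion.1 hp
      exact Or.inr (mem_iUnion.2 ⟨j, s, ⟨hs, hpx⟩, rfl⟩)
  exists_near := by
    intro p hp hx hf N hN
    rcases Λ.mem_carrier.1 hp with ⟨i, s, rfl⟩ | ⟨j, s, hs, rfl⟩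
    -- On the open interval of length one around `s` the circle is injective.
    · refine exists_near_of_curve (Λ.circle_smooth i).continuous (δ := 1 / 2) (by norm_num)
        (fun s _ => Λ.mem_carrier.2 (Or.inl ⟨i, s, rfl⟩)) ?_ hf hN
      intro a ha b hb hab
      refine Λ.circle_inj i ?_ hab
      rw [abs_lt]
      constructor <;> linarith [ha.1, ha.2, hb.1, hb.2]
    -- As `x < 0`, the parameter is not an endpoint of the arc, and a symmetric interval around it
    -- stays in `[0, 1]`.
    · have h0 : 0 < s := hs.1.lt_of_ne (by rintro rfl; rw [Λ.arc_zero] at hx; exact lt_irrefl _ hx)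
      have h1 : s < 1 := hs.2.lt_of_ne (by rintro rfl; rw [Λ.arc_one] at hx; exact lt_irrefl _ hx)
      have hsub : Ioo (s - min s (1 - s)) (s + min s (1 - s)) ⊆ Icc (0 : ℝ) 1 := by
        intro a ha
        have := min_le_left s (1 - s)
        have := min_le_right s (1 - s)
        exact ⟨by linarith [ha.1], by linarith [ha.2]⟩
      exact exists_near_of_curve (Λ.arc_smooth j).continuous
        (lt_min h0 (by linarith)) (fun a ha => Λ.mem_carrier.2 (Or.inr ⟨j, a, hsub ha, rfl⟩))
        ((Λ.arc_inj j).mono hsub) hf hN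
  glue := hglue
  no_triple := hgen.2.2.1
  vert_sub := hT.1
  fold_mem := hT.2.1
  crossing_mem := hT.2.2.1

end Leg

/-! ## Rotating sets about the axis -/

/-- The set swept out by the rotations of `S` by the elements of `U`. -/
def spin (U : Set Circle) (S : Set (J1 ℝ)) : Set (J1 ℂ) := {q | ∃ u ∈ U, ∃ p ∈ S, q = spinPt u p}

theorem spinPt_mem_spin {U : Set Circle} {S : Set (J1 ℝ)} {u : Circle} {p : J1 ℝ} (hu : u ∈ U)
    (hp : p ∈ S) : spinPt u p ∈ spin U S := ⟨u, hu, p, hp, rfl⟩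

theorem continuous_spinPt : Continuous fun w : Circle × J1 ℝ => spinPt w.1 w.2 := by
  unfold spinPt
  fun_prop

/-- The rotation by `u⁻¹`, followed by the projection to `J¹ℝ`. -/
def rotBack (u : Circle) (q : J1 ℂ) : J1 ℝ :=
  ((q.1 * (starRingEnd ℂ) (u : ℂ)).re, (q.2.1 * (starRingEnd ℂ) (u : ℂ)).re, q.2.2)

theorem continuous_rotBack : Continuous fun w : Circle × J1 ℂ => rotBack w.1 w.2 := by
  unfold rotBack
  have : Continuous fun w : Circle × J1 ℂ => (starRingEnd ℂ) (w.1 : ℂ) :=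
    Complex.continuous_conj.comp (by fun_prop)
  fun_prop

theorem rotBack_spinPt (u : Circle) (p : J1 ℝ) : rotBack u (spinPt u p) = p := by
  have h : ∀ x : ℝ, ((x : ℂ) * u * (starRingEnd ℂ) (u : ℂ)).re = x := by
    intro x
    rw [mul_assoc, Complex.mul_conj, Circle.normSq_coe]
    simp
  simp only [rotBack, spinPt, h]

theorem spinPt_injective (u : Circle) : Function.Injective (spinPt u) :=
  Function.LeftInverse.injective (rotBack_spinPt u)

/-- Polar coordinates: the norm recovers `-x`, after which the nonzero factor `x` cancels. -/
theorem spinPt_fst_eq {u u' : Circle} {x x' : ℝ} (hx : x < 0) (hx' : x' ≤ 0)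
    (h : (x : ℂ) * u = x' * u') : x = x' ∧ u = u' := by
  have h1 : x = x' := by
    have := congrArg norm h
    simp only [norm_mul, Complex.norm_real, Circle.norm_coe, mul_one, Real.norm_eq_abs,
      abs_of_neg hx, abs_of_nonpos hx'] at this
    linarith
  subst h1
  refine ⟨rfl, Circle.ext ?_⟩
  exact mul_left_cancel₀ (by exact_mod_cast hx.ne) h

/-- The direction of a point of the front spin off the axis. -/
def dir (q : J1 ℂ) : ℂ := -q.1 / ‖q.1‖

/-- The point of `J¹ℝ` over `x < 0` of which `q` is a rotation. -/
def unspin (q : J1 ℂ) : J1 ℝ := (-‖q.1‖, (q.2.1 * (starRingEnd ℂ) (dir q)).re, q.2.2)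

theorem dir_spinPt {u : Circle} {p : J1 ℝ} (hp : p.1 < 0) : dir (spinPt u p) = u := by
  have h : (p.1 : ℂ) ≠ 0 := by exact_mod_cast hp.ne
  simp only [dir, spinPt, norm_mul, Complex.norm_real, Circle.norm_coe, mul_one, Real.norm_eq_abs,
    abs_of_neg hp]
  push_cast
  field_simp

theorem unspin_spinPt {u : Circle} {p : J1 ℝ} (hp : p.1 < 0) : unspin (spinPt u p) = p := by
  have h := rotBack_spinPt u p
  rw [Prod.ext_iff, Prod.ext_iff] at h
  refine Prod.ext ?_ (Prod.ext ?_ h.2.2)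
  · simp [unspin, spinPt, abs_of_neg hp, Circle.norm_coe]
  · simp only [unspin, dir_spinPt hp]
    exact h.2.1

theorem continuousAt_unspin {q : J1 ℂ} (hq : q.1 ≠ 0) : ContinuousAt unspin q := by
  have h1 : ContinuousAt dir q := by
    unfold dir
    refine ContinuousAt.div (by fun_prop) (by fun_prop) ?_
    exact_mod_cast norm_ne_zero_iff.2 hq
  have h2 : ContinuousAt (fun q => (starRingEnd ℂ) (dir q)) q :=
    Complex.continuous_conj.continuousAt.comp h1
  unfold unspin
  fun_prop

theorem spinPt_fst_ne_zero {u : Circle} {p : J1 ℝ} (hp : p.1 < 0) : (spinPt u p).1 ≠ 0 := by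
  simp [spinPt, hp.ne]

theorem isPreconnected_spin {U : Set Circle} (hU : IsPreconnected U) {S : Set (J1 ℝ)}
    (hS : IsPreconnected S) : IsPreconnected (spin U S) := by
  have : spin U S = (fun w : Circle × J1 ℝ => spinPt w.1 w.2) '' (U ×ˢ S) := by
    ext q
    constructor
    · rintro ⟨u, hu, p, hp, rfl⟩
      exact ⟨(u, p), ⟨hu, hp⟩, rfl⟩
    · rintro ⟨⟨u, p⟩, ⟨hu, hp⟩, rfl⟩
      exact ⟨u, hu, p, hp, rfl⟩
  rw [this]
  exact (hU.prod hS).image _ continuous_spinPt.continuousOn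

/-- Off the axis `unspin` is a continuous left inverse of every rotation, so it maps a component of
the swept out set into a component of `M`. Conversely, `U` times a component of `M` is connected. -/
theorem connectedComponentIn_spin {U : Set Circle} (hU : IsPreconnected U) {M : Set (J1 ℝ)}
    (hM : ∀ p ∈ M, p.1 < 0) {u : Circle} (hu : u ∈ U) {p : J1 ℝ} (hp : p ∈ M) :
    connectedComponentIn (spin U M) (spinPt u p) = spin U (connectedComponentIn M p) := by
  apply subset_antisymm
  · have hsub := connectedComponentIn_subset (spin U M) (spinPt u p)
    have hc : IsPreconnected (unspin '' connectedComponentIn (spin U M) (spinPt u p)) := by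
      refine isPreconnected_connectedComponentIn.image _ fun q hq => ?_
      obtain ⟨v, -, r, hr, rfl⟩ := hsub hq
      exact (continuousAt_unspin (spinPt_fst_ne_zero (hM r hr))).continuousWithinAt
    have hc' : unspin '' connectedComponentIn (spin U M) (spinPt u p)
        ⊆ connectedComponentIn M p := by
      refine hc.subset_connectedComponentIn
        ⟨_, mem_connectedComponentIn (spinPt_mem_spin hu hp), unspin_spinPt (hM p hp)⟩ ?_
      rintro _ ⟨q, hq, rfl⟩
      obtain ⟨v, -, r, hr, rfl⟩ := hsub hq
      rwa [unspin_spinPt (hM r hr)]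
    intro q hq
    obtain ⟨v, hv, r, hr, rfl⟩ := hsub hq
    refine spinPt_mem_spin hv (hc' ⟨_, hq, unspin_spinPt (hM r hr)⟩)
  · refine (isPreconnected_spin hU isPreconnected_connectedComponentIn).subset_connectedComponentIn
      (spinPt_mem_spin hu (mem_connectedComponentIn hp)) ?_
    rintro _ ⟨v, hv, r, hr, rfl⟩
    exact spinPt_mem_spin hv (connectedComponentIn_subset _ _ hr)

theorem spin_injOn {U : Set Circle} (hU : U.Nonempty) {S S' : Set (J1 ℝ)}
    (hS : ∀ p ∈ S, p.1 < 0) (hS' : ∀ p ∈ S', p.1 < 0) (h : spin U S = spin U S') : S = S' := by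
  obtain ⟨u, hu⟩ := hU
  apply subset_antisymm
  · intro p hp
    obtain ⟨v, -, r, hr, hpr⟩ := h ▸ spinPt_mem_spin hu hp
    rw [← unspin_spinPt (u := u) (hS p hp), hpr, unspin_spinPt (hS' r hr)]
    exact hr
  · intro p hp
    obtain ⟨v, -, r, hr, hpr⟩ := h ▸ spinPt_mem_spin hu hp
    rw [← unspin_spinPt (u := u) (hS' p hp), hpr, unspin_spinPt (hS r hr)]
    exact hr

theorem spinPt_mem_frontSpin {Λ : Set (J1 ℝ)} (u : Circle) {p : J1 ℝ} (hp : p ∈ Λ) :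
    spinPt u p ∈ frontSpin Λ := ⟨u, p, hp, rfl⟩

/-- Off the axis, the cusp edges of the front spin are the rotations of the cusps. -/
theorem spinPt_mem_foldLocus {Λ : Set (J1 ℝ)} (hneg : ∀ p ∈ Λ, p.1 ≤ 0) {u : Circle} {p : J1 ℝ}
    (hp : p ∈ Λ) (hx : p.1 < 0) : spinPt u p ∈ foldLocus (frontSpin Λ) ↔ p ∈ foldLocus Λ := by
  rw [← not_iff_not, not_mem_foldLocus hp, not_mem_foldLocus (spinPt_mem_frontSpin u hp)]
  constructor
  · rintro ⟨N, hN, hinj⟩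
    have hc : Continuous (spinPt u) := continuous_spinPt.comp (by fun_prop : Continuous fun p => (u, p))
    refine ⟨_, hc.tendsto p hN, ?_⟩
    rintro q ⟨hq, hqN⟩ r ⟨hr, hrN⟩ hqr
    refine spinPt_injective u (hinj ⟨spinPt_mem_frontSpin u hq, hqN⟩
      ⟨spinPt_mem_frontSpin u hr, hrN⟩ ?_)
    simp [spinPt, hqr]
  · rintro ⟨N, hN, hinj⟩
    -- Off the axis equal base points force equal rotations, so that pulling back by `unspin`
    -- transports injectivity from `Λ`.
    have h1 : unspin ⁻¹' N ∈ 𝓝 (spinPt u p) := by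
      apply continuousAt_unspin (spinPt_fst_ne_zero hx)
      rwa [unspin_spinPt hx]
    have h2 : {q : J1 ℂ | q.1 ≠ 0} ∈ 𝓝 (spinPt u p) :=
      (isOpen_ne_fun continuous_fst continuous_const).mem_nhds (spinPt_fst_ne_zero hx)
    refine ⟨_, Filter.inter_mem h1 h2, ?_⟩
    rintro _ ⟨⟨v, q, hq, rfl⟩, hqN, hq0⟩ _ ⟨⟨w, r, hr, rfl⟩, hrN, hr0⟩ hqr
    have hq' : q.1 < 0 := (hneg q hq).lt_of_ne (by rintro h; simp [spinPt, h] at hq0)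
    have hr' : r.1 < 0 := (hneg r hr).lt_of_ne (by rintro h; simp [spinPt, h] at hr0)
    obtain ⟨h3, rfl⟩ := spinPt_fst_eq hq' hr'.le hqr
    rw [mem_preimage, unspin_spinPt hq'] at hqN
    rw [mem_preimage, unspin_spinPt hr'] at hrN
    rw [hinj ⟨hq, hqN⟩ ⟨hr, hrN⟩ h3]

/-- The limit points of a rotated sheet are the rotated limit points. -/
theorem touches_spin {W : Type} [TopologicalSpace W] {D : Set W} {χ : W → ℂ} {x : W → ℝ}
    {r : W → Circle} (hr : Continuous r) (hχ : ∀ w, χ w = x w * r w) (hx : ∀ w ∈ D, x w < 0)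
    {U : Set Circle} (hU : ∀ w ∈ D, r w ∈ U) {S : Set (J1 ℝ)} (hS : ∀ p ∈ S, p.1 ≤ 0) {w₀ : W}
    {p' : J1 ℂ} : Touches D χ w₀ (spin U S) p' ↔
      ∃ p, Touches D x w₀ S p ∧ p' = spinPt (r w₀) p := by
  -- Over `D` the radius `x w` is nonzero, so every point above `χ w` is a rotation through the one
  -- direction `r w`.
  have hset : ∀ w q', (w ∈ D ∧ q' ∈ spin U S ∧ q'.1 = χ w) ↔
      ∃ q, (w ∈ D ∧ q ∈ S ∧ q.1 = x w) ∧ q' = spinPt (r w) q := by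
    intro w q'
    constructor
    · rintro ⟨hw, ⟨u, hu, q, hq, rfl⟩, hqw⟩
      rw [hχ] at hqw
      obtain ⟨h1, h2⟩ := spinPt_fst_eq (hx w hw) (hS q hq) hqw.symm
      exact ⟨q, ⟨hw, hq, h1.symm⟩, by rw [h2]⟩
    · rintro ⟨q, ⟨hw, hq, hqw⟩, rfl⟩
      refine ⟨hw, spinPt_mem_spin (hU w hw) hq, ?_⟩
      rw [hχ, ← hqw]
      rfl
  constructor
  · intro h
    -- Unlike `unspin`, `rotBack` is continuous also above the axis, so the argument covers boundary
    -- points with `x w₀ = 0`.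
    have hc : Continuous fun v : W × J1 ℂ => (v.1, rotBack (r v.1) v.2) := by
      have := continuous_rotBack.comp (by fun_prop : Continuous fun v : W × J1 ℂ => (r v.1, v.2))
      fun_prop
    refine ⟨rotBack (r w₀) p', ?_, ?_⟩
    · refine map_mem_closure (f := fun v : W × J1 ℂ => (v.1, rotBack (r v.1) v.2)) hc h ?_
      rintro ⟨w, q'⟩ hq'
      obtain ⟨q, hq, h2⟩ := (hset w q').1 hq'
      dsimp only at h2 ⊢
      rw [h2, rotBack_spinPt]
      exact hq
    -- Being the rotation of a point of `J¹ℝ` is a closed condition and passes to the limit.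
    · have hcl : IsClosed {v : W × J1 ℂ | v.2 = spinPt (r v.1) (rotBack (r v.1) v.2)} := by
        refine isClosed_eq continuous_snd ?_
        exact continuous_spinPt.comp ((hr.comp continuous_fst).prodMk
          (continuous_snd.comp hc))
      refine closure_minimal (t := {v : W × J1 ℂ | v.2 = spinPt (r v.1) (rotBack (r v.1) v.2)})
        ?_ hcl h
      rintro ⟨w, q'⟩ hq'
      obtain ⟨q, hq, h2⟩ := (hset w q').1 hq'
      rw [mem_ofPred_eq, h2, rotBack_spinPt]
  · rintro ⟨p, hp, rfl⟩
    have hc : Continuous fun v : W × J1 ℝ => (v.1, spinPt (r v.1) v.2) := by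
      have := continuous_spinPt.comp (by fun_prop : Continuous fun v : W × J1 ℝ => (r v.1, v.2))
      fun_prop
    refine map_mem_closure (f := fun v : W × J1 ℝ => (v.1, spinPt (r v.1) v.2)) hc hp ?_
    rintro ⟨w, q⟩ hq
    exact (hset w _).2 ⟨q, hq, rfl⟩

/-! ### The circle of directions -/

/-- The point with polar angle `2πφ` of the circle. -/
def turn (φ : ℝ) : Circle := Circle.exp (2 * Real.pi * φ)

theorem continuous_turn : Continuous turn := by
  unfold turn
  fun_prop

/-- The shift of the angle by `-π` contributes a sign that cancels the one in `-x`; thus `φ = 0` is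
the trivial rotation. -/
theorem polar_eq (x φ : ℝ) : polar x φ = x * turn φ := by
  have : Complex.exp ((2 * Real.pi * φ - Real.pi : ℝ) * Complex.I)
      = - Complex.exp ((2 * Real.pi * φ : ℝ) * Complex.I) := by
    push_cast
    rw [sub_mul, Complex.exp_sub, Complex.exp_pi_mul_I]
    ring
  rw [polar, this, turn, Circle.coe_exp]
  ring

theorem turn_zero : turn 0 = 1 := by simp [turn]

theorem turn_one : turn 1 = 1 := by simp [turn]

/-- The directions of the open spun cells. -/
def turns : Set Circle := turn '' openI

theorem isPreconnected_turns : IsPreconnected turns :=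
  isPreconnected_Ioo.image _ continuous_turn.continuousOn

theorem turns_nonempty : turns.Nonempty := ⟨_, 1 / 2, ⟨by norm_num, by norm_num⟩, rfl⟩

/-- The spun cells miss just the direction in which the original cells lie. -/
theorem mem_turns {u : Circle} : u ∈ turns ↔ u ≠ 1 := by
  constructor
  · rintro ⟨φ, hφ, rfl⟩ h
    rw [turn, ← Circle.exp_zero, Circle.exp_eq_exp] at h
    obtain ⟨m, hm⟩ := h
    have h1 : φ = m := by
      have := Real.pi_pos
      have : 2 * Real.pi * (φ - m) = 0 := by linarith
      have := (mul_eq_zero.1 this).resolve_left (by positivity)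
      linarith
    rw [h1] at hφ
    have h2 : (0 : ℤ) < m := by exact_mod_cast hφ.1
    have h3 : m < (1 : ℤ) := by exact_mod_cast hφ.2
    omega
  · intro hu
    have hpi := Real.pi_pos
    -- The argument measured in full turns. Its fractional part lies in `[0, 1)` and is not `0`
    -- because `u ≠ 1`.
    set a := Complex.arg u / (2 * Real.pi) with ha
    have hau : turn a = u := by
      rw [turn, ha, mul_div_cancel₀ _ (by positivity : 2 * Real.pi ≠ 0), Circle.exp_arg]
    have hfr : turn (Int.fract a) = u := by
      rw [← hau, turn, turn, Circle.exp_eq_exp]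
      refine ⟨-⌊a⌋, ?_⟩
      rw [Int.fract]
      push_cast
      ring
    refine ⟨Int.fract a, ⟨(Int.fract_nonneg a).lt_of_ne fun h => hu ?_, Int.fract_lt_one a⟩, hfr⟩
    rw [← hfr, ← h, turn_zero]

/-! ## Sheets of the front spin -/

namespace TameFront

variable {Λ : Set (J1 ℝ)} {T : Finset ℝ}

/-- The shape of the cell enters only through `hK'`, so that `U = {1}` and `U = turns` treat `e` and
`ê` alike. -/
theorem partOver_frontSpin (h : TameFront Λ T) {U : Set Circle} {K : Set ℝ} (hK : ∀ x ∈ K, x < 0)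
    {K' : Set ℂ} (hK' : ∀ w, w ∈ K' ↔ ∃ x ∈ K, ∃ u ∈ U, w = x * u) :
    partOver (frontSpin Λ) K' = spin U (partOver Λ K) := by
  ext q
  constructor
  · rintro ⟨⟨u, p, hp, rfl⟩, hq⟩
    obtain ⟨x, hx, v, hv, hxv⟩ := (hK' _).1 hq
    obtain ⟨h1, h2⟩ := spinPt_fst_eq (hK x hx) (h.nonpos p hp) hxv.symm
    exact spinPt_mem_spin (h2 ▸ hv) ⟨hp, h1 ▸ hx⟩
  · rintro ⟨u, hu, p, hp, rfl⟩
    exact ⟨spinPt_mem_frontSpin u hp.1, (hK' _).2 ⟨p.1, hp.2, u, hu, rfl⟩⟩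

/-- Off the axis a base point determines the rotation, so the fibre is a rotated fibre of `Λ`, hence
finite. -/
theorem not_isConeCircle_off_axis (h : TameFront Λ T) {C : Set (J1 ℂ)} (hC : C ⊆ frontSpin Λ)
    (h0 : ∃ q ∈ C, q.1 ≠ 0) : ¬ IsConeCircle C := by
  intro hcone
  obtain ⟨q, hq, hq0⟩ := h0
  obtain ⟨x, hx⟩ := hcone.1
  refine infinite_of_isConeCircle hcone ?_
  obtain ⟨u, p, hp, rfl⟩ := hC hq
  have hp1 : p.1 < 0 := (h.nonpos p hp).lt_of_ne (by intro h; simp [spinPt, h] at hq0)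
  refine ((h.finite_fibre p.1).image (spinPt u)).subset ?_
  intro r hr
  obtain ⟨v, s, hs, rfl⟩ := hC hr
  obtain ⟨h1, h2⟩ := spinPt_fst_eq hp1 (h.nonpos s hs) ((hx _ hq).trans (hx _ hr).symm)
  exact ⟨s, ⟨hs, h1.symm⟩, by rw [h2]⟩

/-- Off the axis, the sheets of the front spin above the set swept out by `K` are the sets swept out
by the sheets above `K`. -/
theorem exists_spinSheet (h : TameFront Λ T) {U : Set Circle} (hU : IsPreconnected U)
    (hUn : U.Nonempty) {K : Set ℝ} (hK : ∀ x ∈ K, x < 0)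
    {K' : Set ℂ} (hK' : ∀ w, w ∈ K' ↔ ∃ x ∈ K, ∃ u ∈ U, w = x * u) :
    ∃ σ : Sheet Λ K ≃ Sheet (frontSpin Λ) K', ∀ S, (σ S).pts = spin U S.pts := by
  have hpart := h.partOver_frontSpin hK hK'
  have hneg : ∀ p ∈ partOver Λ K, p.1 < 0 := fun p hp => hK _ hp.2
  have hmk : ∀ S : Sheet Λ K, IsSheet (frontSpin Λ) K' (spin U S.pts, false) := by
    intro S
    refine ⟨?_, Or.inr ⟨?_, rfl⟩⟩
    · obtain ⟨p, hp⟩ := pts_nonempty S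
      obtain ⟨u, hu⟩ := hUn
      have hp' := pts_subset S hp
      refine ⟨spinPt u p, hpart ▸ spinPt_mem_spin hu hp', ?_⟩
      rw [hpart, connectedComponentIn_spin hU hneg hu hp', ← pts_eq_of_mem S hp]
    · intro hf
      refine (h.sheet_lower S).1 fun p hp => ?_
      obtain ⟨u, hu⟩ := hUn
      exact (spinPt_mem_foldLocus h.nonpos (pts_subset S hp).1 (hneg p (pts_subset S hp))).1
        (hf (spinPt_mem_spin hu hp))
  refine ⟨Equiv.ofBijective (fun S => ⟨_, hmk S⟩) ⟨?_, ?_⟩, fun S => rfl⟩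
  · intro S S' hSS
    have h1 : spin U S.pts = spin U S'.pts := congrArg (fun S'' : Sheet (frontSpin Λ) K' => S''.1.1) hSS
    have h2 := spin_injOn hUn (fun p hp => hneg p (pts_subset S hp))
      (fun p hp => hneg p (pts_subset S' hp)) h1
    obtain ⟨p, hp⟩ := pts_nonempty S
    exact h.sheet_ext hp (h2 ▸ hp)
  · intro S'
    obtain ⟨q, hq⟩ := pts_nonempty S'
    have hq' := pts_subset S' hq
    rw [hpart] at hq'
    obtain ⟨u, hu, p, hp, rfl⟩ := hq'
    have hS' := pts_eq_of_mem S' hq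
    rw [hpart, connectedComponentIn_spin hU hneg hu hp] at hS'
    have hncone : ¬ IsConeCircle S'.pts := h.not_isConeCircle_off_axis
      (fun r hr => (pts_subset S' hr).1) ⟨_, hq, spinPt_fst_ne_zero (hneg p hp)⟩
    have hS2 := S'.2.2.resolve_left hncone
    have hnf : ¬ connectedComponentIn (partOver Λ K) p ⊆ foldLocus Λ := by
      intro hf
      refine hS2.1 ?_
      rintro r (hr : r ∈ S'.pts)
      rw [hS'] at hr
      obtain ⟨v, hv, s, hs, rfl⟩ := hr
      have hs' := connectedComponentIn_subset _ _ hs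
      exact (spinPt_mem_foldLocus h.nonpos hs'.1 (hneg s hs')).2 (hf hs)
    refine ⟨⟨(connectedComponentIn (partOver Λ K) p, false), ⟨p, hp, rfl⟩, Or.inr ⟨hnf, rfl⟩⟩, ?_⟩
    exact Subtype.ext (Prod.ext hS'.symm hS2.2.symm)

theorem above_spin_iff (h : TameFront Λ T) {U : Set Circle} (hUn : U.Nonempty) {K : Set ℝ}
    (hK : ∀ x ∈ K, x < 0) {K' : Set ℂ} {S₁ S₂ : Sheet Λ K} {S₁' S₂' : Sheet (frontSpin Λ) K'}
    (h₁ : S₁'.pts = spin U S₁.pts) (h₂ : S₂'.pts = spin U S₂.pts) :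
    Above S₁' S₂' ↔ Above S₁ S₂ := by
  unfold Above
  rw [h₁, h₂]
  constructor
  · intro hA p hp q hq hpq
    obtain ⟨u, hu⟩ := hUn
    exact hA _ (spinPt_mem_spin hu hp) _ (spinPt_mem_spin hu hq) (by simp [spinPt, hpq])
  · rintro hA _ ⟨u, hu, p, hp, rfl⟩ _ ⟨v, hv, q, hq, rfl⟩ hpq
    exact hA p hp q hq (spinPt_fst_eq (hK _ (pts_subset S₁ hp).2)
      (h.nonpos q (pts_subset S₂ hq).1) hpq).1

/-! ### Sheets above the axis -/

/-- No three endpoints share a height, applied to `p`, its reflection and `q`. If `p` is its own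
reflection this says nothing, and the reflection of `q` is used instead. -/
theorem axis_same_height (h : TameFront Λ T) {p q : J1 ℝ} (hp : p ∈ Λ) (hq : q ∈ Λ)
    (hpx : p.1 = 0) (hqx : q.1 = 0) (hz : p.2.2 = q.2.2) : q = p ∨ q = (0, -p.2.1, p.2.2) := by
  have hp' := h.axis_partner hp hpx
  rcases h.no_triple p hp _ hp' q hq hpx rfl hqx.symm hz with h1 | h1 | h1
  · have hy : p.2.1 = 0 := by
      have := congrArg (fun r : J1 ℝ => r.2.1) h1
      dsimp only at this
      linarith
    have hq' := h.axis_partner hq hqx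
    rcases h.no_triple p hp q hq _ hq' (hpx.trans hqx.symm) hz hqx rfl with h2 | h2 | h2
    · exact Or.inl h2.symm
    · left
      have := congrArg (fun r : J1 ℝ => r.2.1) h2
      dsimp only at this
      exact Prod.ext (hqx.trans hpx.symm) (Prod.ext (by linarith) hz.symm)
    · left
      have := congrArg (fun r : J1 ℝ => r.2.1) h2
      dsimp only at this
      exact Prod.ext (hqx.trans hpx.symm) (Prod.ext (by linarith) hz.symm)
  · exact Or.inr h1.symm
  · exact Or.inl h1.symm

/-- The half turn takes `(0, y, z)` to `(0, -y, z)`. For this reason a matched pair yields a single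
circle. -/
theorem spin_univ_partner (p : J1 ℝ) (hx : p.1 = 0) :
    spin univ {((0, -p.2.1, p.2.2) : J1 ℝ)} = spin univ {p} := by
  have key : ∀ q : J1 ℝ, q.1 = 0 → spin univ {((0, -q.2.1, q.2.2) : J1 ℝ)} ⊆ spin univ {q} := by
    rintro q hq _ ⟨u, -, r, rfl, rfl⟩
    refine ⟨-u, mem_univ _, q, rfl, ?_⟩
    simp [spinPt, hq]
  refine subset_antisymm (key p hx) ?_
  have := key (0, -p.2.1, p.2.2) rfl
  simp only [neg_neg] at this
  have hp : ((0, p.2.1, p.2.2) : J1 ℝ) = p := Prod.ext hx.symm rfl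
  rwa [hp] at this

/-- The height takes finitely many values on the fibre, so it is constant on the component. Only `p`
and its reflection have that height, and they sweep out the same circle. -/
theorem connectedComponentIn_axis (h : TameFront Λ T) {p : J1 ℝ} (hp : p ∈ Λ) (hx : p.1 = 0)
    (u : Circle) : connectedComponentIn (partOver (frontSpin Λ) {(0 : ℂ)}) (spinPt u p)
      = spin univ {p} := by
  have hmem : ∀ v, spinPt v p ∈ partOver (frontSpin Λ) {(0 : ℂ)} := fun v =>
    ⟨spinPt_mem_frontSpin v hp, by simp [spinPt, hx]⟩
  apply subset_antisymm
  · have hform : ∀ q ∈ partOver (frontSpin Λ) {(0 : ℂ)}, ∃ v, ∃ r ∈ partOver Λ {0}, q = spinPt v r := by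
      rintro _ ⟨⟨v, r, hr, rfl⟩, hq⟩
      exact ⟨v, r, ⟨hr, by simpa [spinPt] using hq⟩, rfl⟩
    have hc := (isPreconnected_connectedComponentIn
      (F := partOver (frontSpin Λ) {(0 : ℂ)}) (x := spinPt u p)).image (fun q => q.2.2)
      (by fun_prop)
    have hfin : ((fun q : J1 ℝ => q.2.2) '' partOver Λ {0}).Finite := (h.finite_fibre 0).image _
    have hsub := hfin.countable.isTotallyDisconnected _ (by
      rintro _ ⟨q, hq, rfl⟩
      obtain ⟨v, r, hr, rfl⟩ := hform q (connectedComponentIn_subset _ _ hq)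
      exact ⟨r, hr, rfl⟩) hc
    intro q hq
    have hz : q.2.2 = p.2.2 := hsub ⟨q, hq, rfl⟩ ⟨_, mem_connectedComponentIn (hmem u), rfl⟩
    obtain ⟨v, r, hr, rfl⟩ := hform q (connectedComponentIn_subset _ _ hq)
    rcases h.axis_same_height hp hr.1 hx hr.2 hz.symm with rfl | rfl
    · exact spinPt_mem_spin (mem_univ _) rfl
    · rw [← spin_univ_partner p hx]
      exact spinPt_mem_spin (mem_univ _) rfl
  · refine (isPreconnected_spin isPreconnected_univ
      isPreconnected_singleton).subset_connectedComponentIn (spinPt_mem_spin (mem_univ _) rfl) ?_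
    rintro _ ⟨v, -, _, rfl, rfl⟩
    exact hmem v

/-- For `y = 0` rotations fix the point. Otherwise `u ↦ y u` is injective on the compact circle,
hence a homeomorphism onto its image. -/
theorem isConeCircle_axis {p : J1 ℝ} (hx : p.1 = 0) :
    IsConeCircle (spin univ {p}) ↔ p.2.1 ≠ 0 := by
  constructor
  · intro hc hy
    refine infinite_of_isConeCircle hc ((finite_singleton (spinPt 1 p)).subset ?_)
    rintro _ ⟨u, -, _, rfl, rfl⟩
    simp [spinPt, hx, hy]
  · intro hy
    refine ⟨⟨0, ?_⟩, ⟨?_⟩⟩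
    · rintro _ ⟨u, -, _, rfl, rfl⟩
      simp [spinPt, hx]
    · let f : Circle → spin univ {p} := fun u => ⟨spinPt u p, spinPt_mem_spin (mem_univ _) rfl⟩
      have hf : Function.Bijective f := by
        constructor
        · intro u v huv
          have h1 : (p.2.1 : ℂ) * u = p.2.1 * v :=
            congrArg (fun q : spin univ {p} => q.1.2.1) huv
          exact Circle.ext (mul_left_cancel₀ (by exact_mod_cast hy) h1)
        · rintro ⟨_, u, -, _, rfl, rfl⟩
          exact ⟨u, rfl⟩
      have hc : Continuous f :=
        (continuous_spinPt.comp (by fun_prop : Continuous fun u : Circle => (u, p))).subtype_mk _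
      exact (Continuous.homeoOfEquivCompactToT2 (f := Equiv.ofBijective f hf) hc).symm

/-- At the points with `y = 0` above the axis, the front spin is not folded. -/
theorem spinPt_axis_notMem_fold (h : TameFront Λ T) {p : J1 ℝ} (hp : p ∈ Λ) (hx : p.1 = 0)
    (hy : p.2.1 = 0) (u : Circle) : spinPt u p ∉ foldLocus (frontSpin Λ) := by
  rw [not_mem_foldLocus (spinPt_mem_frontSpin u hp)]
  obtain ⟨N, hN, hinj⟩ := h.axis_injOn hp hx
  obtain ⟨ε, hε, hb⟩ := Metric.mem_nhds_iff.1 hN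
  -- The centre `(0, 0, z)` is fixed by all rotations, so distances to it equal distances to `p`.
  have hball : ∀ v r, spinPt v r ∈ Metric.ball (spinPt u p) ε → r ∈ N := by
    intro v r hr
    apply hb
    rw [Metric.mem_ball, Prod.dist_eq, Prod.dist_eq] at hr ⊢
    simpa [spinPt, hx, hy, dist_eq_norm, Circle.norm_coe] using hr
  refine ⟨_, Metric.ball_mem_nhds _ hε, ?_⟩
  rintro _ ⟨⟨v, q, hq, rfl⟩, hqN⟩ _ ⟨⟨w, r, hr, rfl⟩, hrN⟩ hqr
  have hqN' := hball v q hqN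
  have hrN' := hball w r hrN
  rcases (h.nonpos q hq).lt_or_eq with hq1 | hq1
  · obtain ⟨h1, rfl⟩ := spinPt_fst_eq hq1 (h.nonpos r hr) hqr
    rw [hinj ⟨hq, hqN'⟩ ⟨hr, hrN'⟩ h1]
  · have hr1 : r.1 = 0 := by
      have : (r.1 : ℂ) * w = 0 := by
        have : (q.1 : ℂ) * v = r.1 * w := hqr
        rw [← this, hq1]
        simp
      simpa using this
    have hpN := mem_of_mem_nhds hN
    rw [hinj ⟨hq, hqN'⟩ ⟨hp, hpN⟩ (hq1.trans hx.symm), hinj ⟨hr, hrN'⟩ ⟨hp, hpN⟩ (hr1.trans hx.symm)]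
    simp [spinPt, hx, hy]

/-- The sheets of the front spin above the origin correspond to the points above the axis; at a cone
point the upper sheet corresponds to the endpoint with negative slope. -/
theorem exists_axisSheet (h : TameFront Λ T) :
    ∃ σ : Sheet Λ {(0 : ℝ)} ≃ Sheet (frontSpin Λ) {(0 : ℂ)}, ∀ S p, S.pts = {p} →
      (σ S).pts = spin univ {p} ∧ (σ S).lower = decide (0 < p.2.1) := by
  choose f hf hf1 hff hfS using fun S : Sheet Λ {(0 : ℝ)} => h.vert_sheet S
  -- The flag is `true` exactly for positive slope; for slope `0` it is `false`, as a sheet that is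
  -- not a cone circle requires.
  have hmk : ∀ S, IsSheet (frontSpin Λ) {(0 : ℂ)} (spin univ {f S}, decide (0 < (f S).2.1)) := by
    intro S
    refine ⟨⟨spinPt 1 (f S), ⟨spinPt_mem_frontSpin _ (hf S), by simp [spinPt, hf1 S]⟩,
      (h.connectedComponentIn_axis (hf S) (hf1 S) 1).symm⟩, ?_⟩
    by_cases hy : (f S).2.1 = 0
    · refine Or.inr ⟨fun hsub => ?_, by simp [hy]⟩
      exact h.spinPt_axis_notMem_fold (hf S) (hf1 S) hy 1 (hsub (spinPt_mem_spin (mem_univ _) rfl))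
    · exact Or.inl ((isConeCircle_axis (hf1 S)).2 hy)
  refine ⟨Equiv.ofBijective (fun S => ⟨_, hmk S⟩) ⟨?_, ?_⟩, ?_⟩
  · intro S S' hSS
    have h1 : spin univ {f S} = spin univ {f S'} := congrArg (fun S'' => S''.1.1) hSS
    have h2 : decide (0 < (f S).2.1) = decide (0 < (f S').2.1) := congrArg (fun S'' => S''.1.2) hSS
    have h3 : (f S).2.2 = (f S').2.2 := by
      obtain ⟨v, -, _, rfl, hv⟩ := h1 ▸ spinPt_mem_spin (mem_univ 1) (mem_singleton (f S))
      exact congrArg (fun q : J1 ℂ => q.2.2) hv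
    -- Otherwise `f S'` is the reflection of `f S`; its slope has the opposite sign, so equal flags
    -- force slope `0`.
    have h4 : f S' = f S := by
      rcases h.axis_same_height (hf S) (hf S') (hf1 S) (hf1 S') h3 with h4 | h4
      · exact h4
      · rw [h4] at h2
        simp only [decide_eq_decide] at h2
        have h5 : (f S).2.1 = 0 := by
          rcases lt_trichotomy (f S).2.1 0 with h6 | h6 | h6
          · exact absurd (h2.2 (by linarith)) (by linarith)
          · exact h6
          · exact absurd (h2.1 h6) (by simp only [not_lt]; linarith)
        rw [h4]
        exact Prod.ext (hf1 S).symm (Prod.ext (by simp [h5]) rfl)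
    exact h.sheet_ext (p := f S) (by rw [hfS S]; rfl) (by rw [hfS S', h4]; rfl)
  · intro S'
    have hS' := pts_nonempty S'
    obtain ⟨q, hq⟩ := hS'
    obtain ⟨⟨u, p, hp, rfl⟩, hq0⟩ := pts_subset S' hq
    have hx : p.1 = 0 := by simpa [spinPt] using hq0
    have hpts := pts_eq_of_mem S' hq
    rw [h.connectedComponentIn_axis hp hx] at hpts
    -- Of the two endpoints that sweep out a cone circle, the flag selects one by the sign of its
    -- slope.
    have hex : ∃ r ∈ Λ, r.1 = 0 ∧ spin univ {r} = spin univ {p} ∧ decide (0 < r.2.1) = S'.lower := by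
      by_cases hy : p.2.1 = 0
      · refine ⟨p, hp, hx, rfl, ?_⟩
        have := S'.2.2.resolve_left (by
          rw [show S'.1.1 = spin univ {p} from hpts, isConeCircle_axis hx]
          simpa using hy)
        rw [show S'.lower = false from this.2]
        simp [hy]
      · have hp' := h.axis_partner hp hx
        rcases hb : S'.lower with _ | _
        · rcases lt_or_gt_of_ne hy with hlt | hlt
          · exact ⟨p, hp, hx, rfl, by simp [hlt.le]⟩
          · exact ⟨_, hp', rfl, spin_univ_partner p hx, by simp [hlt.le]⟩
        · rcases lt_or_gt_of_ne hy with hlt | hlt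
          · exact ⟨_, hp', rfl, spin_univ_partner p hx, by simp [hlt]⟩
          · exact ⟨p, hp, hx, rfl, by simp [hlt]⟩
    obtain ⟨r, hr, hrx, hrs, hrl⟩ := hex
    obtain ⟨S, hS⟩ := h.vert_exists_sheet hr hrx (h.axis_notMem_fold hrx)
    have hfr : f S = r := by
      have := hfS S
      rw [hS] at this
      exact (singleton_injective this).symm
    refine ⟨S, Subtype.ext (Prod.ext ?_ ?_)⟩
    · exact (congrArg (fun p => spin univ {p}) hfr).trans (hrs.trans hpts.symm)
    · exact (congrArg (fun p : J1 ℝ => decide (0 < p.2.1)) hfr).trans hrl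
  · intro S p hSp
    have hfr : f S = p := by
      have := hfS S
      rw [hSp] at this
      exact (singleton_injective this).symm
    subst hfr
    exact ⟨rfl, rfl⟩

end TameFront

/-! ### Closures and cusps of rotated sheets -/

namespace TameFront

variable {Λ : Set (J1 ℝ)} {T : Finset ℝ}

/-- The bijection from the sheets of `Λ` above a 0-cell to the sheets of the front spin above the
corresponding 0-cell. -/
structure VertCorr {t : ℝ} (σ : Sheet Λ {t} ≃ Sheet (frontSpin Λ) {(t : ℂ)}) : Prop where
  nonpos : t ≤ 0
  off : t < 0 → ∀ S, (σ S).pts = spin {1} S.pts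
  axis : t = 0 → ∀ S p, S.pts = {p} →
    (σ S).pts = spin univ {p} ∧ (σ S).lower = decide (0 < p.2.1)

theorem exists_vertCorr (h : TameFront Λ T) {t : ℝ} (ht : t ≤ 0) :
    ∃ σ : Sheet Λ {t} ≃ Sheet (frontSpin Λ) {(t : ℂ)}, VertCorr σ := by
  rcases ht.lt_or_eq with hlt | rfl
  · obtain ⟨σ, hσ⟩ := h.exists_spinSheet (U := {1}) isPreconnected_singleton
      (singleton_nonempty 1) (K := {t}) (by simpa using hlt) (K' := {(t : ℂ)}) (by simp)
    exact ⟨σ, ht, fun _ => hσ, fun h0 => absurd h0 hlt.ne⟩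
  · have key : ∀ w : ℂ, w = 0 → ∃ σ : Sheet Λ {(0 : ℝ)} ≃ Sheet (frontSpin Λ) {w},
        ∀ S p, S.pts = {p} →
          (σ S).pts = spin univ {p} ∧ (σ S).lower = decide (0 < p.2.1) := by
      rintro _ rfl
      exact h.exists_axisSheet
    obtain ⟨σ, hσ⟩ := key _ Complex.ofReal_zero
    exact ⟨σ, ht, fun h0 => absurd h0 (lt_irrefl _), fun _ => hσ⟩

namespace VertCorr

variable {t : ℝ} {σ : Sheet Λ {t} ≃ Sheet (frontSpin Λ) {(t : ℂ)}}

theorem spinPt_mem (hσ : VertCorr σ) (h : TameFront Λ T) (S : Sheet Λ {t}) :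
    spinPt 1 '' S.pts ⊆ (σ S).pts := by
  obtain ⟨p, -, -, -, hS⟩ := h.vert_sheet S
  rcases hσ.nonpos.lt_or_eq with hlt | heq
  · rw [hσ.off hlt]
    rintro _ ⟨q, hq, rfl⟩
    exact spinPt_mem_spin rfl hq
  · rw [(hσ.axis heq S p hS).1, hS]
    rintro _ ⟨q, hq, rfl⟩
    exact spinPt_mem_spin (mem_univ _) hq

theorem above_iff (hσ : VertCorr σ) (h : TameFront Λ T) (S S' : Sheet Λ {t}) :
    Above (σ S) (σ S') ↔ Above S S' := by
  rcases hσ.nonpos.lt_or_eq with hlt | heq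
  · exact h.above_spin_iff (singleton_nonempty 1) (by simpa using hlt) (hσ.off hlt S)
      (hσ.off hlt S')
  · obtain ⟨p, -, hpx, -, hS⟩ := h.vert_sheet S
    obtain ⟨q, -, hqx, -, hS'⟩ := h.vert_sheet S'
    rw [vert_above_iff (hpx.trans hqx.symm) hS hS', Above, (hσ.axis heq S p hS).1,
      (hσ.axis heq S' q hS').1]
    constructor
    · intro hA
      exact hA _ (spinPt_mem_spin (mem_univ 1) rfl) _ (spinPt_mem_spin (mem_univ 1) rfl)
        (by simp [spinPt, hpx, hqx])
    · rintro hz _ ⟨u, -, _, rfl, rfl⟩ _ ⟨v, -, _, rfl, rfl⟩ -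
      exact hz

end VertCorr

theorem limits_line_iff (h : TameFront Λ T) {K K' : Set ℝ} {D : Set ℝ} {χ : ℝ → ℝ} {u : ℝ}
    (S : Sheet Λ K) (P : Sheet Λ K') : Limits D χ u S P ↔ ∃ p ∈ P.pts, Touches D χ u S.pts p :=
  ⟨fun hl => hl.1, fun hl => ⟨hl, fun hc => absurd hc
    (h.not_isConeCircle fun _ hp => (pts_subset P hp).1)⟩⟩

/-- The closure relation of sheets off the axis. -/
theorem limits_spin_iff (h : TameFront Λ T) {U : Set Circle} {K : Set ℝ} {K₁ K₂ : Set ℂ}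
    (hK : ∀ x ∈ K, x < 0) {P : Sheet Λ K} {P' : Sheet (frontSpin Λ) K₁} (hUn : U.Nonempty)
    (hP : P'.pts = spin U P.pts) {W : Type} [TopologicalSpace W] {D : Set W} {χ : W → ℂ} {w₀ : W}
    {S' : Sheet (frontSpin Λ) K₂} {R : J1 ℝ → Prop} {v : Circle} (hv : v ∈ U)
    (hR : ∀ p, R p → p.1 ≤ 0)
    (hS' : ∀ p', Touches D χ w₀ S'.pts p' ↔ ∃ p, R p ∧ p' = spinPt v p) :
    Limits D χ w₀ S' P' ↔ ∃ p ∈ P.pts, R p := by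
  have hnc : ¬ IsConeCircle P'.pts := by
    refine h.not_isConeCircle_off_axis (fun r hr => (pts_subset P' hr).1) ?_
    obtain ⟨p, hp⟩ := pts_nonempty P
    obtain ⟨u, hu⟩ := hUn
    exact ⟨_, hP ▸ spinPt_mem_spin hu hp, spinPt_fst_ne_zero (hK _ (pts_subset P hp).2)⟩
  have : Limits D χ w₀ S' P' ↔ ∃ p ∈ P'.pts, Touches D χ w₀ S'.pts p :=
    ⟨fun hl => hl.1, fun hl => ⟨hl, fun hc => absurd hc hnc⟩⟩
  rw [this, hP]
  constructor
  · rintro ⟨_, ⟨u, hu, p, hp, rfl⟩, ht⟩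
    obtain ⟨q, hq, hqp⟩ := (hS' _).1 ht
    obtain ⟨h1, rfl⟩ := spinPt_fst_eq (hK _ (pts_subset P hp).2) (hR q hq)
      (congrArg Prod.fst hqp)
    exact ⟨p, hp, spinPt_injective u hqp ▸ hq⟩
  · rintro ⟨p, hp, hpR⟩
    exact ⟨_, spinPt_mem_spin hv hp, (hS' _).2 ⟨p, hpR, rfl⟩⟩

/-- The closure relation between the sheets above a 0-cell and the sheets above an adjacent 1- or
2-cell. -/
theorem limits_vert_iff (h : TameFront Λ T) {e : LineEdge Λ T} {s₀ : ℝ} {t : ℝ}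
    (ht : e.path s₀ = t) (hs₀ : s₀ ∈ Icc (0 : ℝ) 1)
    {σ : Sheet Λ {t} ≃ Sheet (frontSpin Λ) {(t : ℂ)}} (hσ : VertCorr σ) {K : Set ℂ}
    {τ : Sheet Λ e.ivl ≃ Sheet (frontSpin Λ) K} (hτ : ∀ S S', Above (τ S) (τ S') ↔ Above S S')
    {W : Type} [TopologicalSpace W] {D : Set W} {χ : W → ℂ} {w₀ : W} {v : Circle}
    (hv : t < 0 → v = 1)
    (htouch : ∀ S p', Touches D χ w₀ (τ S).pts p' ↔
      ∃ p, Touches openI e.path s₀ S.pts p ∧ p' = spinPt v p)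
    (S : Sheet Λ e.ivl) (P : Sheet Λ {t}) :
    Limits D χ w₀ (τ S) (σ P) ↔ Limits openI e.path s₀ S P := by
  rw [h.limits_line_iff]
  rcases hσ.nonpos.lt_or_eq with hlt | heq
  · exact h.limits_spin_iff (by simpa using hlt) (singleton_nonempty 1) (hσ.off hlt P)
      (hv hlt) (fun p hp => h.nonpos p (h.touches_mem hp).1) (htouch S)
  -- Edges run away from the axis, so only the inner end can lie on it.
  have hs0 : s₀ = 0 := by
    by_contra hne
    have h1 := e.strictAnti_path (hs₀.1.lt_of_ne (Ne.symm hne))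
    rw [e.path_zero] at h1
    linarith [h.nonpos_of_mem e.1.1.2]
  subst hs0
  have he : e.1.1.1 = 0 := by rw [← e.path_zero, ht, heq]
  obtain ⟨p, hp, hpx, -, hP⟩ := h.vert_sheet P
  rw [heq] at hpx
  obtain ⟨hpts, hlow⟩ := hσ.axis heq P p hP
  -- Meeting the circle swept out by `p` does not distinguish between ending at `p` and ending at
  -- its reflection. This is left to the flag.
  have hmeet : ∀ S', (∃ p' ∈ (σ P).pts, Touches D χ w₀ (τ S').pts p') ↔
      Touches openI e.path 0 S'.pts p ∨ Touches openI e.path 0 S'.pts (0, -p.2.1, p.2.2) := by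
    intro S'
    rw [hpts]
    constructor
    · rintro ⟨_, ⟨u, -, _, rfl, rfl⟩, hq⟩
      obtain ⟨r, hr, hqr⟩ := (htouch S' _).1 hq
      obtain ⟨hrΛ, hrx⟩ := h.touches_mem hr
      rw [ht, heq] at hrx
      have hz := congrArg (fun q : J1 ℂ => q.2.2) hqr
      rcases h.axis_same_height hp hrΛ hpx hrx hz with rfl | rfl
      · exact Or.inl hr
      · exact Or.inr hr
    · rintro (hr | hr)
      · exact ⟨_, spinPt_mem_spin (mem_univ v) rfl, (htouch S' _).2 ⟨_, hr, rfl⟩⟩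
      · exact ⟨_, spin_univ_partner p hpx ▸ spinPt_mem_spin (mem_univ v) rfl,
          (htouch S' _).2 ⟨_, hr, rfl⟩⟩
  have hrhs : (∃ q ∈ P.pts, Touches openI e.path 0 S.pts q) ↔ Touches openI e.path 0 S.pts p := by
    rw [hP]
    simp
  have hcone : IsConeCircle (σ P).pts ↔ p.2.1 ≠ 0 := hpts ▸ isConeCircle_axis hpx
  rw [hrhs, Limits, hmeet, hcone, hlow]
  constructor
  · rintro ⟨hor | hor, hc⟩
    · exact hor
    · by_cases hy : p.2.1 = 0
      · have : ((0, -p.2.1, p.2.2) : J1 ℝ) = p := Prod.ext hpx.symm (Prod.ext (by simp [hy]) rfl)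
        rwa [this] at hor
      exfalso
      -- Here `S` ends at the reflection of `p`. The second sheet at the cone point ends at `p` or
      -- coincides with `S`; either way the order demanded by the flag contradicts the order by
      -- slopes.
      obtain ⟨S'', hS'', hab⟩ := hc hy
      obtain ⟨S', rfl⟩ := τ.surjective S''
      rw [hmeet] at hS''
      rw [hτ, hτ] at hab
      rcases hS'' with hS' | hS'
      · rcases lt_or_gt_of_ne hy with hlt | hlt
        · rw [if_neg (by simp [hlt.le])] at hab
          exact h.edge_above_asymm hab (h.axis_above he hS' hor rfl (by dsimp only; linarith))
        · rw [if_pos (by simp [hlt])] at hab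
          exact h.edge_above_asymm hab (h.axis_above he hor hS' rfl (by dsimp only; linarith))
      · rw [h.axis_eq he hS' hor] at hab
        rw [ite_self] at hab
        exact not_above_self _ hab
  · intro hS
    refine ⟨Or.inl hS, fun hy => ?_⟩
    -- The second sheet at the cone point is the one that ends at the reflection of `p`.
    obtain ⟨S', hS'⟩ := h.axis_exists_sheet he (h.axis_partner hp hpx) rfl
    refine ⟨τ S', (hmeet S').2 (Or.inr hS'), ?_⟩
    rw [hτ, hτ]
    rcases lt_or_gt_of_ne hy with hlt | hlt
    · rw [if_neg (by simp [hlt.le])]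
      exact h.axis_above he hS hS' rfl (by dsimp only; linarith)
    · rw [if_pos (by simp [hlt])]
      exact h.axis_above he hS' hS rfl (by dsimp only; linarith)

/-- Sheets of the front spin meet in a cusp edge if and only if the corresponding sheets of `Λ` meet
in a cusp. -/
theorem meetInCusp_iff (h : TameFront Λ T) {e : LineEdge Λ T} {s₀ : ℝ}
    (hs₀ : s₀ ∈ Icc (0 : ℝ) 1) {K : Set ℂ}
    {τ : Sheet Λ e.ivl ≃ Sheet (frontSpin Λ) K} (hτ : ∀ S S', Above (τ S) (τ S') ↔ Above S S')
    {W : Type} [TopologicalSpace W] {D : Set W} {χ : W → ℂ} {w₀ : W} {v : Circle}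
    (htouch : ∀ S p', Touches D χ w₀ (τ S).pts p' ↔
      ∃ p, Touches openI e.path s₀ S.pts p ∧ p' = spinPt v p)
    (S S' : Sheet Λ e.ivl) :
    MeetInCusp D χ w₀ (τ S) (τ S') ↔ MeetInCusp openI e.path s₀ S S' := by
  rw [MeetInCusp, MeetInCusp, hτ]
  refine and_congr_right fun hab => ?_
  constructor
  · rintro ⟨p', hp', h1, h2⟩
    obtain ⟨p, hp, rfl⟩ := (htouch S _).1 h1
    obtain ⟨q, hq, hpq⟩ := (htouch S' _).1 h2
    obtain rfl := spinPt_injective v hpq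
    obtain ⟨hpΛ, hpx⟩ := h.touches_mem hp
    rcases (h.nonpos p hpΛ).lt_or_eq with hlt | heq
    · exact ⟨p, (spinPt_mem_foldLocus h.nonpos hpΛ hlt).1 hp', hp, hq⟩
    -- Cone circles belong to `foldLocus` too. But two sheets that reach the same point of the
    -- circle in one direction end at the same point of `Λ`, so they are equal.
    · exfalso
      have hs0 : s₀ = 0 := by
        by_contra hne
        have h1 := e.strictAnti_path (hs₀.1.lt_of_ne (Ne.symm hne))
        rw [e.path_zero] at h1
        linarith [h.nonpos_of_mem e.1.1.2]
      subst hs0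
      rw [h.axis_eq (by rw [← e.path_zero, ← hpx, heq]) hp hq] at hab
      exact not_above_self _ hab
  · rintro ⟨p, hp, h1, h2⟩
    have hlt : p.1 < 0 := (h.nonpos p hp.1).lt_of_ne fun h0 => h.axis_notMem_fold h0 hp
    exact ⟨_, (spinPt_mem_foldLocus h.nonpos hp.1 hlt).2 hp, (htouch S _).2 ⟨p, h1, rfl⟩,
      (htouch S' _).2 ⟨p, h2, rfl⟩⟩

/-! ### Matched pairs of endpoints and cone points -/

/-- A common circle gives equal heights, and the flags give the signs of the slopes. Conversely
`p.2.1 < q.2.1` excludes `q = p`, so `q` is the reflection of `p` and `p` has negative slope. -/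
theorem conePair_iff (h : TameFront Λ T) {t : ℝ} (ht : t = 0)
    {σ : Sheet Λ {t} ≃ Sheet (frontSpin Λ) {(t : ℂ)}} (hσ : VertCorr σ) (z : ℝ)
    (S S' : Sheet Λ {t}) : ConePair z (σ S, σ S') ↔ MatchedPair z (S, S') := by
  obtain ⟨p, hp, hpx, -, hS⟩ := h.vert_sheet S
  obtain ⟨q, hq, hqx, -, hS'⟩ := h.vert_sheet S'
  rw [ht] at hpx hqx
  obtain ⟨h1, h2⟩ := hσ.axis ht S p hS
  obtain ⟨h3, h4⟩ := hσ.axis ht S' q hS'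
  simp only [ConePair, MatchedPair, h1, h2, h3, h4, hS, hS', isConeCircle_axis hpx,
    mem_singleton_iff, forall_eq, decide_eq_false_iff_not, decide_eq_true_eq]
  constructor
  · rintro ⟨hy, hC, hy1, hy2, hz⟩
    have hpz : p.2.2 = z := hz _ (spinPt_mem_spin (mem_univ 1) rfl)
    have hqz : q.2.2 = z := hz (spinPt 1 q) (hC ▸ spinPt_mem_spin (mem_univ 1) rfl)
    exact ⟨hpz, hqz, by linarith⟩
  · rintro ⟨hpz, hqz, hy⟩
    rcases h.axis_same_height hp hq hpx hqx (hpz.trans hqz.symm) with h5 | h5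
    · rw [h5] at hy
      exact absurd hy (lt_irrefl _)
    · rw [h5] at hy ⊢
      dsimp only at hy
      refine ⟨by linarith, (spin_univ_partner p hpx).symm, by linarith, by dsimp only; linarith, ?_⟩
      rintro _ ⟨u, -, _, rfl, rfl⟩
      exact hpz

/-- No three endpoints share a height, and the slopes decide which comes first. This makes the
choice in `coneFactor` canonical. -/
theorem matchedPair_unique (h : TameFront Λ T) {t : ℝ} (ht : t = 0) {z : ℝ}
    {r r' : Sheet Λ {t} × Sheet Λ {t}} (hr : MatchedPair z r) (hr' : MatchedPair z r') :
    r = r' := by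
  obtain ⟨p, hp, hpx, -, h1⟩ := h.vert_sheet r.1
  obtain ⟨q, hq, hqx, -, h2⟩ := h.vert_sheet r.2
  obtain ⟨p', hp', hpx', -, h1'⟩ := h.vert_sheet r'.1
  obtain ⟨q', hq', hqx', -, h2'⟩ := h.vert_sheet r'.2
  rw [ht] at hpx hqx hpx' hqx'
  simp only [MatchedPair, h1, h2, h1', h2', mem_singleton_iff, forall_eq] at hr hr'
  have hpp : p = p' := by
    rcases h.no_triple p hp q hq p' hp' (hpx.trans hqx.symm) (by linarith) (hqx.trans hpx'.symm)
      (by linarith) with h3 | h3 | h3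
    · rw [h3] at hr; exact absurd hr.2.2 (lt_irrefl _)
    · subst h3
      rcases h.no_triple p hp q hq q' hq' (hpx.trans hqx.symm) (by linarith) (hqx.trans hqx'.symm)
        (by linarith) with h3 | h3 | h3
      · exact h3
      · rw [h3] at hr'; exact absurd hr'.2.2 (lt_irrefl _)
      · rw [h3] at hr; exact absurd (hr.2.2.trans hr'.2.2) (lt_irrefl _)
    · exact h3
  subst hpp
  have hqq : q = q' := by
    rcases h.no_triple p hp q hq q' hq' (hpx.trans hqx.symm) (by linarith) (hqx.trans hqx'.symm)
      (by linarith) with h3 | h3 | h3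
    · rw [h3] at hr; exact absurd hr.2.2 (lt_irrefl _)
    · exact h3
    · rw [← h3] at hr'; exact absurd hr'.2.2 (lt_irrefl _)
  subst hqq
  exact Prod.ext (h.sheet_ext (p := p) (by rw [h1]; rfl) (by rw [h1']; rfl))
    (h.sheet_ext (p := q) (by rw [h2]; rfl) (by rw [h2']; rfl))

end TameFront

/-! ## Maslov potentials -/

theorem sheetVal_eq {V : Type} [TopologicalSpace V] {m : ℕ} {L : Set (J1 V)} {K : Set V}
    {μ : J1 V → ZMod m} {S : Sheet L K} (hS : ¬ IsConeCircle S.pts) {k : ZMod m}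
    (hk : ∀ p ∈ S.pts, μ p = k) : sheetVal μ S = k := by
  rw [sheetVal, if_neg hS]
  obtain ⟨p, hp⟩ := TameFront.pts_nonempty S
  obtain ⟨q, hq, hqk⟩ := Classical.epsilon_spec (p := fun k => ∃ p ∈ S.pts, μ p = k) ⟨k, p, hp, hk p hp⟩
  rw [← hqk, hk q hq]

namespace TameFront

variable {Λ : Set (J1 ℝ)} {T : Finset ℝ} {m : ℕ} {μ : J1 ℝ → ZMod m} {ν : J1 ℂ → ZMod m}

theorem sheetVal_of_mem (h : TameFront Λ T) (hμ : IsMaslov Λ μ) {K : Set ℝ} {S : Sheet Λ K}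
    (hS : ∀ p ∈ S.pts, p ∉ foldLocus Λ) {p : J1 ℝ} (hp : p ∈ S.pts) : sheetVal μ S = μ p := by
  refine sheetVal_eq (h.not_isConeCircle fun q hq => (pts_subset S hq).1) fun q hq => ?_
  refine eq_of_isPreconnected (isPreconnected_pts S) (f := μ) (fun r hr => ?_) hq hp
  exact (hμ.1 r (pts_subset S hr).1 (hS r hr)).filter_mono
    (nhdsWithin_mono _ fun s hs => (pts_subset S hs).1)

/-- The circle swept out by `p` is connected and avoids the cusp edges, so `ν` is constant along it.
-/
theorem maslov_spinPt (h : TameFront Λ T) (hν : IsMaslov (frontSpin Λ) ν)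
    (hμν : ∀ p ∈ Λ, p.1 < 0 → p ∉ foldLocus Λ → ν (spinPt 1 p) = μ p) {p : J1 ℝ} (hp : p ∈ Λ)
    (hx : p.1 < 0) (hf : p ∉ foldLocus Λ) (u : Circle) : ν (spinPt u p) = μ p := by
  rw [← hμν p hp hx hf]
  refine eq_of_isPreconnected (isPreconnected_spin isPreconnected_univ
    (isPreconnected_singleton (x := p))) (f := ν) ?_ (spinPt_mem_spin (mem_univ u) rfl)
    (spinPt_mem_spin (mem_univ 1) rfl)
  rintro _ ⟨v, -, _, rfl, rfl⟩
  refine (hν.1 _ (spinPt_mem_frontSpin v hp)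
    (fun hf' => hf ((spinPt_mem_foldLocus h.nonpos hp hx).1 hf'))).filter_mono
    (nhdsWithin_mono _ ?_)
  rintro _ ⟨w, -, _, rfl, rfl⟩
  exact spinPt_mem_frontSpin w hp

theorem sheetVal_spin (h : TameFront Λ T) (hμ : IsMaslov Λ μ) (hν : IsMaslov (frontSpin Λ) ν)
    (hμν : ∀ p ∈ Λ, p.1 < 0 → p ∉ foldLocus Λ → ν (spinPt 1 p) = μ p) {U : Set Circle}
    (hUn : U.Nonempty) {K : Set ℝ} (hK : ∀ x ∈ K, x < 0) {K' : Set ℂ} {S : Sheet Λ K}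
    {S' : Sheet (frontSpin Λ) K'} (hS' : S'.pts = spin U S.pts)
    (hS : ∀ p ∈ S.pts, p ∉ foldLocus Λ) : sheetVal ν S' = sheetVal μ S := by
  have hneg : ∀ p ∈ S.pts, p.1 < 0 := fun p hp => hK _ (pts_subset S hp).2
  refine sheetVal_eq (h.not_isConeCircle_off_axis (fun r hr => (pts_subset S' hr).1) ?_) ?_
  · obtain ⟨p, hp⟩ := pts_nonempty S
    obtain ⟨u, hu⟩ := hUn
    exact ⟨_, hS' ▸ spinPt_mem_spin hu hp, spinPt_fst_ne_zero (hneg p hp)⟩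
  · rw [hS']
    rintro _ ⟨u, -, p, hp, rfl⟩
    rw [h.maslov_spinPt hν hμν (pts_subset S hp).1 (hneg p hp) (hS p hp),
      h.sheetVal_of_mem hμ hS hp]

/-- Near the axis, the potential on the front spin is determined by that on `Λ`. -/
theorem eventually_maslov_axis (h : TameFront Λ T) (hμ : IsMaslov Λ μ)
    (hν : IsMaslov (frontSpin Λ) ν)
    (hμν : ∀ p ∈ Λ, p.1 < 0 → p ∉ foldLocus Λ → ν (spinPt 1 p) = μ p) {p : J1 ℝ} (hp : p ∈ Λ)
    (hx : p.1 = 0) : ∀ᶠ q in 𝓝 p, q ∈ Λ → q.1 < 0 → ∀ u, ν (spinPt u q) = μ p := by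
  obtain ⟨N, hN, hinj⟩ := h.axis_injOn hp hx
  have h1 := eventually_nhdsWithin_iff.1 (hμ.1 p hp (h.axis_notMem_fold hx))
  filter_upwards [h1, eventually_mem_nhds_iff.2 hN] with q hq hqN hqΛ hqx u
  have hqf : q ∉ foldLocus Λ := (not_mem_foldLocus hqΛ).2 ⟨N, hqN, hinj⟩
  rw [h.maslov_spinPt hν hμν hqΛ hqx hqf, hq hqΛ]

theorem axis_exists_near (h : TameFront Λ T) {p : J1 ℝ} (hp : p ∈ Λ) (hx : p.1 = 0)
    {N : Set (J1 ℝ)} (hN : N ∈ 𝓝 p) : ∀ᶠ x in 𝓝 (0 : ℝ), x < 0 → ∃ q ∈ Λ ∩ N, q.1 = x := by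
  obtain ⟨F, hF, h1, h2, hev⟩ := h.glue_left hp hx
  have hg : Continuous fun x : ℝ => ((x, deriv F x, F x) : J1 ℝ) := by
    have := hF.continuous_deriv (by simp)
    have := hF.continuous
    fun_prop
  have hgt := hg.tendsto 0
  have hgp : ((0, deriv F 0, F 0) : J1 ℝ) = p := Prod.ext hx.symm (Prod.ext h1.symm h2.symm)
  rw [hgp] at hgt
  filter_upwards [hgt.eventually hev, hgt hN] with x hx1 hx2 hx0
  exact ⟨_, ⟨hx1.2 ⟨hx0.le, rfl, rfl⟩, hx2⟩, rfl⟩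

theorem exists_neg_of_eventually {P : ℝ → Prop} (hP : ∀ᶠ x in 𝓝 (0 : ℝ), P x) :
    ∃ x < 0, P x := by
  obtain ⟨ε, hε, h⟩ := Metric.eventually_nhds_iff.1 hP
  exact ⟨-(ε / 2), by linarith, h (by simp [abs_of_pos hε]; linarith)⟩

/-- Near two matching endpoints, the strand at the endpoint with the smaller slope is above the
other one. -/
theorem axis_eventually_lt (h : TameFront Λ T) {p q : J1 ℝ} (hp : p ∈ Λ) (hq : q ∈ Λ)
    (hpx : p.1 = 0) (hqx : q.1 = 0) (hz : p.2.2 = q.2.2) (hy : p.2.1 < q.2.1) :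
    ∃ A ∈ 𝓝 p, ∃ B ∈ 𝓝 q, ∀ r ∈ Λ ∩ A, ∀ s ∈ Λ ∩ B, r.1 = s.1 → r.1 < 0 → s.2.2 < r.2.2 := by
  obtain ⟨F, hF, h1, h2, hev⟩ := h.glue_left hp hpx
  obtain ⟨G, hG, h1', h2', hev'⟩ := h.glue_left hq hqx
  have hlt := eventually_lt_of_deriv (hF.differentiable (by simp)).differentiableAt
    (hG.differentiable (by simp)).differentiableAt (by rw [← h2, ← h2', hz])
    (by rw [← h1, ← h1']; exact hy)
  have hfst : Filter.Tendsto (fun r : J1 ℝ => r.1) (𝓝 p) (𝓝 0) := hpx ▸ continuous_fst.tendsto p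
  refine ⟨_, Filter.inter_mem hev (hfst.eventually hlt), _, hev', ?_⟩
  rintro r ⟨hr, hr1, hr2⟩ s ⟨hs, hs1⟩ hrs hr0
  rw [(hr1.1 hr).2.2, (hs1.1 hs).2.2, ← hrs]
  exact hr2 hr0

/-- Above points near a cone point, the values of the potential are those at the matching
endpoints. -/
theorem maslov_cone (h : TameFront Λ T) (hμ : IsMaslov Λ μ)
    (hν : IsMaslov (frontSpin Λ) ν)
    (hμν : ∀ p ∈ Λ, p.1 < 0 → p ∉ foldLocus Λ → ν (spinPt 1 p) = μ p) {p q : J1 ℝ} (hp : p ∈ Λ)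
    (hq : q ∈ Λ) (hpx : p.1 = 0) (hqp : q = (0, -p.2.1, p.2.2)) (hy : p.2.1 < 0) :
    ∃ N : Set (J1 ℂ), IsOpen N ∧ spin univ {p} ⊆ N ∧ ∀ a ∈ frontSpin Λ ∩ N,
      ∀ b ∈ frontSpin Λ ∩ N, a.1 = b.1 → b.2.2 < a.2.2 → ν a = μ p ∧ ν b = μ q := by
  have hqx : q.1 = 0 := by rw [hqp]
  have hqz : q.2.2 = p.2.2 := by rw [hqp]
  have hqy : q.2.1 = -p.2.1 := by rw [hqp]
  obtain ⟨A, hA, B, hB, hAB⟩ := h.axis_eventually_lt hp hq hpx hqx hqz.symm (by linarith)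
  obtain ⟨A', hA', hAi⟩ := h.axis_injOn hp hpx
  obtain ⟨B', hB', hBi⟩ := h.axis_injOn hq hqx
  obtain ⟨ε₁, hε₁, hb₁⟩ := Metric.mem_nhds_iff.1 (Filter.inter_mem (Filter.inter_mem hA hA')
    (h.eventually_maslov_axis hμ hν hμν hp hpx))
  obtain ⟨ε₂, hε₂, hb₂⟩ := Metric.mem_nhds_iff.1 (Filter.inter_mem (Filter.inter_mem hB hB')
    (h.eventually_maslov_axis hμ hν hμν hq hqx))
  -- A rotation invariant neighbourhood of the cone circle; note that `-p.2.1` is the radius of the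
  -- circle. Its points come from points near `p` or near `q`, according to the sign of `y`.
  refine ⟨{w : J1 ℂ | ‖w.1‖ < min ε₁ ε₂ ∧ |‖w.2.1‖ + p.2.1| < min ε₁ ε₂ ∧
    |w.2.2 - p.2.2| < min ε₁ ε₂}, ?_, ?_, ?_⟩
  · have h1 : Continuous fun w : J1 ℂ => ‖w.1‖ := by fun_prop
    have h2 : Continuous fun w : J1 ℂ => |‖w.2.1‖ + p.2.1| := by fun_prop
    have h3 : Continuous fun w : J1 ℂ => |w.2.2 - p.2.2| := by fun_prop
    exact (isOpen_lt h1 continuous_const).inter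
      ((isOpen_lt h2 continuous_const).inter (isOpen_lt h3 continuous_const))
  · rintro _ ⟨u, -, _, rfl, rfl⟩
    simp [spinPt, hpx, Circle.norm_coe, abs_of_neg hy, hε₁, hε₂]
  · have hbox : ∀ r u, ‖(spinPt u r).1‖ < min ε₁ ε₂ → |‖(spinPt u r).2.1‖ + p.2.1| < min ε₁ ε₂ →
        |(spinPt u r).2.2 - p.2.2| < min ε₁ ε₂ → r ∈ Metric.ball p ε₁ ∨ r ∈ Metric.ball q ε₂ := by
      intro r u h1 h2 h3
      simp only [spinPt, norm_mul, Complex.norm_real, Circle.norm_coe, mul_one, Real.norm_eq_abs,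
        lt_min_iff] at h1 h2 h3
      simp only [Metric.mem_ball, Prod.dist_eq, max_lt_iff, Real.dist_eq, hpx, hqx, hqy, hqz,
        sub_zero, sub_neg_eq_add]
      rcases le_total 0 r.2.1 with hr | hr
      · rw [abs_of_nonneg hr] at h2
        exact Or.inr ⟨h1.2, h2.2, h3.2⟩
      · rw [abs_of_nonpos hr, ← abs_neg, neg_add, neg_neg, ← sub_eq_add_neg] at h2
        exact Or.inl ⟨h1.1, h2.1, h3.1⟩
    rintro _ ⟨⟨u, r, hr, rfl⟩, hr1, hr2, hr3⟩ _ ⟨⟨v, s, hs, rfl⟩, hs1, hs2, hs3⟩ hab hz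
    have hrbox := hbox r u hr1 hr2 hr3
    have hsbox := hbox s v hs1 hs2 hs3
    have hz' : s.2.2 < r.2.2 := hz
    -- Above the origin only one height occurs in this neighbourhood, so `a` and `b` cannot lie
    -- there.
    have hlevel : ∀ r' ∈ Λ, r'.1 = 0 → (r' ∈ Metric.ball p ε₁ ∨ r' ∈ Metric.ball q ε₂) →
        r'.2.2 = p.2.2 := by
      rintro r' hr' hr'x (hr'b | hr'b)
      · rw [hAi ⟨hr', (hb₁ hr'b).1.2⟩ ⟨hp, mem_of_mem_nhds hA'⟩ (hr'x.trans hpx.symm)]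
      · rw [hBi ⟨hr', (hb₂ hr'b).1.2⟩ ⟨hq, mem_of_mem_nhds hB'⟩ (hr'x.trans hqx.symm), hqz]
    have hab' : (r.1 : ℂ) * u = s.1 * v := hab
    rcases (h.nonpos r hr).lt_or_eq with hr0 | hr0
    · obtain ⟨hrs, rfl⟩ := spinPt_fst_eq hr0 (h.nonpos s hs) hab'
      -- Two points near the same endpoint coincide by injectivity; of two points near different
      -- endpoints, the upper one is near `p`.
      rcases hrbox with hrb | hrb <;> rcases hsbox with hsb | hsb
      · rw [hAi ⟨hr, (hb₁ hrb).1.2⟩ ⟨hs, (hb₁ hsb).1.2⟩ hrs] at hz'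
        exact absurd hz' (lt_irrefl _)
      · exact ⟨(hb₁ hrb).2 hr hr0 u, (hb₂ hsb).2 hs (hrs ▸ hr0) u⟩
      · have := hAB s ⟨hs, (hb₁ hsb).1.1⟩ r ⟨hr, (hb₂ hrb).1.1⟩ hrs.symm (hrs ▸ hr0)
        exact absurd this hz'.not_gt
      · rw [hBi ⟨hr, (hb₂ hrb).1.2⟩ ⟨hs, (hb₂ hsb).1.2⟩ hrs] at hz'
        exact absurd hz' (lt_irrefl _)
    · have hs0 : s.1 = 0 := by
        rw [hr0] at hab'
        simpa using hab'.symm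
      rw [hlevel r hr hr0 hrbox, hlevel s hs hs0 hsbox] at hz'
      exact absurd hz' (lt_irrefl _)

/-- Together with `maslov_cone` this pins down the value chosen in `sheetVal`: every neighbourhood
of the cone circle contains a pair of points to which that lemma applies. -/
theorem exists_near_cone (h : TameFront Λ T) {p q : J1 ℝ} (hp : p ∈ Λ)
    (hq : q ∈ Λ) (hpx : p.1 = 0) (hqp : q = (0, -p.2.1, p.2.2)) (hy : p.2.1 < 0)
    {N : Set (J1 ℂ)} (hN : IsOpen N) (hpN : spin univ {p} ⊆ N) :
    ∃ a ∈ frontSpin Λ ∩ N, ∃ b ∈ frontSpin Λ ∩ N, a.1 = b.1 ∧ b.2.2 < a.2.2 := by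
  have hqx : q.1 = 0 := by rw [hqp]
  have hqz : q.2.2 = p.2.2 := by rw [hqp]
  have hqy : q.2.1 = -p.2.1 := by rw [hqp]
  obtain ⟨A, hA, B, hB, hAB⟩ := h.axis_eventually_lt hp hq hpx hqx hqz.symm (by linarith)
  have hc : Continuous (spinPt 1) := continuous_spinPt.comp (by fun_prop : Continuous fun p => ((1 : Circle), p))
  have hNp : spinPt 1 ⁻¹' N ∈ 𝓝 p :=
    (hN.preimage hc).mem_nhds (hpN (spinPt_mem_spin (mem_univ 1) rfl))
  have hNq : spinPt 1 ⁻¹' N ∈ 𝓝 q := by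
    refine (hN.preimage hc).mem_nhds (hpN ?_)
    rw [← spin_univ_partner p hpx, ← hqp]
    exact spinPt_mem_spin (mem_univ 1) rfl
  obtain ⟨x, hx, hx1, hx2⟩ := exists_neg_of_eventually
    ((h.axis_exists_near hp hpx (Filter.inter_mem hA hNp)).and
      (h.axis_exists_near hq hqx (Filter.inter_mem hB hNq)))
  obtain ⟨r, ⟨hr, hrA, hrN⟩, hrx⟩ := hx1 hx
  obtain ⟨s, ⟨hs, hsB, hsN⟩, hsx⟩ := hx2 hx
  exact ⟨_, ⟨spinPt_mem_frontSpin 1 hr, hrN⟩, _, ⟨spinPt_mem_frontSpin 1 hs, hsN⟩,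
    by simp [spinPt, hrx, hsx],
    hAB r ⟨hr, hrA⟩ s ⟨hs, hsB⟩ (hrx.trans hsx.symm) (by rw [hrx]; exact hx)⟩

/-- At a cone circle the values come from nearby upper and lower points, which lie on the strands of
negative and of positive slope. At an endpoint of slope `0` the potentials are compared at a nearby
point off the axis. -/
theorem VertCorr.sheetVal_eq (h : TameFront Λ T) (hμ : IsMaslov Λ μ)
    (hν : IsMaslov (frontSpin Λ) ν)
    (hμν : ∀ p ∈ Λ, p.1 < 0 → p ∉ foldLocus Λ → ν (spinPt 1 p) = μ p) {t : ℝ}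
    {σ : Sheet Λ {t} ≃ Sheet (frontSpin Λ) {(t : ℂ)}} (hσ : VertCorr σ) (S : Sheet Λ {t}) :
    sheetVal ν (σ S) = sheetVal μ S := by
  obtain ⟨p, hp, hpx, hpf, hS⟩ := h.vert_sheet S
  have hSf : ∀ q ∈ S.pts, q ∉ foldLocus Λ := by
    rw [hS]
    rintro _ rfl
    exact hpf
  rcases hσ.nonpos.lt_or_eq with hlt | heq
  · exact h.sheetVal_spin hμ hν hμν (singleton_nonempty 1) (by simpa using hlt) (hσ.off hlt S) hSf
  rw [heq] at hpx
  have hSp : sheetVal μ S = μ p := h.sheetVal_of_mem hμ hSf (by rw [hS]; rfl)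
  obtain ⟨hpts, hlow⟩ := hσ.axis heq S p hS
  have hcone : IsConeCircle (σ S).pts ↔ p.2.1 ≠ 0 := hpts ▸ isConeCircle_axis hpx
  rw [hSp]
  by_cases hy : p.2.1 = 0
  · refine CellularDGA.sheetVal_eq (by rw [hcone]; simpa using hy) ?_
    rw [hpts]
    rintro _ ⟨u, -, _, rfl, rfl⟩
    have h1 := eventually_nhdsWithin_iff.1 (hν.1 _ (spinPt_mem_frontSpin u hp)
      (h.spinPt_axis_notMem_fold hp hpx hy u))
    have hc : Continuous (spinPt u) :=
      continuous_spinPt.comp (by fun_prop : Continuous fun p => (u, p))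
    obtain ⟨x, hx, hx1⟩ := exists_neg_of_eventually (h.axis_exists_near hp hpx (Filter.inter_mem
      ((hc.tendsto _).eventually h1) (h.eventually_maslov_axis hμ hν hμν hp hpx)))
    obtain ⟨r, ⟨hr, hr1, hr2⟩, hrx⟩ := hx1 hx
    rw [← hr1 (spinPt_mem_frontSpin u hr), hr2 hr (by rw [hrx]; exact hx)]
  · have hq := h.axis_partner hp hpx
    rw [sheetVal, if_pos (hcone.2 hy), hpts, hlow]
    rcases lt_or_gt_of_ne hy with hneg | hpos
    · simp only [hneg.le.not_gt, decide_false, Bool.false_eq_true, if_false]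
      obtain ⟨N, hN, hpN, hNm⟩ := h.maslov_cone hμ hν hμν hp hq hpx rfl hneg
      have hspec := Classical.epsilon_spec (p := fun k => ∀ N : Set (J1 ℂ), IsOpen N →
        spin univ {p} ⊆ N → ∃ a ∈ frontSpin Λ ∩ N, ∃ b ∈ frontSpin Λ ∩ N,
          a.1 = b.1 ∧ b.2.2 < a.2.2 ∧ ν a = k) ⟨μ p, fun N' hN' hpN' => by
        obtain ⟨a, ha, b, hb, hab, hz⟩ := h.exists_near_cone hp hq hpx rfl hneg (hN.inter hN')
          (subset_inter hpN hpN')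
        exact ⟨a, ⟨ha.1, ha.2.2⟩, b, ⟨hb.1, hb.2.2⟩, hab, hz,
          (hNm a ⟨ha.1, ha.2.1⟩ b ⟨hb.1, hb.2.1⟩ hab hz).1⟩⟩
      obtain ⟨a, ha, b, hb, hab, hz, hk⟩ := hspec N hN hpN
      rw [← hk, (hNm a ha b hb hab hz).1]
    -- Now `p` is the lower endpoint, so the lemmas are applied to its reflection, whose own
    -- reflection is `p`.
    · simp only [hpos, decide_true, if_true]
      have hpq : p = (0, - -p.2.1, p.2.2) := Prod.ext hpx (Prod.ext (neg_neg _).symm rfl)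
      have hneg : -p.2.1 < 0 := by linarith
      obtain ⟨N, hN, hpN, hNm⟩ := h.maslov_cone hμ hν hμν hq hp rfl hpq hneg
      have hC := spin_univ_partner p hpx
      rw [hC] at hpN
      have hspec := Classical.epsilon_spec (p := fun k => ∀ N : Set (J1 ℂ), IsOpen N →
        spin univ {p} ⊆ N → ∃ a ∈ frontSpin Λ ∩ N, ∃ b ∈ frontSpin Λ ∩ N,
          a.1 = b.1 ∧ b.2.2 < a.2.2 ∧ ν b = k) ⟨μ p, fun N' hN' hpN' => by
        obtain ⟨a, ha, b, hb, hab, hz⟩ := h.exists_near_cone hq hp rfl hpq hneg (hN.inter hN')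
          (hC ▸ subset_inter hpN hpN')
        exact ⟨a, ⟨ha.1, ha.2.2⟩, b, ⟨hb.1, hb.2.2⟩, hab, hz,
          (hNm a ⟨ha.1, ha.2.1⟩ b ⟨hb.1, hb.2.1⟩ hab hz).2⟩⟩
      obtain ⟨a, ha, b, hb, hab, hz, hk⟩ := hspec N hN hpN
      rw [← hk, (hNm a ha b hb hab hz).2]

end TameFront

/-! ## Derivations and matrices -/

theorem derivAlong_algebraMap {X B : Type} [Ring B] [Algebra (ZMod 2) B] (f g : X → B) (r : ZMod 2) :
    derivAlong f g (algebraMap (ZMod 2) (FreeAlgebra (ZMod 2) X) r) = 0 := by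
  simp [derivAlong, Algebra.algebraMap_eq_smul_one]

theorem derivAlong_zero {X B : Type} [Ring B] [Algebra (ZMod 2) B] (f g : X → B) :
    derivAlong f g 0 = 0 := by
  simp [derivAlong]

theorem map_derivAlong {X B C : Type} [Ring B] [Algebra (ZMod 2) B] [Ring C] [Algebra (ZMod 2) C]
    (ψ : B →ₐ[ZMod 2] C) (f g : X → B) (a : FreeAlgebra (ZMod 2) X) :
    ψ (derivAlong f g a) = derivAlong (fun x => ψ (f x)) (fun x => ψ (g x)) a := by
  have hψ : ∀ b, ψ (FreeAlgebra.lift (ZMod 2) f b) = FreeAlgebra.lift (ZMod 2) (fun x => ψ (f x)) b := by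
    intro b
    have : ψ.comp (FreeAlgebra.lift (ZMod 2) f) = FreeAlgebra.lift (ZMod 2) (fun x => ψ (f x)) := by
      ext x
      simp
    exact DFunLike.congr_fun this b
  induction a using FreeAlgebra.induction with
  | grade0 r => simp [derivAlong_algebraMap]
  | grade1 x => simp [derivAlong_ι]
  | mul a b ha hb => simp [derivAlong_mul, ha, hb, hψ]
  | add a b ha hb => simp [derivAlong_add, ha, hb]

/-- Both composites are derivations along the same homomorphism, so they are determined by their
values on generators. -/
theorem isBasedIso_of_gens {m : ℕ} {A B : Based m} (φ : A.Gen ≃ B.Gen)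
    (hdeg : ∀ x, B.deg (φ x) = A.deg x) (hd : ∀ x, mapGen φ (A.d x) = B.d (φ x)) :
    IsBasedIso φ := by
  refine ⟨hdeg, fun a => ?_⟩
  have hid : ∀ (C : Based m) (b : C.Alg),
      FreeAlgebra.lift (ZMod 2) (FreeAlgebra.ι (ZMod 2) : C.Gen → C.Alg) b = b := by
    intro C b
    have : FreeAlgebra.lift (ZMod 2) (FreeAlgebra.ι (ZMod 2) : C.Gen → C.Alg) = AlgHom.id _ _ := by
      ext x
      simp
    exact DFunLike.congr_fun this b
  induction a using FreeAlgebra.induction with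
  | grade0 r => simp [Based.diff, derivAlong_algebraMap]
  | grade1 x =>
    simp only [Based.diff, derivAlong_ι, hd]
    rw [mapGen, FreeAlgebra.lift_ι_apply, derivAlong_ι]
  | mul a b ha hb =>
    simp only [Based.diff] at ha hb ⊢
    simp only [derivAlong_mul, map_add, map_mul, ha, hb, hid]
  | add a b ha hb =>
    simp only [Based.diff] at ha hb ⊢
    simp only [derivAlong_add, map_add, ha, hb]

theorem add_self_eq_zero_of_algebra {A : Type} [Ring A] [Algebra (ZMod 2) A] (a : A) :
    a + a = 0 := by
  have : (2 : ZMod 2) • a = 0 := by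
    rw [show (2 : ZMod 2) = 0 from rfl, zero_smul]
  rwa [two_smul] at this

theorem mmul_eq {I A : Type} [Ring A] [Fintype I] (M N : Matrix I I A) : mmul M N = M * N := by
  ext i j
  rw [mmul, finsum_eq_sum_of_fintype, Matrix.mul_apply]

theorem mmul_equiv {I J A : Type} [Ring A] [Fintype I] (b : I ≃ J) (M N : Matrix J J A) :
    (mmul M N).submatrix b b = M.submatrix b b * N.submatrix b b := by
  ext i j
  rw [Matrix.submatrix_apply, mmul, ← finsum_comp_equiv b, finsum_eq_sum_of_fintype,
    Matrix.mul_apply]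
  rfl

open scoped Classical in
theorem mone_eq (I A : Type) [Ring A] : mone I A = 1 := rfl

open scoped Classical in
theorem mone_equiv {I J A : Type} [Ring A] (b : I ≃ J) :
    (mone J A).submatrix b b = 1 := Matrix.submatrix_one_equiv b

theorem submatrix_add_apply {I J A : Type} [Ring A] (b : I → J) (M N : Matrix J J A) :
    (M + N).submatrix b b = M.submatrix b b + N.submatrix b b := rfl

/-! ### Transporting the formulas for the differential along bijections of indices -/

section Transfer

variable {I J A B : Type} [Ring A] [Ring B] (b : I ≃ J)

theorem mmul_transfer [Finite I] (f : A →+* B) {M N : Matrix I I A} {M' N' : Matrix J J B}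
    (hM : M'.submatrix b b = M.map f) (hN : N'.submatrix b b = N.map f) :
    (mmul M' N').submatrix b b = (mmul M N).map f := by
  have := Fintype.ofFinite I
  rw [mmul_equiv, mmul_eq, hM, hN, Matrix.map_mul]

theorem mone_transfer (f : A →+* B) : (mone J B).submatrix b b = (mone I A).map f := by
  classical
  rw [mone_equiv, mone_eq, Matrix.map_one f (map_zero f) (map_one f)]

/-- The differential of the generators of a 1-cell is natural. -/
theorem edge_transfer [Finite I] (f : A →+* B) {V₁ X V₀ : Matrix I I A} {V₁' X' V₀' : Matrix J J B}
    (h₁ : V₁'.submatrix b b = V₁.map f) (hX : X'.submatrix b b = X.map f)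
    (h₀ : V₀'.submatrix b b = V₀.map f) :
    (mmul V₁' (mone _ _ + X') + mmul (mone _ _ + X') V₀').submatrix b b =
      (mmul V₁ (mone _ _ + X) + mmul (mone _ _ + X) V₀).map f := by
  have h : (mone J B + X').submatrix b b = (mone I A + X).map f := by
    rw [submatrix_add_apply, Matrix.map_add f (map_add f)]
    exact congrArg₂ _ (mone_transfer b f) hX
  rw [submatrix_add_apply, Matrix.map_add f (map_add f)]
  exact congrArg₂ _ (mmul_transfer b f h₁ h) (mmul_transfer b f h h₀)

/-- The product rule holds in every summand `M i k * N k j`, with the order of the factors kept. -/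
theorem mmul_deriv [Fintype I] {f : A →+* B} {D : A → B} (hadd : ∀ x y, D (x + y) = D x + D y)
    (hmul : ∀ x y, D (x * y) = D x * f y + f x * D y) (M N : Matrix I I A) :
    (M * N).map D = M.map D * N.map f + M.map f * N.map D := by
  ext i j
  let D' : A →+ B := AddMonoidHom.mk' D hadd
  have : ∀ x, D x = D' x := fun _ => rfl
  simp only [Matrix.map_apply, Matrix.mul_apply, Matrix.add_apply, this, map_sum]
  simp only [← this, hmul, Finset.sum_add_distrib]

/-- The differential of the generators of the circle spanned by a 0-cell. -/
theorem circle_transfer [Finite I] [Algebra (ZMod 2) B] {f : A →+* B} {D : A → B} (hadd : ∀ x y, D (x + y) = D x + D y)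
    (hmul : ∀ x y, D (x * y) = D x * f y + f x * D y) {X : Matrix I I A}
    {V₁ Y V₀ : Matrix J J B} (h₁ : V₁.submatrix b b = X.map f) (hY : Y.submatrix b b = X.map D)
    (h₀ : V₀.submatrix b b = X.map f) :
    (mmul V₁ (mone _ _ + Y) + mmul (mone _ _ + Y) V₀).submatrix b b = (mmul X X).map D := by
  classical
  have := Fintype.ofFinite I
  have h : (mone J B + Y).submatrix b b = 1 + X.map D := by
    rw [submatrix_add_apply, ← hY, ← mone_equiv b]
  have h2 : ∀ M : Matrix I I B, M + M = 0 := fun M => by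
    ext i j
    exact add_self_eq_zero_of_algebra _
  rw [mmul_eq X, mmul_deriv hadd hmul, submatrix_add_apply, mmul_equiv, mmul_equiv, h, h₁, h₀, mul_add, add_mul, mul_one, one_mul]
  -- The two copies of `A` that stem from the `I` in `I + Â` cancel in characteristic 2.
  calc X.map f + X.map f * X.map D + (X.map f + X.map D * X.map f)
      = (X.map f + X.map f) + (X.map D * X.map f + X.map f * X.map D) := by abel
    _ = _ := by rw [h2, zero_add]

/-- The differential of the generators of the 2-cell swept out by a 1-cell. -/
theorem face_transfer [Finite I] [Algebra (ZMod 2) B] {f : A →+* B} {D : A → B} (hadd : ∀ x y, D (x + y) = D x + D y)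
    (hmul : ∀ x y, D (x * y) = D x * f y + f x * D y) (hone : D 1 = 0)
    {V₁ X V₀ : Matrix I I A} {V₁' Y V₀' S₁ S₂ S₃ S₄ : Matrix J J B}
    (h₁ : V₁'.submatrix b b = V₁.map f) (hY : Y.submatrix b b = X.map D)
    (h₀ : V₀'.submatrix b b = V₀.map f) (hS₁ : S₁.submatrix b b = X.map f)
    (hS₂ : S₂.submatrix b b = V₁.map D) (hS₃ : S₃.submatrix b b = V₀.map D)
    (hS₄ : S₄.submatrix b b = X.map f) :
    (mmul V₁' Y + mmul Y V₀' + mmul (mone _ _ + S₂) (mmul (mone _ _ + S₁) (mone _ _)) +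
      mmul (mone _ _ + S₄) (mmul (mone _ _ + S₃) (mone _ _))).submatrix b b =
      (mmul V₁ (mone _ _ + X) + mmul (mone _ _ + X) V₀).map D := by
  classical
  have := Fintype.ofFinite I
  have hs : ∀ S : Matrix J J B, (mone J B + S).submatrix b b = 1 + S.submatrix b b := by
    intro S
    rw [submatrix_add_apply, ← mone_equiv b]
  have h2 : ∀ M : Matrix I I B, M + M = 0 := fun M => by
    ext i j
    exact add_self_eq_zero_of_algebra _
  have hzero : D 0 = 0 := by
    have := hadd 0 0
    simpa using this
  have hD1 : (1 + X).map D = X.map D := by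
    ext i j
    simp only [Matrix.map_apply, Matrix.add_apply, hadd, Matrix.one_apply]
    split_ifs
    · rw [hone, zero_add]
    · rw [hzero, zero_add]
  have hf1 : (1 + X).map f = 1 + X.map f := by
    rw [Matrix.map_add f (map_add f), Matrix.map_one f (map_zero f) (map_one f)]
  rw [submatrix_add_apply, submatrix_add_apply, submatrix_add_apply]
  rw [Matrix.map_add D hadd, mmul_eq V₁, mmul_eq _ V₀, mmul_deriv hadd hmul, mmul_deriv hadd hmul,
    mone_eq I A, hD1, hf1]
  simp only [mmul_equiv, hs, mone_equiv, h₁, hY, h₀, hS₁, hS₂, hS₃, hS₄, mul_one]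
  -- `S` and `W` stand for the circular sides, `U` for both radial ones. Each boundary path
  -- contributes one summand `1 + U`, and the two cancel in characteristic 2.
  have key : ∀ P Q R S U W : Matrix I I B,
      P * Q + Q * R + (1 + S) * (1 + U) + (1 + U) * (1 + W) =
      S * (1 + U) + P * Q + (Q * R + (1 + U) * W) + ((1 + U) + (1 + U)) := by
    intro P Q R S U W
    noncomm_ring
  rw [key, h2, add_zero]

end Transfer

/-- `place` depends on chosen indices; uniqueness of the position makes the choice harmless. Of `F`
only `F 0 = 0` is needed, so it may be a derivation. -/
theorem place_transfer {I J I' J' A B : Type} [Ring A] [Ring B] (a : I ≃ I') (b : J ≃ J')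
    {r : I → J → Prop} {r' : I' → J' → Prop} (hr : ∀ i j, r' (a i) (b j) ↔ r i j)
    (huniq : ∀ i j j', r i j → r i j' → j = j') {M : Matrix J J A} {M' : Matrix J' J' B}
    {F : A → B} (hF : F 0 = 0) (hM : M'.submatrix b b = M.map F) :
    (place r' M').submatrix a a = (place r M).map F := by
  ext i i'
  rw [Matrix.submatrix_apply, Matrix.map_apply, place, place]
  by_cases h : ∃ j : J × J, r i j.1 ∧ r i' j.2
  · have h' : ∃ j : J' × J', r' (a i) j.1 ∧ r' (a i') j.2 := by
      obtain ⟨j, hj⟩ := h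
      exact ⟨(b j.1, b j.2), (hr _ _).2 hj.1, (hr _ _).2 hj.2⟩
    rw [dif_pos h, dif_pos h']
    have h1 := h.choose_spec
    have h2 := h'.choose_spec
    have e1 : h'.choose.1 = b h.choose.1 := by
      obtain ⟨k, hk⟩ := b.surjective h'.choose.1
      rw [← hk, hr] at h2
      rw [← hk, huniq _ _ _ h2.1 h1.1]
    have e2 : h'.choose.2 = b h.choose.2 := by
      obtain ⟨k, hk⟩ := b.surjective h'.choose.2
      rw [← hk, hr] at h2
      rw [← hk, huniq _ _ _ h2.2 h1.2]
    rw [e1, e2]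
    exact congrFun (congrFun hM _) _
  · have h' : ¬ ∃ j : J' × J', r' (a i) j.1 ∧ r' (a i') j.2 := by
      rintro ⟨⟨j, j'⟩, hj⟩
      obtain ⟨k, rfl⟩ := b.surjective j
      obtain ⟨k', rfl⟩ := b.surjective j'
      exact h ⟨(k, k'), (hr _ _).1 hj.1, (hr _ _).1 hj.2⟩
    rw [dif_neg h, dif_neg h', hF]

/-- A matrix placed along a bijection. -/
theorem place_equiv {I J' A : Type} {I' : Type} [Ring A] (a : I ≃ I') (b : I ≃ J')
    {r' : I' → J' → Prop} (hr : ∀ i j, r' (a i) (b j) ↔ i = j) (M' : Matrix J' J' A) :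
    (place r' M').submatrix a a = M'.submatrix b b := by
  have h := place_transfer a b (r := fun i j => i = j) hr (fun i j j' h h' => h.symm.trans h')
    (M := M'.submatrix b b) (F := id) (M' := M') rfl (by ext; rfl)
  rw [h]
  ext i i'
  have hex : ∃ j : I × I, i = j.1 ∧ i' = j.2 := ⟨(i, i'), rfl, rfl⟩
  rw [Matrix.map_apply, place, dif_pos hex, id, ← hex.choose_spec.1, ← hex.choose_spec.2]

/-! ### The matrix of the cone points -/

section Cone

variable {I J A B : Type} [Ring A] [Ring B] (b : I ≃ J)

/-- By uniqueness the pairs chosen on the two sides correspond, and the entries are moved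
accordingly. -/
theorem coneFactor_transfer (f : A →+* B) {a : Matrix I I A} {a' : Matrix J J B}
    (ha : a'.submatrix b b = a.map f) {P : I × I → Prop} {P' : J × J → Prop}
    (hP : ∀ i j, P' (b i, b j) ↔ P (i, j)) (huniq : ∀ r r', P r → P r' → r = r') :
    (coneFactor a' P').submatrix b b = (coneFactor a P).map f := by
  by_cases h : ∃ r, P r
  · have h' : ∃ r, P' r := by
      obtain ⟨r, hr⟩ := h
      exact ⟨(b r.1, b r.2), (hP _ _).2 hr⟩
    have hch : h'.choose = (b h.choose.1, b h.choose.2) := by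
      have h1 := h'.choose_spec
      have h2 := h.choose_spec
      obtain ⟨i, hi⟩ := b.surjective h'.choose.1
      obtain ⟨j, hj⟩ := b.surjective h'.choose.2
      have h3 : P (i, j) := (hP i j).1 (by rw [hi, hj]; exact h1)
      rw [huniq _ _ h2 h3, hi, hj]
    rw [coneFactor, coneFactor, dif_pos h, dif_pos h', hch]
    ext i j
    have hmone := congrFun (congrFun (mone_transfer (A := A) (B := B) b f) i) j
    have ha' : ∀ i j, a' (b i) (b j) = f (a i j) := fun i j => congrFun (congrFun ha i) j
    simp only [Matrix.submatrix_apply, Matrix.map_apply] at hmone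
    simp only [Matrix.submatrix_apply, Matrix.map_apply, Matrix.add_apply, coneMat, map_add, hmone]
    by_cases h1 : j = h.choose.1 <;> by_cases h2 : i = h.choose.2 <;> simp [h1, h2, ha']
  · have h' : ¬ ∃ r, P' r := by
      rintro ⟨⟨i, j⟩, hij⟩
      obtain ⟨i, rfl⟩ := b.surjective i
      obtain ⟨j, rfl⟩ := b.surjective j
      exact h ⟨_, (hP i j).1 hij⟩
    rw [coneFactor, coneFactor, dif_neg h, dif_neg h']
    exact mone_transfer b f

theorem coneU_transfer [Finite I] (f : A →+* B) {a : Matrix I I A} {a' : Matrix J J B}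
    (ha : a'.submatrix b b = a.map f) {P : ℝ → I × I → Prop} {P' : ℝ → J × J → Prop}
    (hP : ∀ z i j, P' z (b i, b j) ↔ P z (i, j)) (huniq : ∀ z r r', P z r → P z r' → r = r')
    (heights : List ℝ) : (coneU a' P' heights).submatrix b b = (coneU a P heights).map f := by
  unfold coneU
  have key : ∀ (M : Matrix I I A) (M' : Matrix J J B), M'.submatrix b b = M.map f →
      (heights.foldl (fun M z => mmul (coneFactor a' (P' z)) M) M').submatrix b b =
      (heights.foldl (fun M z => mmul (coneFactor a (P z)) M) M).map f := by
    induction heights with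
    | nil => exact fun M M' h => h
    | cons z l ih =>
      intro M M' h
      exact ih _ _ (mmul_transfer b f (coneFactor_transfer b f ha (hP z) (huniq z)) h)
  exact key _ _ (mone_transfer b f)

/-- The matrix of the cone points is unipotent with respect to the order of the sheets, and its
entries for pairs of sheets without generator vanish. -/
theorem coneU_sub_one_eq_zero {I A : Type} [Ring A] [Finite I] {a : Matrix I I A} {R : I → I → Prop}
    (htrans : ∀ i j k, R i j → R j k → R i k) (ha : ∀ i j, ¬ R i j → a i j = 0)
    {P : ℝ → I × I → Prop} (hleft : ∀ z i r, P z r → R i r.2 → R i r.1)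
    (hright : ∀ z j r, P z r → R r.1 j → R r.2 j) (heights : List ℝ) {i j : I} (hij : ¬ R i j) :
    (coneU a P heights - mone I A) i j = 0 := by
  classical
  have := Fintype.ofFinite I
  have hfac : ∀ z, ∃ N : Matrix I I A, coneFactor a (P z) = 1 + N ∧ ∀ i j, ¬ R i j → N i j = 0 := by
    intro z
    by_cases h : ∃ r, P z r
    · refine ⟨coneMat a h.choose.1 h.choose.2, by rw [coneFactor, dif_pos h, mone_eq], ?_⟩
      intro i j hij
      have hs := h.choose_spec
      rw [coneMat]
      -- The entry `a i low` is moved to the column of `up`. It vanishes unless `R i low`, which by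
      -- `hleft` implies `R i up`; `hright` serves the rows in the same way.
      split_ifs with h1 h2 h2
      · rw [ha i _ (fun hR => hij (h1 ▸ hleft z i _ hs hR)),
          ha _ j (fun hR => hij (h2 ▸ hright z j _ hs hR)), add_zero]
      · rw [ha i _ (fun hR => hij (h1 ▸ hleft z i _ hs hR)), add_zero]
      · rw [ha _ j (fun hR => hij (h2 ▸ hright z j _ hs hR)), add_zero]
      · rw [add_zero]
    · exact ⟨0, by rw [coneFactor, dif_neg h, mone_eq, add_zero], fun _ _ _ => rfl⟩
  have key : ∀ M : Matrix I I A, (∀ i j, ¬ R i j → (M - 1) i j = 0) → ∀ i j, ¬ R i j →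
      (heights.foldl (fun M z => mmul (coneFactor a (P z)) M) M - 1) i j = 0 := by
    induction heights with
    | nil => exact fun M h => h
    | cons z l ih =>
      intro M hM
      refine ih _ fun i j hij => ?_
      obtain ⟨N, hN, hN0⟩ := hfac z
      -- Each term has its entries supported on `R`, the middle one by transitivity.
      have hexp : mmul (coneFactor a (P z)) M - 1 = (M - 1) + N * (M - 1) + N := by
        rw [mmul_eq, hN]
        noncomm_ring
      rw [hexp, Matrix.add_apply, Matrix.add_apply, hM i j hij, hN0 i j hij, Matrix.mul_apply,
        Finset.sum_eq_zero, add_zero, add_zero]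
      intro k _
      by_cases hik : R i k
      · rw [hM k j (fun hkj => hij (htrans i k j hik hkj)), mul_zero]
      · rw [hN0 i k hik, zero_mul]
  rw [mone_eq]
  refine key _ (fun i j _ => ?_) i j hij
  rw [mone_eq, sub_self]
  rfl

end Cone

/-! ## The generators of the front spin -/

/-- Order preserving bijections between the sheets of `Λ` above its cells and the sheets of the front
spin above the cells in `x₂ = 0` (`vert` and `edge`) and above the spun cells (`spunVert` and
`spunEdge`). -/
structure SheetCorr (Λ : Set (J1 ℝ)) (T : Finset ℝ) (heights : List ℝ) where
  vert : ∀ t : T, Sheet Λ (Cell.vert (E := lineDecomp Λ T) t).carrier ≃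
    Sheet (frontSpin Λ) (Cell.vert (E := spunDecomp Λ T heights) t).carrier
  edge : ∀ e : LineEdge Λ T, Sheet Λ (Cell.edge (E := lineDecomp Λ T) e).carrier ≃
    Sheet (frontSpin Λ) (Cell.edge (E := spunDecomp Λ T heights) (Sum.inl e)).carrier
  spunVert : ∀ t : OffAxis T, Sheet Λ (Cell.vert (E := lineDecomp Λ T) t.1).carrier ≃
    Sheet (frontSpin Λ) (Cell.edge (E := spunDecomp Λ T heights) (Sum.inr t)).carrier
  spunEdge : ∀ e : LineEdge Λ T, Sheet Λ (Cell.edge (E := lineDecomp Λ T) e).carrier ≃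
    Sheet (frontSpin Λ) (Cell.face (E := spunDecomp Λ T heights) e).carrier
  vert_above : ∀ t S S', Above (vert t S) (vert t S') ↔ Above S S'
  edge_above : ∀ e S S', Above (edge e S) (edge e S') ↔ Above S S'
  spunVert_above : ∀ t S S', Above (spunVert t S) (spunVert t S') ↔ Above S S'
  spunEdge_above : ∀ e S S', Above (spunEdge e S) (spunEdge e S') ↔ Above S S'

namespace SheetCorr

variable {Λ : Set (J1 ℝ)} {T : Finset ℝ} {heights : List ℝ} (c : SheetCorr Λ T heights)

/-- The generator above the cell in `x₂ = 0`. -/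
def base : Gen Λ (lineDecomp Λ T) → Gen (frontSpin Λ) (spunDecomp Λ T heights)
  | ⟨.vert t, S⟩ => ⟨.vert t, ⟨(c.vert t S.1.1, c.vert t S.1.2), (c.vert_above t _ _).2 S.2⟩⟩
  | ⟨.edge e, S⟩ =>
    ⟨.edge (Sum.inl e), ⟨(c.edge e S.1.1, c.edge e S.1.2), (c.edge_above e _ _).2 S.2⟩⟩
  | ⟨.face f, _⟩ => Empty.elim f

/-- The generator above the spun cell. -/
def spun : (x : Gen Λ (lineDecomp Λ T)) → (∀ t : T, x.1 = Cell.vert t → t.1 ≠ 0) →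
    Gen (frontSpin Λ) (spunDecomp Λ T heights)
  | ⟨.vert t, S⟩, h => ⟨.edge (Sum.inr ⟨t, h t rfl⟩),
      ⟨(c.spunVert ⟨t, h t rfl⟩ S.1.1, c.spunVert ⟨t, h t rfl⟩ S.1.2),
        (c.spunVert_above _ _ _).2 S.2⟩⟩
  | ⟨.edge e, S⟩, _ =>
    ⟨.face e, ⟨(c.spunEdge e S.1.1, c.spunEdge e S.1.2), (c.spunEdge_above e _ _).2 S.2⟩⟩
  | ⟨.face f, _⟩, _ => Empty.elim f

theorem base_injective : Function.Injective c.base := by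
  rintro ⟨t | e | f, ⟨S₁, S₂⟩, hS⟩ ⟨t' | e' | f', ⟨S₁', S₂'⟩, hS'⟩ heq <;>
    first | exact Empty.elim f | exact Empty.elim f' | skip
  · obtain ⟨h1, h2⟩ := Sigma.mk.inj_iff.1 heq
    obtain rfl := Cell.vert.inj h1
    have h3 := Prod.mk.inj (congrArg Subtype.val (eq_of_heq h2))
    obtain rfl := (c.vert t).injective h3.1
    obtain rfl := (c.vert t).injective h3.2
    rfl
  · exact absurd (congrArg Sigma.fst heq) (by rintro ⟨⟩)
  · exact absurd (congrArg Sigma.fst heq) (by rintro ⟨⟩)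
  · obtain ⟨h1, h2⟩ := Sigma.mk.inj_iff.1 heq
    obtain rfl := Sum.inl.inj (Cell.edge.inj h1)
    have h3 := Prod.mk.inj (congrArg Subtype.val (eq_of_heq h2))
    obtain rfl := (c.edge e).injective h3.1
    obtain rfl := (c.edge e).injective h3.2
    rfl

theorem spun_injective {x x' : Gen Λ (lineDecomp Λ T)} {h : ∀ t : T, x.1 = Cell.vert t → t.1 ≠ 0}
    {h' : ∀ t : T, x'.1 = Cell.vert t → t.1 ≠ 0} (heq : c.spun x h = c.spun x' h') : x = x' := by
  obtain ⟨t | e | f, ⟨S₁, S₂⟩, hS⟩ := x <;> obtain ⟨t' | e' | f', ⟨S₁', S₂'⟩, hS'⟩ := x' <;>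
    first | exact Empty.elim f | exact Empty.elim f' | skip
  · obtain ⟨h1, h2⟩ := Sigma.mk.inj_iff.1 heq
    obtain rfl := Subtype.mk.inj (Sum.inr.inj (Cell.edge.inj h1))
    have h3 := Prod.mk.inj (congrArg Subtype.val (eq_of_heq h2))
    obtain rfl := (c.spunVert _).injective h3.1
    obtain rfl := (c.spunVert _).injective h3.2
    rfl
  · exact absurd (congrArg Sigma.fst heq) (by rintro ⟨⟩)
  · exact absurd (congrArg Sigma.fst heq) (by rintro ⟨⟩)
  · obtain ⟨h1, h2⟩ := Sigma.mk.inj_iff.1 heq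
    obtain rfl := Cell.face.inj h1
    have h3 := Prod.mk.inj (congrArg Subtype.val (eq_of_heq h2))
    obtain rfl := (c.spunEdge e).injective h3.1
    obtain rfl := (c.spunEdge e).injective h3.2
    rfl

theorem base_ne_spun {x x' : Gen Λ (lineDecomp Λ T)} {h : ∀ t : T, x'.1 = Cell.vert t → t.1 ≠ 0} :
    c.base x ≠ c.spun x' h := by
  intro heq
  obtain ⟨t | e | f, ⟨S₁, S₂⟩, hS⟩ := x <;> obtain ⟨t' | e' | f', ⟨S₁', S₂'⟩, hS'⟩ := x' <;>
    first
    | exact Empty.elim f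
    | exact Empty.elim f'
    | exact absurd (congrArg Sigma.fst heq) (by rintro ⟨⟩)

theorem exists_base_or_spun (y : Gen (frontSpin Λ) (spunDecomp Λ T heights)) :
    (∃ x, c.base x = y) ∨ ∃ x h, c.spun x h = y := by
  obtain ⟨t | (e | t) | e, ⟨S₁, S₂⟩, hS⟩ := y
  · obtain ⟨S₁, rfl⟩ := (c.vert t).surjective S₁
    obtain ⟨S₂, rfl⟩ := (c.vert t).surjective S₂
    exact Or.inl ⟨⟨.vert t, ⟨(S₁, S₂), (c.vert_above t _ _).1 hS⟩⟩, rfl⟩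
  · obtain ⟨S₁, rfl⟩ := (c.edge e).surjective S₁
    obtain ⟨S₂, rfl⟩ := (c.edge e).surjective S₂
    exact Or.inl ⟨⟨.edge e, ⟨(S₁, S₂), (c.edge_above e _ _).1 hS⟩⟩, rfl⟩
  · obtain ⟨S₁, rfl⟩ := (c.spunVert t).surjective S₁
    obtain ⟨S₂, rfl⟩ := (c.spunVert t).surjective S₂
    refine Or.inr ⟨⟨.vert t.1, ⟨(S₁, S₂), (c.spunVert_above t _ _).1 hS⟩⟩, ?_, rfl⟩
    intro t' ht'
    obtain rfl := Cell.vert.inj ht'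
    exact t.2
  · obtain ⟨S₁, rfl⟩ := (c.spunEdge e).surjective S₁
    obtain ⟨S₂, rfl⟩ := (c.spunEdge e).surjective S₂
    refine Or.inr ⟨⟨.edge e, ⟨(S₁, S₂), (c.spunEdge_above e _ _).1 hS⟩⟩, ?_, rfl⟩
    intro t ht
    exact absurd ht (by rintro ⟨⟩)

/-- The set of generators of `Λ` above the 0-cell on the axis. -/
def axisGens (Λ : Set (J1 ℝ)) (T : Finset ℝ) : Set (Gen Λ (lineDecomp Λ T)) :=
  {x | ∃ t : T, t.1 = 0 ∧ x.1 = Cell.vert t}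

theorem ne_zero_of_notMem {x : Gen Λ (lineDecomp Λ T)} (hx : x ∉ axisGens Λ T) (t : T)
    (ht : x.1 = Cell.vert t) : t.1 ≠ 0 := fun h0 => hx ⟨t, h0, ht⟩

/-- The bijection from the generators of the suspension to those of the front spin. -/
def genEquiv : Gen Λ (lineDecomp Λ T) ⊕ {x : Gen Λ (lineDecomp Λ T) // x ∉ axisGens Λ T} ≃
    Gen (frontSpin Λ) (spunDecomp Λ T heights) :=
  Equiv.ofBijective (Sum.elim c.base fun x => c.spun x.1 (ne_zero_of_notMem x.2)) (by
    constructor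
    · rintro (x | x) (x' | x') hxx
      · exact congrArg _ (c.base_injective hxx)
      · exact absurd hxx c.base_ne_spun
      · exact absurd hxx.symm c.base_ne_spun
      · exact congrArg _ (Subtype.ext (c.spun_injective hxx))
    · intro y
      rcases c.exists_base_or_spun y with ⟨x, hx⟩ | ⟨x, h, hx⟩
      · exact ⟨Sum.inl x, hx⟩
      · exact ⟨Sum.inr ⟨x, fun ⟨t, h0, ht⟩ => h t ht h0⟩, hx⟩)

/-- The bijections of sheets respect closures, cusps, matched pairs and cone points. -/
structure Compatible : Prop where
  finite_vert : ∀ t : T, Finite (Sheet Λ (Cell.vert (E := lineDecomp Λ T) t).carrier)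
  finite_edge : ∀ e, Finite (Sheet Λ (Cell.edge (E := lineDecomp Λ T) e).carrier)
  limits_unique : ∀ (e : LineEdge Λ T) (t : T) (u : ℝ), u = 0 ∨ u = 1 →
    ∀ (S : Sheet Λ (Cell.edge (E := lineDecomp Λ T) e).carrier)
      (P P' : Sheet Λ (Cell.vert (E := lineDecomp Λ T) t).carrier),
      Limits openI e.path u S P → Limits openI e.path u S P' → P = P'
  limits_edge : ∀ (e : LineEdge Λ T) (t : T) (u : ℝ), (u = 0 ∧ t = e.1.1) ∨ (u = 1 ∧ t = e.1.2) →
    ∀ S P, Limits openI (fun s => (e.path s : ℂ)) u (c.edge e S) (c.vert t P) ↔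
      Limits openI e.path u S P
  cusp_edge : ∀ (e : LineEdge Λ T) (u : ℝ), u = 0 ∨ u = 1 → ∀ S S',
    MeetInCusp openI (fun s => (e.path s : ℂ)) u (c.edge e S) (c.edge e S') ↔
      MeetInCusp openI e.path u S S'
  limits_circle : ∀ (t : OffAxis T) (u : ℝ), u = 0 ∨ u = 1 → ∀ S P,
    Limits openI (polar t.1.1) u (c.spunVert t S) (c.vert t.1 P) ↔ S = P
  cusp_circle : ∀ (t : OffAxis T) (u : ℝ), u = 0 ∨ u = 1 → ∀ S S',
    ¬ MeetInCusp openI (polar t.1.1) u (c.spunVert t S) (c.spunVert t S')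
  limits_face_vert : ∀ (e : LineEdge Λ T) (t : T) (u φ : ℝ),
    (u = 0 ∧ t = e.1.1) ∨ (u = 1 ∧ t = e.1.2) → φ ∈ Icc (0 : ℝ) 1 →
    (φ = 0 ∨ φ = 1 ∨ t.1 = 0) → ∀ S P,
      Limits openSq (fun w : ℝ × ℝ => polar (e.path w.1) w.2) (u, φ) (c.spunEdge e S) (c.vert t P) ↔
        Limits openI e.path u S P
  cusp_face : ∀ (e : LineEdge Λ T) (u φ : ℝ), u = 0 ∨ u = 1 → φ = 0 ∨ φ = 1 → ∀ S S',
    MeetInCusp openSq (fun w : ℝ × ℝ => polar (e.path w.1) w.2) (u, φ) (c.spunEdge e S)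
      (c.spunEdge e S') ↔ MeetInCusp openI e.path u S S'
  limits_face_edge : ∀ (e : LineEdge Λ T) (φ : ℝ), φ = 0 ∨ φ = 1 → ∀ S P,
    Limits openSq (fun w : ℝ × ℝ => polar (e.path w.1) w.2) (1 / 2, φ) (c.spunEdge e S)
      (c.edge e P) ↔ S = P
  limits_face_circle : ∀ (e : LineEdge Λ T) (t : OffAxis T) (u : ℝ),
    (u = 0 ∧ t.1 = e.1.1) ∨ (u = 1 ∧ t.1 = e.1.2) → ∀ S P,
      Limits openSq (fun w : ℝ × ℝ => polar (e.path w.1) w.2) (u, 1 / 2) (c.spunEdge e S)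
        (c.spunVert t P) ↔ Limits openI e.path u S P
  above_trans : ∀ (t : T) (S S' S'' : Sheet Λ (Cell.vert (E := lineDecomp Λ T) t).carrier),
    Above S S' → Above S' S'' → Above S S''
  conePair : ∀ t : T, t.1 = 0 → ∀ z S S',
    ConePair z (c.vert t S, c.vert t S') ↔ MatchedPair z (S, S')
  matched_unique : ∀ t : T, t.1 = 0 → ∀ z
    (r r' : Sheet Λ (Cell.vert (E := lineDecomp Λ T) t).carrier ×
      Sheet Λ (Cell.vert (E := lineDecomp Λ T) t).carrier),
    MatchedPair z r → MatchedPair z r' → r = r'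
  matched_left : ∀ (t : T) z (S : Sheet Λ (Cell.vert (E := lineDecomp Λ T) t).carrier) r,
    MatchedPair z r → Above S r.2 → Above S r.1
  matched_right : ∀ (t : T) z (S : Sheet Λ (Cell.vert (E := lineDecomp Λ T) t).carrier) r,
    MatchedPair z r → Above r.1 S → Above r.2 S

end SheetCorr

theorem mapGen_mapGen {X Y Z : Type} (φ : X → Y) (ψ : Y → Z) (a : FreeAlgebra (ZMod 2) X) :
    mapGen ψ (mapGen φ a) = mapGen (fun x => ψ (φ x)) a := by
  have : (mapGen ψ).comp (mapGen φ) = mapGen (fun x => ψ (φ x)) := by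
    ext x
    simp [mapGen]
  exact DFunLike.congr_fun this a

theorem mapGen_ι {X Y : Type} (φ : X → Y) (x : X) :
    mapGen φ (FreeAlgebra.ι (ZMod 2) x) = FreeAlgebra.ι (ZMod 2) (φ x) := by
  simp [mapGen]

/-! ### Comparing the matrices of cells -/

section Matrices

variable {V V' : Type} [TopologicalSpace V] [TopologicalSpace V'] {L : Set (J1 V)} {E : Decomp V}
  {L' : Set (J1 V')} {E' : Decomp V'}

theorem gmat_of_above {c : Cell E} {S S' : Sheet L c.carrier} (h : Above S S') :
    gmat L E c S S' = FreeAlgebra.ι (ZMod 2) (⟨c, ⟨(S, S'), h⟩⟩ : Gen L E) := dif_pos h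

theorem gmat_of_not_above {c : Cell E} {S S' : Sheet L c.carrier} (h : ¬ Above S S') :
    gmat L E c S S' = 0 := dif_neg h

theorem vertMat_transfer {K : Set V} {K' : Set V'} {W W' : Type} [TopologicalSpace W]
    [TopologicalSpace W'] {D : Set W} {D' : Set W'} {χ : W → V} {χ' : W' → V'} {u : W} {u' : W'}
    {v : E.Vert} {v' : E'.Vert} (a : Sheet L K ≃ Sheet L' K') (F : Alg L E →+* Alg L' E')
    (hp : (place (Limits D' χ' u') (gmat L' E' (.vert v'))).submatrix a a =
      (place (Limits D χ u) (gmat L E (.vert v))).map F)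
    (hm : ∀ S S', MeetInCusp D' χ' u' (a S) (a S') ↔ MeetInCusp D χ u S S') :
    (vertMat L' E' K' D' χ' u' v').submatrix a a = (vertMat L E K D χ u v).map F := by
  ext S S'
  have hp' := congrFun (congrFun hp S) S'
  rw [Matrix.submatrix_apply, Matrix.map_apply] at hp' ⊢
  rw [vertMat, vertMat, map_add, hp', hm]
  split_ifs <;> simp

theorem vertMat_eq_place {K : Set V} {W : Type} [TopologicalSpace W] {D : Set W} {χ : W → V} {u : W}
    {v : E.Vert} {I : Type} (a : I → Sheet L K) (hm : ∀ i j, ¬ MeetInCusp D χ u (a i) (a j)) :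
    (vertMat L E K D χ u v).submatrix a a =
      (place (Limits D χ u) (gmat L E (.vert v))).submatrix a a := by
  ext i j
  rw [Matrix.submatrix_apply, Matrix.submatrix_apply, vertMat, if_neg (hm i j), add_zero]

/-- The entries for cusps do not contribute to the derivative of the matrix of a vertex. -/
theorem map_vertMat {K : Set V} {W : Type} [TopologicalSpace W] {D : Set W} {χ : W → V} {u : W}
    {v : E.Vert} {B : Type} [Ring B] {F : Alg L E → B} (hadd : ∀ x y, F (x + y) = F x + F y)
    (hzero : F 0 = 0) (hone : F 1 = 0) : (vertMat L E K D χ u v).map F =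
      (place (Limits D χ u) (gmat L E (.vert v))).map F := by
  ext S S'
  rw [Matrix.map_apply, Matrix.map_apply, vertMat, hadd]
  split_ifs
  · rw [hone, add_zero]
  · rw [hzero, add_zero]

/-- The boundary paths of spun 2-cells are defined by case distinctions; this form lets them be
replaced by explicit lists. -/
theorem dmat_face {f : E.Face} {l l' : List (Step E.Vert E.Edge)} (hl : E.ccw f = l)
    (hl' : E.cw f = l') : dmat L E (.face f) =
      mmul (vertMat L E _ openSq (E.chart f) (E.p1 f) (E.v1 f)) (gmat L E (.face f)) +
      mmul (gmat L E (.face f)) (vertMat L E _ openSq (E.chart f) (E.p0 f) (E.v0 f)) +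
      pathMat L E f l + pathMat L E f l' := by
  subst hl hl'
  rfl

end Matrices

/-! ### Comparing the differentials -/

namespace SheetCorr

variable {Λ : Set (J1 ℝ)} {T : Finset ℝ} {heights : List ℝ} (c : SheetCorr Λ T heights)

/-- The algebra map that sends the generators of `Λ` to the generators above `x₂ = 0`. -/
def baseHom : Alg Λ (lineDecomp Λ T) →+* Alg (frontSpin Λ) (spunDecomp Λ T heights) :=
  (mapGen c.base).toRingHom

theorem baseHom_ι (x : Gen Λ (lineDecomp Λ T)) :
    c.baseHom (FreeAlgebra.ι (ZMod 2) x) = FreeAlgebra.ι (ZMod 2) (c.base x) :=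
  mapGen_ι c.base x

open scoped Classical in
/-- The derivation along `baseHom` that sends the generators off the axis to the generators above the
spun cells, and agrees with `g` on the generators above the axis. -/
def spunDeriv (g : Gen Λ (lineDecomp Λ T) → Alg Λ (lineDecomp Λ T)) :
    Alg Λ (lineDecomp Λ T) → Alg (frontSpin Λ) (spunDecomp Λ T heights) :=
  derivAlong (fun x => FreeAlgebra.ι (ZMod 2) (c.base x))
    (fun x => if h : x ∉ axisGens Λ T then FreeAlgebra.ι (ZMod 2) (c.spun x (ne_zero_of_notMem h))
      else c.baseHom (g x))

variable (g : Gen Λ (lineDecomp Λ T) → Alg Λ (lineDecomp Λ T))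

theorem spunDeriv_add (x y : Alg Λ (lineDecomp Λ T)) :
    c.spunDeriv g (x + y) = c.spunDeriv g x + c.spunDeriv g y := derivAlong_add _ _ _ _

theorem spunDeriv_mul (x y : Alg Λ (lineDecomp Λ T)) :
    c.spunDeriv g (x * y) = c.spunDeriv g x * c.baseHom y + c.baseHom x * c.spunDeriv g y :=
  derivAlong_mul _ _ _ _

theorem spunDeriv_one : c.spunDeriv g 1 = 0 := derivAlong_one _ _

theorem spunDeriv_zero : c.spunDeriv g 0 = 0 := derivAlong_zero _ _

theorem spunDeriv_ι_of_mem {x : Gen Λ (lineDecomp Λ T)} (hx : x ∈ axisGens Λ T) :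
    c.spunDeriv g (FreeAlgebra.ι (ZMod 2) x) = c.baseHom (g x) := by
  rw [spunDeriv, derivAlong_ι, dif_neg (not_not.2 hx)]

theorem spunDeriv_ι_of_notMem {x : Gen Λ (lineDecomp Λ T)} (hx : x ∉ axisGens Λ T) :
    c.spunDeriv g (FreeAlgebra.ι (ZMod 2) x) =
      FreeAlgebra.ι (ZMod 2) (c.spun x (ne_zero_of_notMem hx)) := by
  rw [spunDeriv, derivAlong_ι, dif_pos hx]

theorem gmat_vert (t : T) :
    (gmat (frontSpin Λ) (spunDecomp Λ T heights) (.vert t)).submatrix (c.vert t) (c.vert t) =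
      (gmat Λ (lineDecomp Λ T) (.vert t)).map c.baseHom := by
  ext S S'
  by_cases h : Above S S'
  · exact (gmat_of_above ((c.vert_above t S S').2 h)).trans
      ((c.baseHom_ι _).symm.trans (congrArg c.baseHom (gmat_of_above h).symm))
  · exact (gmat_of_not_above (fun h' => h ((c.vert_above t S S').1 h'))).trans
      ((map_zero c.baseHom).symm.trans (congrArg c.baseHom (gmat_of_not_above h).symm))

theorem gmat_edge (e : LineEdge Λ T) :
    (gmat (frontSpin Λ) (spunDecomp Λ T heights) (.edge (Sum.inl e))).submatrix
      (c.edge e) (c.edge e) = (gmat Λ (lineDecomp Λ T) (.edge e)).map c.baseHom := by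
  ext S S'
  by_cases h : Above S S'
  · exact (gmat_of_above ((c.edge_above e S S').2 h)).trans
      ((c.baseHom_ι _).symm.trans (congrArg c.baseHom (gmat_of_above h).symm))
  · exact (gmat_of_not_above (fun h' => h ((c.edge_above e S S').1 h'))).trans
      ((map_zero c.baseHom).symm.trans (congrArg c.baseHom (gmat_of_not_above h).symm))

/-- The derivation takes `a` to `â` off the axis, where the values of `g` play no role. -/
theorem gmat_spunVert (t : OffAxis T) :
    (gmat (frontSpin Λ) (spunDecomp Λ T heights) (.edge (Sum.inr t))).submatrix
      (c.spunVert t) (c.spunVert t) =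
        (gmat Λ (lineDecomp Λ T) (.vert t.1)).map (c.spunDeriv g) := by
  ext S S'
  by_cases h : Above S S'
  · have hx : (⟨.vert t.1, ⟨(S, S'), h⟩⟩ : Gen Λ (lineDecomp Λ T)) ∉ axisGens Λ T := by
      rintro ⟨t', h0, ht'⟩
      obtain rfl := Cell.vert.inj ht'
      exact t.2 h0
    exact (gmat_of_above ((c.spunVert_above t S S').2 h)).trans
      ((c.spunDeriv_ι_of_notMem g hx).symm.trans (congrArg (c.spunDeriv g) (gmat_of_above h).symm))
  · exact (gmat_of_not_above (fun h' => h ((c.spunVert_above t S S').1 h'))).trans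
      ((c.spunDeriv_zero g).symm.trans (congrArg (c.spunDeriv g) (gmat_of_not_above h).symm))

theorem gmat_spunEdge (e : LineEdge Λ T) :
    (gmat (frontSpin Λ) (spunDecomp Λ T heights) (.face e)).submatrix
      (c.spunEdge e) (c.spunEdge e) = (gmat Λ (lineDecomp Λ T) (.edge e)).map (c.spunDeriv g) := by
  ext S S'
  by_cases h : Above S S'
  · have hx : (⟨.edge e, ⟨(S, S'), h⟩⟩ : Gen Λ (lineDecomp Λ T)) ∉ axisGens Λ T := by
      rintro ⟨t', h0, ht'⟩
      exact absurd ht' (by rintro ⟨⟩)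
    exact (gmat_of_above ((c.spunEdge_above e S S').2 h)).trans
      ((c.spunDeriv_ι_of_notMem g hx).symm.trans (congrArg (c.spunDeriv g) (gmat_of_above h).symm))
  · exact (gmat_of_not_above (fun h' => h ((c.spunEdge_above e S S').1 h'))).trans
      ((c.spunDeriv_zero g).symm.trans (congrArg (c.spunDeriv g) (gmat_of_not_above h).symm))

variable {c}

theorem Compatible.vertMat_edge (hc : c.Compatible) (e : LineEdge Λ T) (t : T) (u : ℝ)
    (hut : (u = 0 ∧ t = e.1.1) ∨ (u = 1 ∧ t = e.1.2)) :
    (vertMat (frontSpin Λ) (spunDecomp Λ T heights) _ openI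
      ((spunDecomp Λ T heights).path (Sum.inl e)) u t).submatrix (c.edge e) (c.edge e) =
      (vertMat Λ (lineDecomp Λ T) _ openI ((lineDecomp Λ T).path e) u t).map c.baseHom := by
  have hu : u = 0 ∨ u = 1 := hut.imp And.left And.left
  exact vertMat_transfer (c.edge e) c.baseHom
    (place_transfer (c.edge e) (c.vert t) (hc.limits_edge e t u hut)
      (hc.limits_unique e t u hu) (map_zero c.baseHom) (c.gmat_vert t)) (hc.cusp_edge e u hu)

theorem Compatible.vertMat_face (hc : c.Compatible) (e : LineEdge Λ T) (t : T) (u φ : ℝ)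
    (hut : (u = 0 ∧ t = e.1.1) ∨ (u = 1 ∧ t = e.1.2)) (hφ : φ = 0 ∨ φ = 1) :
    (vertMat (frontSpin Λ) (spunDecomp Λ T heights) _ openSq
      ((spunDecomp Λ T heights).chart e) (u, φ) t).submatrix (c.spunEdge e) (c.spunEdge e) =
      (vertMat Λ (lineDecomp Λ T) _ openI ((lineDecomp Λ T).path e) u t).map c.baseHom := by
  have hu : u = 0 ∨ u = 1 := hut.imp And.left And.left
  have hφ' : φ ∈ Icc (0 : ℝ) 1 := by rcases hφ with rfl | rfl <;> simp
  exact vertMat_transfer (c.spunEdge e) c.baseHom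
    (place_transfer (c.spunEdge e) (c.vert t)
      (hc.limits_face_vert e t u φ hut hφ' (hφ.imp_right Or.inl))
      (hc.limits_unique e t u hu) (map_zero c.baseHom) (c.gmat_vert t)) (hc.cusp_face e u φ hu hφ)

/-- Each sheet above the open loop closes up at the sheet from which it was swept out, and no cusps
occur at its ends; so `A` appears unchanged. -/
theorem Compatible.vertMat_circle (hc : c.Compatible) (t : OffAxis T) (u : ℝ) (hu : u = 0 ∨ u = 1) :
    (vertMat (frontSpin Λ) (spunDecomp Λ T heights) _ openI
      ((spunDecomp Λ T heights).path (Sum.inr t)) u t.1).submatrix (c.spunVert t) (c.spunVert t) =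
      (gmat Λ (lineDecomp Λ T) (.vert t.1)).map c.baseHom := by
  exact (vertMat_eq_place (c.spunVert t) (hc.cusp_circle t u hu)).trans
    ((place_equiv (c.spunVert t) (c.vert t.1) (hc.limits_circle t u hu) _).trans
      (c.gmat_vert t.1))

theorem Compatible.dmat_vert (hc : c.Compatible) (t : T) :
    (dmat (frontSpin Λ) (spunDecomp Λ T heights) (.vert t)).submatrix (c.vert t) (c.vert t) =
      (dmat Λ (lineDecomp Λ T) (.vert t)).map c.baseHom := by
  have := hc.finite_vert t
  exact mmul_transfer _ _ (c.gmat_vert t) (c.gmat_vert t)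

theorem Compatible.dmat_edge (hc : c.Compatible) (e : LineEdge Λ T) :
    (dmat (frontSpin Λ) (spunDecomp Λ T heights) (.edge (Sum.inl e))).submatrix
      (c.edge e) (c.edge e) = (dmat Λ (lineDecomp Λ T) (.edge e)).map c.baseHom := by
  have := hc.finite_edge e
  exact edge_transfer _ _ (hc.vertMat_edge e e.1.2 1 (Or.inr ⟨rfl, rfl⟩)) (c.gmat_edge e)
    (hc.vertMat_edge e e.1.1 0 (Or.inl ⟨rfl, rfl⟩))

theorem Compatible.dmat_spunVert (hc : c.Compatible) (t : OffAxis T) :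
    (dmat (frontSpin Λ) (spunDecomp Λ T heights) (.edge (Sum.inr t))).submatrix
      (c.spunVert t) (c.spunVert t) =
        (dmat Λ (lineDecomp Λ T) (.vert t.1)).map (c.spunDeriv g) := by
  have := hc.finite_vert t.1
  exact circle_transfer _ (c.spunDeriv_add g) (c.spunDeriv_mul g)
    (hc.vertMat_circle t 1 (Or.inr rfl)) (c.gmat_spunVert g t)
    (hc.vertMat_circle t 0 (Or.inl rfl))

/-- The value of the derivation on the generators above the axis in the front spin. -/
theorem Compatible.coneU_axis (hc : c.Compatible) (hg : ∀ x ∈ axisGens Λ T, g x =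
      (coneU (gmat Λ (lineDecomp Λ T) x.1) MatchedPair heights - mone _ _ :
        Matrix _ _ (Alg Λ (lineDecomp Λ T))) x.2.1.1 x.2.1.2) (t : T) (ht : t.1 = 0) :
    (coneU (gmat (frontSpin Λ) (spunDecomp Λ T heights) (.vert t)) ConePair heights
      - mone _ _).submatrix (c.vert t) (c.vert t) =
        (gmat Λ (lineDecomp Λ T) (.vert t)).map (c.spunDeriv g) := by
  have := hc.finite_vert t
  have h1 := coneU_transfer (c.vert t) c.baseHom (c.gmat_vert t) (hc.conePair t ht)
    (hc.matched_unique t ht) heights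
  have h2 := mone_transfer (A := Alg Λ (lineDecomp Λ T)) (c.vert t) c.baseHom
  ext S S'
  have h1' := congrFun (congrFun h1 S) S'
  have h2' := congrFun (congrFun h2 S) S'
  rw [Matrix.submatrix_apply, Matrix.map_apply] at h1' h2' ⊢
  rw [Matrix.sub_apply, h1', h2', ← map_sub, ← Matrix.sub_apply]
  by_cases h : Above S S'
  · have hx : (⟨.vert t, ⟨(S, S'), h⟩⟩ : Gen Λ (lineDecomp Λ T)) ∈ axisGens Λ T := ⟨t, ht, rfl⟩
    exact (congrArg c.baseHom (hg _ hx).symm).trans ((c.spunDeriv_ι_of_mem g hx).symm.trans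
      (congrArg (c.spunDeriv g) (gmat_of_above h).symm))
  -- For pairs without a generator both sides vanish, as `U - I` is supported on the pairs `S ≺ S'`.
  · have h0 := coneU_sub_one_eq_zero (hc.above_trans t) (a := gmat Λ (lineDecomp Λ T) (.vert t))
      (fun i j hij => gmat_of_not_above hij) (hc.matched_left t) (hc.matched_right t) heights h
    exact (congrArg c.baseHom h0).trans ((map_zero c.baseHom).trans ((c.spunDeriv_zero g).symm.trans
      (congrArg (c.spunDeriv g) (gmat_of_not_above h).symm)))

/-- If the inner vertex is on the axis, the corner factor `I + (U - I)` takes the place of the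
circular side `I + Â₋`; the matrix computation is the same in both cases. -/
theorem Compatible.dmat_spunEdge (hc : c.Compatible) (hT : ∀ t ∈ T, t ≤ 0) (hg : ∀ x ∈ axisGens Λ T, g x =
      (coneU (gmat Λ (lineDecomp Λ T) x.1) MatchedPair heights - mone _ _ :
        Matrix _ _ (Alg Λ (lineDecomp Λ T))) x.2.1.1 x.2.1.2) (e : LineEdge Λ T) :
    (dmat (frontSpin Λ) (spunDecomp Λ T heights) (.face e)).submatrix
      (c.spunEdge e) (c.spunEdge e) =
        (dmat Λ (lineDecomp Λ T) (.edge e)).map (c.spunDeriv g) := by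
  have := hc.finite_edge e
  -- The outer end of an edge is never on the axis.
  have h1 : e.1.2.1 ≠ 0 := (e.2.1.trans_le (hT _ e.1.1.2)).ne
  have hccw : (spunDecomp Λ T heights).ccw e = [Step.edge (Sum.inl e) true (1 / 2, 0),
      Step.edge (Sum.inr ⟨e.1.2, h1⟩) true (1, 1 / 2)] := by
    simp [spunDecomp, h1]
  -- Both radial sides of the rectangle are the edge `e` itself.
  have hS : ∀ φ : ℝ, φ = 0 ∨ φ = 1 → ((place (Limits openSq ((spunDecomp Λ T heights).chart e)
      (1 / 2, φ)) (gmat (frontSpin Λ) (spunDecomp Λ T heights) (.edge (Sum.inl e)))) : Matrix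
      (Sheet (frontSpin Λ) (Cell.face (E := spunDecomp Λ T heights) e).carrier) _ _).submatrix
      (c.spunEdge e) (c.spunEdge e) = (gmat Λ (lineDecomp Λ T) (.edge e)).map c.baseHom := by
    intro φ hφ
    rw [← c.gmat_edge]
    exact place_equiv (c.spunEdge e) (c.edge e) (hc.limits_face_edge e φ hφ) _
  -- For a pair that meets in a cusp the circular side has entry `0`, which is the derivative of the
  -- entry `1` in the vertex matrix of `Λ`.
  have hV : ∀ (t : OffAxis T) (u : ℝ), (u = 0 ∧ t.1 = e.1.1) ∨ (u = 1 ∧ t.1 = e.1.2) →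
      ((place (Limits openSq ((spunDecomp Λ T heights).chart e) (u, 1 / 2))
      (gmat (frontSpin Λ) (spunDecomp Λ T heights) (.edge (Sum.inr t)))) : Matrix
      (Sheet (frontSpin Λ) (Cell.face (E := spunDecomp Λ T heights) e).carrier) _ _).submatrix
      (c.spunEdge e) (c.spunEdge e) = (vertMat Λ (lineDecomp Λ T) _ openI
        ((lineDecomp Λ T).path e) u t.1).map (c.spunDeriv g) := by
    intro t u hut
    exact (place_transfer (c.spunEdge e) (c.spunVert t) (hc.limits_face_circle e t u hut)
      (hc.limits_unique e t.1 u (hut.imp And.left And.left)) (c.spunDeriv_zero g)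
      (c.gmat_spunVert g t)).trans
        (map_vertMat (c.spunDeriv_add g) (c.spunDeriv_zero g) (c.spunDeriv_one g)).symm
  have hv1 := hc.vertMat_face e e.1.2 1 1 (Or.inr ⟨rfl, rfl⟩) (Or.inr rfl)
  have hv0 := hc.vertMat_face e e.1.1 0 0 (Or.inl ⟨rfl, rfl⟩) (Or.inl rfl)
  by_cases h0 : e.1.1.1 = 0
  · have hcw : (spunDecomp Λ T heights).cw e = [Step.corner e.1.1 (0, 1 / 2) heights,
        Step.edge (Sum.inl e) true (1 / 2, 1)] := by
      simp [spunDecomp, h0]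
    have hU : ((place (Limits openSq ((spunDecomp Λ T heights).chart e) (0, 1 / 2))
      (coneU (gmat (frontSpin Λ) (spunDecomp Λ T heights) (.vert e.1.1)) ConePair heights
        - mone _ _)) : Matrix
      (Sheet (frontSpin Λ) (Cell.face (E := spunDecomp Λ T heights) e).carrier) _ _).submatrix
      (c.spunEdge e) (c.spunEdge e) = (vertMat Λ (lineDecomp Λ T) _ openI
        ((lineDecomp Λ T).path e) 0 e.1.1).map (c.spunDeriv g) := by
      exact (place_transfer (c.spunEdge e) (c.vert e.1.1)
        (hc.limits_face_vert e e.1.1 0 (1 / 2) (Or.inl ⟨rfl, rfl⟩) ⟨by norm_num, by norm_num⟩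
          (Or.inr (Or.inr h0)))
        (hc.limits_unique e e.1.1 0 (Or.inl rfl)) (c.spunDeriv_zero g)
        (hc.coneU_axis g hg e.1.1 h0)).trans
          (map_vertMat (c.spunDeriv_add g) (c.spunDeriv_zero g) (c.spunDeriv_one g)).symm
    refine (congrArg (fun M => Matrix.submatrix M (c.spunEdge e) (c.spunEdge e))
      (dmat_face hccw hcw)).trans ?_
    exact face_transfer (c.spunEdge e) (c.spunDeriv_add g) (c.spunDeriv_mul g) (c.spunDeriv_one g)
      hv1 (c.gmat_spunEdge g e) hv0 (hS 0 (Or.inl rfl))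
      (hV ⟨e.1.2, h1⟩ 1 (Or.inr ⟨rfl, rfl⟩)) hU (hS 1 (Or.inr rfl))
  · have hcw : (spunDecomp Λ T heights).cw e = [Step.edge (Sum.inr ⟨e.1.1, h0⟩) true (0, 1 / 2),
        Step.edge (Sum.inl e) true (1 / 2, 1)] := by
      simp [spunDecomp, h0]
    refine (congrArg (fun M => Matrix.submatrix M (c.spunEdge e) (c.spunEdge e))
      (dmat_face hccw hcw)).trans ?_
    exact face_transfer (c.spunEdge e) (c.spunDeriv_add g) (c.spunDeriv_mul g) (c.spunDeriv_one g)
      hv1 (c.gmat_spunEdge g e) hv0 (hS 0 (Or.inl rfl))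
      (hV ⟨e.1.2, h1⟩ 1 (Or.inr ⟨rfl, rfl⟩)) (hV ⟨e.1.1, h0⟩ 0 (Or.inl ⟨rfl, rfl⟩))
      (hS 1 (Or.inr rfl))

end SheetCorr

/-! ## The correspondence of sheets -/

/-- The bijections of sheets are given by the rotation of sheets. -/
structure SheetCorr.Geometric {Λ : Set (J1 ℝ)} {T : Finset ℝ} {heights : List ℝ}
    (c : SheetCorr Λ T heights) : Prop where
  vert : ∀ t : T, TameFront.VertCorr (t := t.1) (c.vert t)
  edge : ∀ e S, (c.edge e S).pts = spin {1} S.pts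
  spunVert : ∀ t S, (c.spunVert t S).pts = spin turns S.pts
  spunEdge : ∀ e S, (c.spunEdge e S).pts = spin turns S.pts

theorem touches_const {t φ : ℝ} (hφ : φ ∈ Icc (0 : ℝ) 1) {p₀ p : J1 ℝ} (hp₀ : p₀.1 = t) :
    Touches openI (fun _ : ℝ => t) φ {p₀} p ↔ p = p₀ := by
  rw [touches_iff_frequently]
  constructor
  · intro h
    by_contra hne
    obtain ⟨-, -, q, ⟨rfl, hq⟩, -⟩ := h univ Filter.univ_mem {p₀}ᶜ (isOpen_ne.mem_nhds hne)
    exact hq rfl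
  · rintro rfl J hJ N hN
    obtain ⟨J', hJ', -, ⟨s, hs, hsJ⟩, hsub⟩ := exists_isPreconnected_openI hφ hJ
    exact ⟨s, ⟨hs, hsub s hsJ⟩, p, ⟨rfl, mem_of_mem_nhds hN⟩, hp₀⟩

/-- The second coordinate does not enter the condition and can approach `φ₀` independently of the
first. -/
theorem touches_openSq {f : ℝ → ℝ} {s₀ φ₀ : ℝ} (hφ : φ₀ ∈ Icc (0 : ℝ) 1) {S : Set (J1 ℝ)}
    {p : J1 ℝ} : Touches openSq (fun w : ℝ × ℝ => f w.1) (s₀, φ₀) S p ↔ Touches openI f s₀ S p := by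
  rw [touches_iff_frequently, touches_iff_frequently]
  constructor
  · intro h J hJ N hN
    obtain ⟨w, ⟨hw, hwJ⟩, q, hq, hqw⟩ := h (Prod.fst ⁻¹' J)
      (continuous_fst.continuousAt.preimage_mem_nhds hJ) N hN
    exact ⟨w.1, ⟨hw.1, hwJ⟩, q, hq, hqw⟩
  · intro h J hJ N hN
    rw [nhds_prod_eq] at hJ
    obtain ⟨J₁, hJ₁, J₂, hJ₂, hsub⟩ := Filter.mem_prod_iff.1 hJ
    obtain ⟨s, ⟨hs, hsJ⟩, q, hq, hqs⟩ := h J₁ hJ₁ N hN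
    obtain ⟨J', -, -, ⟨φ, hφI, hφJ⟩, hJ'⟩ := exists_isPreconnected_openI hφ hJ₂
    exact ⟨(s, φ), ⟨⟨hs, hφI⟩, hsub ⟨hsJ, hJ' φ hφJ⟩⟩, q, hq, hqs⟩

namespace TameFront

variable {Λ : Set (J1 ℝ)} {T : Finset ℝ}

theorem pts_nonpos (h : TameFront Λ T) {K : Set ℝ} (S : Sheet Λ K) : ∀ p ∈ S.pts, p.1 ≤ 0 :=
  fun p hp => h.nonpos p (pts_subset S hp).1

theorem touches_base_edge (h : TameFront Λ T) (e : LineEdge Λ T) (S : Sheet Λ e.ivl) (s₀ : ℝ)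
    (p' : J1 ℂ) : Touches openI (fun s => (e.path s : ℂ)) s₀ (spin {1} S.pts) p' ↔
      ∃ p, Touches openI e.path s₀ S.pts p ∧ p' = spinPt 1 p :=
  touches_spin (χ := fun s => (e.path s : ℂ)) (x := e.path) (r := fun _ => 1) (U := {1})
    continuous_const (fun w => by simp)
    (fun w hw => h.ivl_neg e (e.path_mem hw)) (fun _ _ => rfl) (h.pts_nonpos S)

theorem touches_circle (h : TameFront Λ T) {t : ℝ} (ht : t < 0) (S : Sheet Λ {t}) {p₀ : J1 ℝ}
    (hS : S.pts = {p₀}) {φ : ℝ} (hφ : φ ∈ Icc (0 : ℝ) 1) (p' : J1 ℂ) :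
    Touches openI (polar t) φ (spin turns S.pts) p' ↔ ∃ p, p = p₀ ∧ p' = spinPt (turn φ) p := by
  have hp₀ : p₀.1 = t := (pts_subset S (hS ▸ rfl : p₀ ∈ S.pts)).2
  rw [touches_spin (U := turns) (x := fun _ => t) continuous_turn (polar_eq t) (fun _ _ => ht)
    (fun w hw => mem_image_of_mem turn hw) (h.pts_nonpos S), hS]
  simp only [touches_const hφ hp₀]

theorem touches_face (h : TameFront Λ T) (e : LineEdge Λ T) (S : Sheet Λ e.ivl) (s₀ : ℝ) {φ : ℝ}
    (hφ : φ ∈ Icc (0 : ℝ) 1) (p' : J1 ℂ) :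
    Touches openSq (fun w : ℝ × ℝ => polar (e.path w.1) w.2) (s₀, φ) (spin turns S.pts) p' ↔
      ∃ p, Touches openI e.path s₀ S.pts p ∧ p' = spinPt (turn φ) p := by
  rw [touches_spin (U := turns) (x := fun w : ℝ × ℝ => e.path w.1)
    (r := fun w => turn w.2) (continuous_turn.comp continuous_snd) (fun w => polar_eq _ _)
    (fun w hw => h.ivl_neg e (e.path_mem hw.1)) (fun w hw => mem_image_of_mem turn hw.2) (h.pts_nonpos S)]
  simp only [touches_openSq hφ]

/-- Every cell except the 0-cell on the axis has the form required by `exists_spinSheet`, with `U =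
{1}` or `U = turns`. -/
theorem exists_sheetCorr (h : TameFront Λ T) (heights : List ℝ) :
    ∃ c : SheetCorr Λ T heights, c.Geometric := by
  choose v hv using fun t : T => h.exists_vertCorr (h.nonpos_of_mem t.2)
  have hE : ∀ e : LineEdge Λ T, ∃ σ : Sheet Λ e.ivl ≃
      Sheet (frontSpin Λ) ((fun s => (e.path s : ℂ)) '' openI),
      ∀ S, (σ S).pts = spin {1} S.pts := fun e =>
    h.exists_spinSheet isPreconnected_singleton (singleton_nonempty 1) (fun x => h.ivl_neg e) (by
      intro w
      constructor
      · rintro ⟨s, hs, rfl⟩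
        exact ⟨_, e.path_mem hs, 1, rfl, by simp⟩
      · rintro ⟨_, ⟨s, hs, rfl⟩, _, rfl, rfl⟩
        exact ⟨s, hs, by simp⟩)
  have hneg : ∀ t : OffAxis T, t.1.1 < 0 := fun t => (h.nonpos_of_mem t.1.2).lt_of_ne t.2
  have hV : ∀ t : OffAxis T, ∃ σ : Sheet Λ {t.1.1} ≃ Sheet (frontSpin Λ) (polar t.1.1 '' openI),
      ∀ S, (σ S).pts = spin turns S.pts := fun t =>
    h.exists_spinSheet isPreconnected_turns turns_nonempty (by simpa using hneg t) (by
      intro w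
      constructor
      · rintro ⟨φ, hφ, rfl⟩
        exact ⟨_, rfl, _, ⟨φ, hφ, rfl⟩, polar_eq _ _⟩
      · rintro ⟨_, rfl, _, ⟨φ, hφ, rfl⟩, rfl⟩
        exact ⟨φ, hφ, polar_eq _ _⟩)
  have hF : ∀ e : LineEdge Λ T, ∃ σ : Sheet Λ e.ivl ≃
      Sheet (frontSpin Λ) ((fun w : ℝ × ℝ => polar (e.path w.1) w.2) '' openSq),
      ∀ S, (σ S).pts = spin turns S.pts := fun e =>
    h.exists_spinSheet isPreconnected_turns turns_nonempty (fun x => h.ivl_neg e) (by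
      intro w
      constructor
      · rintro ⟨s, hs, rfl⟩
        exact ⟨_, e.path_mem hs.1, _, ⟨s.2, hs.2, rfl⟩, polar_eq _ _⟩
      · rintro ⟨_, ⟨s, hs, rfl⟩, _, ⟨φ, hφ, rfl⟩, rfl⟩
        exact ⟨(s, φ), ⟨hs, hφ⟩, polar_eq _ _⟩)
  choose E hE using hE
  choose V hV using hV
  choose F hF using hF
  exact ⟨{  vert := v
            edge := E
            spunVert := V
            spunEdge := F
            vert_above := fun t => (hv t).above_iff h
            edge_above := fun e S S' => h.above_spin_iff (singleton_nonempty 1)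
              (fun x => h.ivl_neg e) (hE e S) (hE e S')
            spunVert_above := fun t S S' => h.above_spin_iff turns_nonempty
              (K := {t.1.1}) (by simpa using hneg t) (hV t S) (hV t S')
            spunEdge_above := fun e S S' => h.above_spin_iff turns_nonempty
              (fun x => h.ivl_neg e) (hF e S) (hF e S') },
    { vert := hv, edge := hE, spunVert := hV, spunEdge := hF }⟩

end TameFront

namespace SheetCorr.Geometric

variable {Λ : Set (J1 ℝ)} {T : Finset ℝ} {heights : List ℝ} {c : SheetCorr Λ T heights}

theorem touches_edge (hc : c.Geometric) (h : TameFront Λ T) (e : LineEdge Λ T) (u : ℝ)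
    (S : Sheet Λ e.ivl) (p' : J1 ℂ) :
    Touches openI (fun s => (e.path s : ℂ)) u (c.edge e S).pts p' ↔
      ∃ p, Touches openI e.path u S.pts p ∧ p' = spinPt 1 p :=
  (congrArg (fun M => Touches openI (fun s => (e.path s : ℂ)) u M p') (hc.edge e S)).to_iff.trans
    (h.touches_base_edge e S u p')

theorem touches_spunEdge (hc : c.Geometric) (h : TameFront Λ T) (e : LineEdge Λ T) (u : ℝ) {φ : ℝ}
    (hφ : φ ∈ Icc (0 : ℝ) 1) (S : Sheet Λ e.ivl) (p' : J1 ℂ) :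
    Touches openSq (fun w : ℝ × ℝ => polar (e.path w.1) w.2) (u, φ) (c.spunEdge e S).pts p' ↔
      ∃ p, Touches openI e.path u S.pts p ∧ p' = spinPt (turn φ) p :=
  (congrArg (fun M => Touches openSq (fun w : ℝ × ℝ => polar (e.path w.1) w.2) (u, φ) M p')
    (hc.spunEdge e S)).to_iff.trans (h.touches_face e S u hφ p')

theorem touches_spunVert (hc : c.Geometric) (h : TameFront Λ T) (t : OffAxis T)
    (S : Sheet Λ {t.1.1}) {p₀ : J1 ℝ} (hS : S.pts = {p₀}) {φ : ℝ} (hφ : φ ∈ Icc (0 : ℝ) 1)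
    (p' : J1 ℂ) : Touches openI (polar t.1.1) φ (c.spunVert t S).pts p' ↔
      ∃ p, p = p₀ ∧ p' = spinPt (turn φ) p :=
  (congrArg (fun M => Touches openI (polar t.1.1) φ M p') (hc.spunVert t S)).to_iff.trans
    (h.touches_circle ((h.nonpos_of_mem t.1.2).lt_of_ne t.2) S hS hφ p')

theorem compatible (hc : c.Geometric) (h : TameFront Λ T) : c.Compatible where
  finite_vert t := h.finite_vert_sheet t.1
  finite_edge e := h.finite_edge_sheet e
  limits_unique e t u hu S P P' hP hP' := by
    have hu' : u ∈ Icc (0 : ℝ) 1 := by rcases hu with rfl | rfl <;> simp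
    obtain ⟨p, hp, htp⟩ := hP.1
    obtain ⟨p', hp', htp'⟩ := hP'.1
    obtain rfl := h.touches_unique (e := e) (S := S) hu' htp htp'
    exact h.sheet_ext hp hp'
  limits_edge e t u hut S P := by
    have ht : e.path u = t.1 := by
      rcases hut with ⟨rfl, rfl⟩ | ⟨rfl, rfl⟩
      exacts [e.path_zero, e.path_one]
    have hu' : u ∈ Icc (0 : ℝ) 1 := by rcases hut with ⟨rfl, -⟩ | ⟨rfl, -⟩ <;> simp
    exact h.limits_vert_iff ht hu' (hc.vert t) (c.edge_above e) (fun _ => rfl)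
      (hc.touches_edge h e u) S P
  cusp_edge e u hu S S' := by
    have hu' : u ∈ Icc (0 : ℝ) 1 := by rcases hu with rfl | rfl <;> simp
    exact h.meetInCusp_iff hu' (c.edge_above e) (hc.touches_edge h e u) S S'
  limits_circle t u hu S P := by
    have hu' : u ∈ Icc (0 : ℝ) 1 := by rcases hu with rfl | rfl <;> simp
    have hturn : turn u = 1 := by
      rcases hu with rfl | rfl
      exacts [turn_zero, turn_one]
    have hlt : t.1.1 < 0 := (h.nonpos_of_mem t.1.2).lt_of_ne t.2
    obtain ⟨p₀, hp₀, -, -, hS⟩ := h.vert_sheet (t := t.1.1) S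
    refine (h.limits_spin_iff (K := {t.1.1}) (by simpa using hlt) (singleton_nonempty 1)
      ((hc.vert t.1).off hlt P) hturn (R := fun p => p = p₀)
      (by rintro _ rfl; exact h.nonpos _ hp₀) (hc.touches_spunVert h t S hS hu')).trans ?_
    constructor
    · rintro ⟨p, hp, rfl⟩
      exact h.sheet_ext (K := {t.1.1}) (p := p) (hS ▸ rfl) hp
    · rintro rfl
      exact ⟨p₀, (hS ▸ rfl : p₀ ∈ S.pts), rfl⟩
  cusp_circle t u hu S S' := by
    have hu' : u ∈ Icc (0 : ℝ) 1 := by rcases hu with rfl | rfl <;> simp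
    rintro ⟨hab, p', -, h1, h2⟩
    obtain ⟨p₀, -, -, -, hS⟩ := h.vert_sheet (t := t.1.1) S
    obtain ⟨q₀, -, -, -, hS'⟩ := h.vert_sheet (t := t.1.1) S'
    obtain ⟨p, rfl, hp⟩ := (hc.touches_spunVert h t S hS hu' p').1 h1
    obtain ⟨q, rfl, hq⟩ := (hc.touches_spunVert h t S' hS' hu' p').1 h2
    obtain rfl := spinPt_injective _ (hp.symm.trans hq)
    have heq : S = S' := h.sheet_ext (K := {t.1.1}) (p := p) (hS ▸ rfl) (hS' ▸ rfl)
    subst heq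
    exact TameFront.not_above_self _ hab
  limits_face_vert e t u φ hut hφ hφt S P := by
    have ht : e.path u = t.1 := by
      rcases hut with ⟨rfl, rfl⟩ | ⟨rfl, rfl⟩
      exacts [e.path_zero, e.path_one]
    have hu' : u ∈ Icc (0 : ℝ) 1 := by rcases hut with ⟨rfl, -⟩ | ⟨rfl, -⟩ <;> simp
    refine h.limits_vert_iff ht hu' (hc.vert t) (c.spunEdge_above e) (v := turn φ) (fun hlt => ?_)
      (hc.touches_spunEdge h e u hφ) S P
    -- At the corners of the square the rotation is trivial. On the axis the whole side is collapsed
    -- to the vertex, so every `φ` is allowed, in particular the `1 / 2` of the marked corner.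
    rcases hφt with rfl | rfl | h0
    exacts [turn_zero, turn_one, absurd h0 hlt.ne]
  cusp_face e u φ hu hφ S S' := by
    have hu' : u ∈ Icc (0 : ℝ) 1 := by rcases hu with rfl | rfl <;> simp
    have hφ' : φ ∈ Icc (0 : ℝ) 1 := by rcases hφ with rfl | rfl <;> simp
    exact h.meetInCusp_iff hu' (c.spunEdge_above e) (hc.touches_spunEdge h e u hφ') S S'
  limits_face_edge e φ hφ S P := by
    have hφ' : φ ∈ Icc (0 : ℝ) 1 := by rcases hφ with rfl | rfl <;> simp
    have hturn : turn φ = 1 := by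
      rcases hφ with rfl | rfl
      exacts [turn_zero, turn_one]
    -- A radial side is tested above the midpoint of `e`, where limit points of a sheet belong to
    -- the sheet.
    have hhalf : (1 / 2 : ℝ) ∈ openI := ⟨by norm_num, by norm_num⟩
    refine (h.limits_spin_iff (K := e.ivl) (fun x => h.ivl_neg e) (singleton_nonempty 1)
      (hc.edge e P) hturn (R := fun p => Touches openI e.path (1 / 2) S.pts p)
      (fun p hp => h.nonpos p (h.touches_mem (e := e) (S := S) hp).1)
      (hc.touches_spunEdge h e (1 / 2) hφ' S)).trans ?_
    constructor
    · rintro ⟨p, hp, htp⟩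
      exact h.sheet_ext (K := e.ivl) ((h.touches_interior (e := e) (S := S) hhalf).1 htp).1 hp
    · rintro rfl
      obtain ⟨p, hp, hpx⟩ := h.edge_exists_pt (e := e) S (e.path_mem hhalf)
      exact ⟨p, hp, (h.touches_interior (e := e) (S := S) hhalf).2 ⟨hp, hpx⟩⟩
  limits_face_circle e t u hut S P := by
    have hlt : t.1.1 < 0 := (h.nonpos_of_mem t.1.2).lt_of_ne t.2
    have hhalf : (1 / 2 : ℝ) ∈ openI := ⟨by norm_num, by norm_num⟩
    exact (h.limits_spin_iff (K := {t.1.1}) (by simpa using hlt) turns_nonempty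
      (hc.spunVert t P) (mem_image_of_mem turn hhalf)
      (R := fun p => Touches openI e.path u S.pts p)
      (fun p hp => h.nonpos p (h.touches_mem (e := e) (S := S) hp).1)
      (hc.touches_spunEdge h e u (Ioo_subset_Icc_self hhalf) S)).trans
        (h.limits_line_iff S P).symm
  above_trans t S S' S'' h1 h2 := by
    obtain ⟨p, -, hp, -, hS⟩ := h.vert_sheet (t := t.1) S
    obtain ⟨q, -, hq, -, hS'⟩ := h.vert_sheet (t := t.1) S'
    obtain ⟨r, -, hr, -, hS''⟩ := h.vert_sheet (t := t.1) S''
    exact (TameFront.vert_above_iff (hp.trans hr.symm) hS hS'').2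
      (((TameFront.vert_above_iff (hq.trans hr.symm) hS' hS'').1 h2).trans
        ((TameFront.vert_above_iff (hp.trans hq.symm) hS hS').1 h1))
  conePair t ht z S S' := h.conePair_iff ht (hc.vert t) z S S'
  matched_unique t ht z r r' hr hr' := h.matchedPair_unique ht hr hr'
  matched_left t z S r hr hab := by
    obtain ⟨s, -, hs, -, hS⟩ := h.vert_sheet (t := t.1) S
    obtain ⟨p, -, hp, -, h1⟩ := h.vert_sheet (t := t.1) r.1
    obtain ⟨q, -, hq, -, h2⟩ := h.vert_sheet (t := t.1) r.2
    -- Both members of a matched pair have height `z`, so they compare in the same way with any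
    -- other sheet.
    obtain ⟨hpz, hqz, -⟩ := hr p (h1 ▸ rfl) q (h2 ▸ rfl)
    have := (TameFront.vert_above_iff (hs.trans hq.symm) hS h2).1 hab
    exact (TameFront.vert_above_iff (hs.trans hp.symm) hS h1).2 (by rwa [hpz, ← hqz])
  matched_right t z S r hr hab := by
    obtain ⟨s, -, hs, -, hS⟩ := h.vert_sheet (t := t.1) S
    obtain ⟨p, -, hp, -, h1⟩ := h.vert_sheet (t := t.1) r.1
    obtain ⟨q, -, hq, -, h2⟩ := h.vert_sheet (t := t.1) r.2
    obtain ⟨hpz, hqz, -⟩ := hr p (h1 ▸ rfl) q (h2 ▸ rfl)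
    have := (TameFront.vert_above_iff (hp.trans hs.symm) h1 hS).1 hab
    exact (TameFront.vert_above_iff (hq.trans hs.symm) h2 hS).2 (by rwa [hqz, ← hpz])

end SheetCorr.Geometric

/-! ## The isomorphism with the suspension -/

namespace SheetCorr

variable {Λ : Set (J1 ℝ)} {T : Finset ℝ} {heights : List ℝ} {c : SheetCorr Λ T heights}

theorem Geometric.isBase (hc : c.Geometric) (h : TameFront Λ T) (x : Gen Λ (lineDecomp Λ T)) :
    IsBase (c.base x) x := by
  obtain ⟨t | e | f, ⟨S₁, S₂⟩, hS⟩ := x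
  · exact ⟨Or.inl ⟨t, rfl, rfl⟩, (hc.vert t).spinPt_mem h S₁, (hc.vert t).spinPt_mem h S₂⟩
  · have key : ∀ S, spinPt 1 '' S.pts ⊆ (c.edge e S).pts := by
      rintro S _ ⟨p, hp, rfl⟩
      exact (hc.edge e S).ge (spinPt_mem_spin rfl hp)
    exact ⟨Or.inr ⟨e, rfl, rfl⟩, key S₁, key S₂⟩
  · exact Empty.elim f

theorem Geometric.isSpun (hc : c.Geometric) (x : Gen Λ (lineDecomp Λ T))
    (hx : ∀ t : T, x.1 = Cell.vert t → t.1 ≠ 0) : IsSpun (c.spun x hx) x := by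
  obtain ⟨t | e | f, ⟨S₁, S₂⟩, hS⟩ := x
  · have key : ∀ u : Circle, u ≠ 1 → ∀ S, spinPt u '' S.pts ⊆ (c.spunVert ⟨t, hx t rfl⟩ S).pts := by
      rintro u hu S _ ⟨p, hp, rfl⟩
      exact (hc.spunVert ⟨t, hx t rfl⟩ S).ge (spinPt_mem_spin (mem_turns.2 hu) hp)
    exact ⟨Or.inl ⟨⟨t, hx t rfl⟩, rfl, rfl⟩, fun u hu => ⟨key u hu S₁, key u hu S₂⟩⟩
  · have key : ∀ u : Circle, u ≠ 1 → ∀ S, spinPt u '' S.pts ⊆ (c.spunEdge e S).pts := by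
      rintro u hu S _ ⟨p, hp, rfl⟩
      exact (hc.spunEdge e S).ge (spinPt_mem_spin (mem_turns.2 hu) hp)
    exact ⟨Or.inr ⟨e, rfl, rfl⟩, fun u hu => ⟨key u hu S₁, key u hu S₂⟩⟩
  · exact Empty.elim f

/-! ### Degrees of the generators -/

section Degrees

variable {m : ℕ} {μ : J1 ℝ → ZMod m} {ν : J1 ℂ → ZMod m}

theorem Geometric.deg_base (hc : c.Geometric) (h : TameFront Λ T) (hμ : IsMaslov Λ μ)
    (hν : IsMaslov (frontSpin Λ) ν)
    (hμν : ∀ p ∈ Λ, p.1 < 0 → p ∉ foldLocus Λ → ν (spinPt 1 p) = μ p)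
    (x : Gen Λ (lineDecomp Λ T)) :
    (cellularDGA (frontSpin Λ) (spunDecomp Λ T heights) ν).deg (c.base x) =
      (cellularDGA Λ (lineDecomp Λ T) μ).deg x := by
  obtain ⟨t | e | f, ⟨S₁, S₂⟩, hS⟩ := x
  · have key := TameFront.VertCorr.sheetVal_eq h hμ hν hμν (hc.vert t)
    exact congrArg₂ (fun a b => a - b + (-1 : ZMod m)) (key S₁) (key S₂)
  · have key : ∀ S : Sheet Λ e.ivl, sheetVal ν (c.edge e S) = sheetVal μ S := fun S =>
      h.sheetVal_spin hμ hν hμν (singleton_nonempty 1) (fun x => h.ivl_neg e) (hc.edge e S)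
        fun p hp => h.notMem_fold e (TameFront.pts_subset S hp).2
    exact congrArg₂ (fun a b => a - b + (0 : ZMod m)) (key S₁) (key S₂)
  · exact Empty.elim f

/-- The sheets keep their potentials, while the dimension of the cell grows by one. -/
theorem Geometric.deg_spun (hc : c.Geometric) (h : TameFront Λ T) (hμ : IsMaslov Λ μ)
    (hν : IsMaslov (frontSpin Λ) ν)
    (hμν : ∀ p ∈ Λ, p.1 < 0 → p ∉ foldLocus Λ → ν (spinPt 1 p) = μ p)
    (x : Gen Λ (lineDecomp Λ T)) (hx : ∀ t : T, x.1 = Cell.vert t → t.1 ≠ 0) :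
    (cellularDGA (frontSpin Λ) (spunDecomp Λ T heights) ν).deg (c.spun x hx) =
      (cellularDGA Λ (lineDecomp Λ T) μ).deg x + 1 := by
  obtain ⟨t | e | f, ⟨S₁, S₂⟩, hS⟩ := x
  · have hlt : t.1 < 0 := (h.nonpos_of_mem t.2).lt_of_ne (hx t rfl)
    have key : ∀ S : Sheet Λ {t.1}, sheetVal ν (c.spunVert ⟨t, hx t rfl⟩ S) = sheetVal μ S := by
      intro S
      obtain ⟨p, -, -, hpf, hS⟩ := h.vert_sheet S
      refine h.sheetVal_spin hμ hν hμν turns_nonempty (by simpa using hlt)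
        (hc.spunVert ⟨t, hx t rfl⟩ S) fun q hq => ?_
      rw [hS] at hq
      exact hq ▸ hpf
    have hdeg : ∀ a b : ZMod m, a - b + 0 = a - b + -1 + 1 := fun a b => by ring
    exact (congrArg₂ (fun a b => a - b + (0 : ZMod m)) (key S₁) (key S₂)).trans (hdeg _ _)
  · have key : ∀ S : Sheet Λ e.ivl, sheetVal ν (c.spunEdge e S) = sheetVal μ S := fun S =>
      h.sheetVal_spin hμ hν hμν turns_nonempty (fun x => h.ivl_neg e) (hc.spunEdge e S)
        fun p hp => h.notMem_fold e (TameFront.pts_subset S hp).2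
    have hdeg : ∀ a b : ZMod m, a - b + 1 = a - b + 0 + 1 := fun a b => by ring
    exact (congrArg₂ (fun a b => a - b + (1 : ZMod m)) (key S₁) (key S₂)).trans (hdeg _ _)
  · exact Empty.elim f

end Degrees

theorem Compatible.d_base (hc : c.Compatible) (x : Gen Λ (lineDecomp Λ T)) :
    c.baseHom (dmat Λ (lineDecomp Λ T) x.1 x.2.1.1 x.2.1.2) =
      dmat (frontSpin Λ) (spunDecomp Λ T heights) (c.base x).1 (c.base x).2.1.1
        (c.base x).2.1.2 := by
  obtain ⟨t | e | f, ⟨S₁, S₂⟩, hS⟩ := x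
  · exact (congrFun (congrFun (hc.dmat_vert t) S₁) S₂).symm
  · exact (congrFun (congrFun (hc.dmat_edge e) S₁) S₂).symm
  · exact Empty.elim f

theorem Compatible.d_spun (hc : c.Compatible) (hT : ∀ t ∈ T, t ≤ 0)
    {g : Gen Λ (lineDecomp Λ T) → Alg Λ (lineDecomp Λ T)} (hg : ∀ x ∈ axisGens Λ T, g x =
      (coneU (gmat Λ (lineDecomp Λ T) x.1) MatchedPair heights - mone _ _ :
        Matrix _ _ (Alg Λ (lineDecomp Λ T))) x.2.1.1 x.2.1.2)
    (x : Gen Λ (lineDecomp Λ T)) (hx : ∀ t : T, x.1 = Cell.vert t → t.1 ≠ 0) :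
    c.spunDeriv g (dmat Λ (lineDecomp Λ T) x.1 x.2.1.1 x.2.1.2) =
      dmat (frontSpin Λ) (spunDecomp Λ T heights) (c.spun x hx).1 (c.spun x hx).2.1.1
        (c.spun x hx).2.1.2 := by
  obtain ⟨t | e | f, ⟨S₁, S₂⟩, hS⟩ := x
  · exact (congrFun (congrFun (hc.dmat_spunVert g ⟨t, hx t rfl⟩) S₁) S₂).symm
  · exact (congrFun (congrFun (hc.dmat_spunEdge g hT hg e) S₁) S₂).symm
  · exact Empty.elim f

/-- The derivation `Γ`, followed by the bijection of generators. -/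
theorem map_suspΓ {m : ℕ} (μ : J1 ℝ → ZMod m)
    (g : Gen Λ (lineDecomp Λ T) → Alg Λ (lineDecomp Λ T)) (a : Alg Λ (lineDecomp Λ T)) :
    mapGen c.genEquiv (suspΓ (cellularDGA Λ (lineDecomp Λ T) μ) (axisGens Λ T) g a) =
      c.spunDeriv g a := by
  refine (map_derivAlong (mapGen c.genEquiv) _ _ a).trans ?_
  refine congrFun (congrArg₂ derivAlong ?_ ?_) a
  · funext x
    exact mapGen_ι _ _
  · funext x
    by_cases hx : x ∈ axisGens Λ T
    · refine ((congrArg (mapGen c.genEquiv) (dif_neg (not_not.2 hx))).trans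
        (mapGen_mapGen _ _ _)).trans ?_
      rw [dif_neg (not_not.2 hx)]
      rfl
    · refine ((congrArg (mapGen c.genEquiv) (dif_pos hx)).trans (mapGen_ι _ _)).trans ?_
      rw [dif_pos hx]
      rfl

end SheetCorr

/-- The common form of the three parts. The derivation uses `g` on `ℒ` only, so agreement with `U -
I` there suffices. -/
theorem exists_isBasedIso {Λ : Leg} {T : Finset ℝ} (h : TameFront Λ.carrier T) (heights : List ℝ)
    {m : ℕ} {μ : J1 ℝ → ZMod m} {ν : J1 ℂ → ZMod m} (hμ : IsMaslov Λ.carrier μ)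
    (hν : IsMaslov (frontSpin Λ.carrier) ν)
    (hμν : ∀ p ∈ Λ.carrier, p.1 < 0 → p ∉ foldLocus Λ.carrier → ν (spinPt 1 p) = μ p)
    {ℒ : Set (Λ.dga T μ).Gen} (hℒ : ℒ = Λ.axisGens T μ) {g : (Λ.dga T μ).Gen → (Λ.dga T μ).Alg}
    (hg : ∀ x ∈ ℒ, g x = Λ.axisΓ T μ heights x) :
    ∃ φ : (modifiedSuspension (Λ.dga T μ) ℒ g).Gen ≃ (Λ.spunDga T heights ν).Gen,
      IsBasedIso φ ∧ IsCanonical ℒ φ := by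
  subst hℒ
  obtain ⟨c, hgeo⟩ := h.exists_sheetCorr heights
  have hc := hgeo.compatible h
  refine ⟨c.genEquiv, isBasedIso_of_gens _ ?_ ?_, fun x => hgeo.isBase h x, fun x => hgeo.isSpun _ _⟩
  · rintro (x | x)
    · exact hgeo.deg_base h hμ hν hμν x
    · exact hgeo.deg_spun h hμ hν hμν x.1 _
  · rintro (x | x)
    · exact (mapGen_mapGen _ _ _).trans (hc.d_base x)
    · exact (SheetCorr.map_suspΓ μ g _).trans
        (hc.d_spun (fun t ht => h.nonpos_of_mem ht) hg x.1 (SheetCorr.ne_zero_of_notMem x.2))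

/-- 0-cells lie in the base projection of `Λ`, which misses `0` if there are only circles. -/
theorem Leg.axisGens_eq_empty {Λ : Leg} {T : Finset ℝ} (hT : Λ.Compatible T) {m : ℕ}
    (μ : J1 ℝ → ZMod m) (h0 : Λ.numArcs = 0) : Λ.axisGens T μ = ∅ := by
  refine eq_empty_of_forall_notMem ?_
  rintro x ⟨t, ht, -⟩
  obtain ⟨p, hp, hpt⟩ := hT.1 t.2
  rcases hp with hp | hp
  · obtain ⟨i, s, rfl⟩ := mem_iUnion.1 hp
    exact (Λ.circle_neg i s).ne (hpt.trans ht)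
  · obtain ⟨j, -⟩ := mem_iUnion.1 hp
    exact (h0 ▸ j).elim0

theorem Leg.ListsMatchedEnds.eq_nil {Λ : Leg} {heights : List ℝ} (hh : Λ.ListsMatchedEnds heights)
    (hd : Λ.DistinctEnds) : heights = [] := by
  refine List.eq_nil_iff_forall_not_mem.2 fun z hz => ?_
  obtain ⟨p, hp, q, hq, hne, hpx, hqx, hpz, hqz⟩ := (hh.2 z).1 hz
  exact hne (hd p hp q hq hpx hqx (hpz.trans hqz.symm))

theorem Leg.axisΓ_nil (Λ : Leg) (T : Finset ℝ) {m : ℕ} (μ : J1 ℝ → ZMod m) :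
    Λ.axisΓ T μ [] = fun _ => 0 := by
  funext x
  exact congrFun (congrFun (sub_self (mone _ _ : Matrix _ _ (Alg Λ.carrier
    (lineDecomp Λ.carrier T)))) _) _

end CellularDGA

end

/-! ### The proposition -/

theorem proposition5
    (Λ : CellularDGA.Leg) (hglue : Λ.GluesToReflection) (hgen : Λ.GenericFront)
    (T : Finset ℝ) (hT : Λ.Compatible T)
    (heights : List ℝ) (hheights : Λ.ListsMatchedEnds heights)
    (m : ℕ) (μ : CellularDGA.J1 ℝ → ZMod m) (ν : CellularDGA.J1 ℂ → ZMod m)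
    (hμ : CellularDGA.IsMaslov Λ.carrier μ)
    (hν : CellularDGA.IsMaslov (CellularDGA.frontSpin Λ.carrier) ν)
    (hμν : ∀ p ∈ Λ.carrier, p.1 < 0 → p ∉ CellularDGA.foldLocus Λ.carrier →
      ν (CellularDGA.spinPt 1 p) = μ p) :
    (Λ.numArcs = 0 →
      ∃ φ : (CellularDGA.suspension (Λ.dga T μ)).Gen ≃ (Λ.spunDga T heights ν).Gen,
        CellularDGA.IsBasedIso φ ∧ CellularDGA.IsCanonical ∅ φ) ∧
    (Λ.numArcs ≠ 0 → Λ.DistinctEnds →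
      ∃ φ : (CellularDGA.relSuspension (Λ.dga T μ) (Λ.axisGens T μ)).Gen ≃
          (Λ.spunDga T heights ν).Gen,
        CellularDGA.IsBasedIso φ ∧ CellularDGA.IsCanonical (Λ.axisGens T μ) φ) ∧
    (Λ.numArcs ≠ 0 →
      ∃ φ : (CellularDGA.modifiedSuspension (Λ.dga T μ) (Λ.axisGens T μ)
          (Λ.axisΓ T μ heights)).Gen ≃ (Λ.spunDga T heights ν).Gen,
        CellularDGA.IsBasedIso φ ∧ CellularDGA.IsCanonical (Λ.axisGens T μ) φ) := by
  have h := Λ.tameFront hglue hgen hT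
  refine ⟨fun h0 => ?_, fun _ hd => ?_, fun _ => ?_⟩
  · have hℒ := CellularDGA.Leg.axisGens_eq_empty hT μ h0
    -- No generator lies above the axis, so there is no value of `Γ` to check.
    exact CellularDGA.exists_isBasedIso h heights hμ hν hμν hℒ.symm (fun x hx => hx.elim)
  · refine CellularDGA.exists_isBasedIso h heights hμ hν hμν rfl (fun x _ => ?_)
    -- Without matched pairs `U` is the empty product, so `U - I = 0`.
    rw [CellularDGA.Leg.ListsMatchedEnds.eq_nil hheights hd, Λ.axisΓ_nil]
  · exact CellularDGA.exists_isBasedIso h heights hμ hν hμν rfl (fun _ _ => rfl)
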